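/- **Setting.** Consider the linear system $x_{t+1}=Ax_t+Bu_t$, $y_t=Cx_t+Du_t$ with $x_t\in\mathbb R^n$, $u_t\in\mathbb R^m$, $y_t\in\mathbb R^p$. Let $\ell\ge1$ be such that $\operatorname{col}(C,CA,\dots,CA^{\ell-1})$ has rank $n$, and let $\xi_t=\operatorname{col}(u_{t-\ell},\dots,u_{t-1},y_{t-\ell},\dots,y_{t-1})$ be the extended state. Let $(\tilde A,\tilde B,\tilde C,\tilde D)$ be matrices with $\xi_{t+1}=\tilde A\xi_t+\tilde Bu_t$ and $y_t=\tilde C\xi_t+\tilde Du_t$ along every trajectory of the system. Let $(x^F,u^F,y^F)$ be an equilibrium, $\xi^F=\operatorname{col}(u^F,\dots,u^F,y^F,\dots,y^F)$, let $\mathcal U\subseteq\mathbb R^m$ and $\mathcal Y\subseteq\mathbb R^p$ be convex, and let $h(u,y)=\|u-u^F\|_R^2+\|y-y^F\|_Q^2$ with $R\succ0$, $Q\succeq0$. The infinite-horizon problem is $$\min_{u_0,u_1,\dots}\ \sum_{k\ge0}h(u_k,y_k)\quad\text{s.t. } \xi_0=\xi^S,\ \xi_{k+1}=\tilde A\xi_k+\tilde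 Bu_k,\ y_k=\tilde C\xi_k+\tilde Du_k,\ u_k\in\mathcal U,\ y_k\in\mathcal Y\ \ (k\ge0).\tag{1}$$ Assume that $(A,B)$ is stabilizable, that $(Q^{1/2}\tilde C,\tilde A)$ is detectable, and that (1) has a feasible point of finite cost. **Trajectories.** A trajectory $w$ of the system has samples at the times $-\ell,\dots,T-1$ with $0<T\le\infty$, and $\xi_0=\xi^S$. Its cost-to-go is $J^w(\xi_t)=\sum_{k=t}^{T-1}h(u_k,y_k)\in[0,\infty]$. It is *safe* if $u_t\in\mathcal U$, $y_t\in\mathcal Y$ for $0\le t<T$, and $\xi_T=\xi^F$ if $T<\infty$, respectively $\xi_t\to\xi^F$ and $J^w(\xi_0)<\infty$ if $T=\infty$. **The scheme.** Let $\bar N\ge\ell$ be the desired horizon. Iteration $i$ produces a measured trajectory $w^i=(u^i,y^i)$ with length $T^i$, and stores a trajectory of the system from $\xi^S$ for the safe set; the run may have finitely or infinitely many iterations. Iteration $0$ stores $w^0$, which is safe, and for some $N_0\ge\ell$ the depth-$(\ell+N_0)$ input–output Hankel matrix of $w^0$ has rank $m(\ell+N_0)+n$. Let $\mathrm{io}\mathcal{CS}^j$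 be the convex hull of all extended states (times $0\le t\le T$, $t<\infty$) of the safe trajectories stored in iterations $i<j$, and let $P^j(\xi)$ be the infimum of the corresponding convex combinations of costs-to-go over all representations of $\xi$ as a finite convex combination of these states. The horizon $\bar N$ *is reached at iteration $\bar j$* (at time $\bar t\le T^{\bar j}$): the matrix $\mathcal H$, whose columns are all length-$(\ell+\bar N)$ windows of $w^0,\dots,w^{\bar j-1}$ together with those of $w^{\bar j}$ that end before time $\bar t$, has rank $m(\ell+\bar N)+n$. In the iterations $1,\dots,\bar j$ the inputs and the stored trajectories are arbitrary (any exploration strategy). Every iteration $j>\bar j$ stores $w^j$, ends at $\xi^j_{T^j}=\xi^F$ if $T^j<\infty$, and at each time $t<T^j$ applies the first input $u_0$ of an optimal solution $(g,u,y)$ of $$\min\ \sum_{k=0}^{\bar N-1}h(u_k,y_k)+P^j(\xi_{\bar N})\quad\text{s.t. } \mathcal Hg=\text{the window with past }\xi^j_t\text{ and future }(u,y),\ \ \xi_{\bar N}\in\mathrm{io}\mathcal{CS}^j,\ u_k\in\mathcal U,\ y_k\in\mathcal Y\ (0\le k<\bar N),$$ where $\xi_{\bar N}$ consists of the last $\ell$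 entries of $u$ and of $y$. Write $J^j(\xi^S)=\sum_{k=0}^{T^j-1}h(u^j_k,y^j_k)$. **LICQ.** Let $\mathcal U=\{u: g_i(u)\le0\ \forall i\}$ and $\mathcal Y=\{y: q_i(y)\le0\ \forall i\}$ with finitely many $C^1$ functions. A sequence $(x_t,u_t)_{t\ge0}$ *satisfies LICQ* if $\bar N>\ell$ and for $H\in\{\bar N-\ell,\ \bar N-\ell-1\}$ and every $t\ge0$ the following holds at the point $(x_t,\dots,x_{t+H},u_t,\dots,u_{t+H-1})$. Consider the $H$-step optimal control problem in the variables $(z_0,\dots,z_H,v_0,\dots,v_{H-1})$ with equality constraints $z_0=x_t$, $z_{k+1}=Az_k+Bv_k$, $z_H=x_{t+H}$ and inequality constraints $g_i(v_k)\le0$, $q_i(Cz_k+Dv_k)\le0$ (those $q_i$-constraints at $k=0$ that do not depend on $v_0$, i.e. $q_i(y+Dv)=q_i(y)$ for all $y,v$, are dropped). Then the gradients of the equality constraints and of the active inequality constraints are linearly independent. **Theorem.** Suppose that the desired horizon $\bar N$ is reached at iteration $\bar j$. Then $J^{j}(\xi^S)\ge J^{j+1}(\xi^S)$ for all $j>\bar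 j$ (such that iteration $j+1$ is carried out). Moreover, if $u^{j+1}=u^j$ for some $j>\bar j$, and if LICQ, for such a description of $\mathcal U$ and $\mathcal Y$, is satisfied by the state–input sequence of iteration $j$ (continued by $(x^F,u^F)$ after time $T^j$ if $T^j<\infty$) and by its limit, the constant sequence $(x^F,u^F)$ (automatic if $T^j<\infty$), then $u^j$ (continued by $u^F$ after time $T^j-1$ if $T^j<\infty$) is an optimal solution of (1). -/

import Mathlib

open Filter Topology
open scoped ENNReal

noncomputable section

/-- The system `x⁺ = A x + B u`, `y = C x + D u`. -/
structure Plant (n m p : ℕ) where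
  A : Matrix (Fin n) (Fin n) ℝ
  B : Matrix (Fin n) (Fin m) ℝ
  C : Matrix (Fin p) (Fin n) ℝ
  D : Matrix (Fin p) (Fin m) ℝ

/-- Coordinates of an extended state: `ℓ` past inputs followed by `ℓ` past outputs. -/
abbrev ExtIdx (ℓ m p : ℕ) : Type := (Fin ℓ × Fin m) ⊕ (Fin ℓ × Fin p)

/-- Extended states `ξ = col(u_{t-ℓ}, …, u_{t-1}, y_{t-ℓ}, …, y_{t-1})`. -/
abbrev ExtState (ℓ m p : ℕ) : Type := ExtIdx ℓ m p → ℝ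

/-- Stack `ℓ` inputs and `ℓ` outputs. -/
def mkExt {ℓ m p : ℕ} (u : Fin ℓ → Fin m → ℝ) (y : Fin ℓ → Fin p → ℝ) : ExtState ℓ m p :=
  Sum.elim (fun a => u a.1 a.2) (fun a => y a.1 a.2)

/-- The inputs stored in an extended state. -/
def ExtState.past_u {ℓ m p : ℕ} (ξ : ExtState ℓ m p) : Fin ℓ → Fin m → ℝ := fun i a => ξ (Sum.inl (i, a))

/-- The outputs stored in an extended state. -/
def ExtState.past_y {ℓ m p : ℕ} (ξ : ExtState ℓ m p) : Fin ℓ → Fin p → ℝ := fun i a => ξ (Sum.inr (i, a))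

/-- A trajectory over the times `-ℓ, …, T - 1`, where `T = ⊤` is allowed. The sample with index `k`
belongs to time `k - ℓ`; so the input at time `t` is `u (t + ℓ)`. Samples at times `≥ T` (for
the state: `> T`) are irrelevant. -/
structure Traj (n m p : ℕ) where
  x : ℕ → Fin n → ℝ
  u : ℕ → Fin m → ℝ
  y : ℕ → Fin p → ℝ
  T : ℕ∞

/-- The extended state at time `t`: samples of the times `t - ℓ, …, t - 1`. -/
def Traj.ext {n m p : ℕ} (ℓ : ℕ) (w : Traj n m p) (t : ℕ) : ExtState ℓ m p :=
  mkExt (fun i => w.u (t + i)) (fun i => w.y (t + i))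

/-- `w` is a trajectory of the plant, on the times `-ℓ, …, T - 1`. -/
def Plant.Generates {n m p : ℕ} (S : Plant n m p) (ℓ : ℕ) (w : Traj n m p) : Prop :=
  0 < w.T ∧ ∀ k : ℕ, (k : ℕ∞) < ℓ + w.T →
    w.x (k + 1) = S.A.mulVec (w.x k) + S.B.mulVec (w.u k) ∧
    w.y k = S.C.mulVec (w.x k) + S.D.mulVec (w.u k)

/-- The observability matrix `col(C, C A, …, C A^{ℓ-1})`. -/
def Plant.obsMatrix {n m p : ℕ} (S : Plant n m p) (ℓ : ℕ) : Matrix (Fin ℓ × Fin p) (Fin n) ℝ :=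
  Matrix.of fun a => (S.C * S.A ^ (a.1 : ℕ)) a.2

/-- All (complex) eigenvalues lie in the open unit disc. -/
def IsSchur {ι : Type} [Fintype ι] [DecidableEq ι] (M : Matrix ι ι ℝ) : Prop :=
  ∀ z ∈ spectrum ℂ (M.map (algebraMap ℝ ℂ)), ‖z‖ < 1

/-- `(A, B)` is stabilizable. -/
def Stabilizable {ι κ : Type} [Fintype ι] [DecidableEq ι] [Fintype κ]
    (A : Matrix ι ι ℝ) (B : Matrix ι κ ℝ) : Prop :=
  ∃ K : Matrix κ ι ℝ, IsSchur (A + B * K)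

/-- `(C, A)` is detectable. -/
def Detectable {ι κ : Type} [Fintype ι] [DecidableEq ι] [Fintype κ]
    (C : Matrix κ ι ℝ) (A : Matrix ι ι ℝ) : Prop :=
  ∃ L : Matrix ι κ ℝ, IsSchur (A + L * C)

/-- The data of the repetitive control task: the plant, a representation `(At, Bt, Ct, Dt)` with
the extended state as its state, weights, constraint sets, the target equilibrium, the starting
extended state, and the desired prediction horizon `N`. -/
structure RepTask (n m p ℓ : ℕ) where
  plant : Plant n m p
  At : Matrix (ExtIdx ℓ m p) (ExtIdx ℓ m p) ℝ
  Bt : Matrix (ExtIdx ℓ m p) (Fin m) ℝ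
  Ct : Matrix (Fin p) (ExtIdx ℓ m p) ℝ
  Dt : Matrix (Fin p) (Fin m) ℝ
  Q : Matrix (Fin p) (Fin p) ℝ
  R : Matrix (Fin m) (Fin m) ℝ
  U : Set (Fin m → ℝ)
  Y : Set (Fin p → ℝ)
  xF : Fin n → ℝ
  uF : Fin m → ℝ
  yF : Fin p → ℝ
  ξS : ExtState ℓ m p
  N : ℕ
  hℓ : 0 < ℓ
  hN : ℓ ≤ N

namespace RepTask

variable {n m p ℓ : ℕ} (P : RepTask n m p ℓ)

/-- The target extended state `col(uF, …, uF, yF, …, yF)`. -/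
def ξF : ExtState ℓ m p := mkExt (fun _ => P.uF) (fun _ => P.yF)

/-- The stage cost `‖u - uF‖²_R + ‖y - yF‖²_Q`. -/
def stageCost (u : Fin m → ℝ) (y : Fin p → ℝ) : ℝ :=
  (u - P.uF) ⬝ᵥ P.R.mulVec (u - P.uF) + (y - P.yF) ⬝ᵥ P.Q.mulVec (y - P.yF)

/-- `(At, Bt, Ct, Dt)` reproduces every trajectory of the plant. -/
def IsExtendedRealization : Prop :=
  ∀ w : Traj n m p, w.T = ⊤ → P.plant.Generates ℓ w → ∀ t : ℕ,
    w.ext ℓ (t + 1) = P.At.mulVec (w.ext ℓ t) + P.Bt.mulVec (w.u (t + ℓ)) ∧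
    w.y (t + ℓ) = P.Ct.mulVec (w.ext ℓ t) + P.Dt.mulVec (w.u (t + ℓ))

/-! ### The infinite-horizon problem -/

/-- The extended states obtained from `ξS` with inputs `u 0, u 1, …`. -/
def rollout (u : ℕ → Fin m → ℝ) : ℕ → ExtState ℓ m p
  | 0 => P.ξS
  | k + 1 => P.At.mulVec (rollout u k) + P.Bt.mulVec (u k)

/-- The outputs obtained from `ξS` with inputs `u 0, u 1, …`. -/
def output (u : ℕ → Fin m → ℝ) (k : ℕ) : Fin p → ℝ :=
  P.Ct.mulVec (P.rollout u k) + P.Dt.mulVec (u k)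

def InfFeasible (u : ℕ → Fin m → ℝ) : Prop := ∀ k, u k ∈ P.U ∧ P.output u k ∈ P.Y

def infCost (u : ℕ → Fin m → ℝ) : ℝ≥0∞ :=
  ∑' k, ENNReal.ofReal (P.stageCost (u k) (P.output u k))

/-- `u` is a minimizer of the infinite-horizon optimal control problem. -/
def SolvesInf (u : ℕ → Fin m → ℝ) : Prop :=
  P.InfFeasible u ∧ ∀ u', P.InfFeasible u' → P.infCost u ≤ P.infCost u'

/-- The standing assumptions. -/
structure Standing : Prop where
  R_pos : P.R.PosDef
  Q_nonneg : P.Q.PosSemidef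
  U_convex : Convex ℝ P.U
  Y_convex : Convex ℝ P.Y
  /-- observability, with `ℓ` an upper bound on the lag -/
  observable : (P.plant.obsMatrix ℓ).rank = n
  stabilizable : Stabilizable P.plant.A P.plant.B
  realization : P.IsExtendedRealization
  /-- `(Q^{1/2} Ct, At)` is detectable -/
  detectable : ∃ Qh : Matrix (Fin p) (Fin p) ℝ,
    Qh.PosSemidef ∧ Qh * Qh = P.Q ∧ Detectable (Qh * P.Ct) P.At
  target_state : P.xF = P.plant.A.mulVec P.xF + P.plant.B.mulVec P.uF
  target_output : P.yF = P.plant.C.mulVec P.xF + P.plant.D.mulVec P.uF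
  finite_cost : ∃ u, P.InfFeasible u ∧ P.infCost u ≠ ⊤

/-! ### Costs, safe trajectories, safe set and terminal cost -/

/-- The cost-to-go of a trajectory from time `t`: the sum of the stage costs at `t, …, T - 1`. -/
def costToGo (w : Traj n m p) (t : ℕ) : ℝ≥0∞ := by
  classical
  exact ∑' k : ℕ, if ((t + k : ℕ) : ℕ∞) < w.T then
    ENNReal.ofReal (P.stageCost (w.u (t + k + ℓ)) (w.y (t + k + ℓ))) else 0

/-- If the trajectory is finite, it ends at the target. -/
def EndsAtTarget (w : Traj n m p) : Prop := ∀ τ : ℕ, w.T = τ → w.ext ℓ τ = P.ξF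

/-- Safe trajectories: the constraints hold at the times `0, …, T - 1`, and the trajectory reaches
the target at time `T` or, if `T = ⊤`, converges to the target with finite cost. -/
def Safe (w : Traj n m p) : Prop :=
  (∀ t : ℕ, (t : ℕ∞) < w.T → w.u (t + ℓ) ∈ P.U ∧ w.y (t + ℓ) ∈ P.Y) ∧
  P.EndsAtTarget w ∧
  (w.T = ⊤ → Tendsto (w.ext ℓ) atTop (𝓝 P.ξF) ∧ P.costToGo w 0 ≠ ⊤)

/-- `γ` is a convex combination, equal to `ξ`, of the extended states at the times `0, …, T` along
the safe ones among the trajectories `W i`, `i < j`. The weight `γ (i, t)` belongs to time `t` of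
trajectory `i`. -/
def IsWeights (W : ℕ → Traj n m p) (j : ℕ) (γ : ℕ × ℕ →₀ ℝ) (ξ : ExtState ℓ m p) : Prop :=
  (∀ c, 0 ≤ γ c) ∧
  (∀ c ∈ γ.support, c.1 < j ∧ P.Safe (W c.1) ∧ (c.2 : ℕ∞) ≤ (W c.1).T) ∧
  (γ.sum fun _ a => a) = 1 ∧
  (γ.sum fun c a => a • (W c.1).ext ℓ c.2) = ξ

/-- The input-output convex safe set at iteration `j`. -/
def ioCS (W : ℕ → Traj n m p) (j : ℕ) : Set (ExtState ℓ m p) := {ξ | ∃ γ, P.IsWeights W j γ ξ}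

/-- The terminal cost at iteration `j` (it is `⊤` outside the safe set). -/
def termCost (W : ℕ → Traj n m p) (j : ℕ) (ξ : ExtState ℓ m p) : ℝ≥0∞ :=
  ⨅ (γ : ℕ × ℕ →₀ ℝ) (_ : P.IsWeights W j γ ξ),
    γ.sum fun c a => ENNReal.ofReal a * P.costToGo (W c.1) c.2

/-! ### Hankel data -/

/-- The column of a depth-`L` input-output Hankel matrix that starts at sample `s`. -/
def column (w : Traj n m p) (L s : ℕ) : (Fin L → Fin m → ℝ) × (Fin L → Fin p → ℝ) :=
  (fun k => w.u (s + k), fun k => w.y (s + k))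

/-- The Hankel matrix of depth `ℓ + N'` of the single trajectory `w` has rank `m (ℓ + N') + n`. -/
def HankelRank (w : Traj n m p) (N' : ℕ) : Prop :=
  Module.finrank ℝ (Submodule.span ℝ
    {c | ∃ s : ℕ, ((s + N' : ℕ) : ℕ∞) ≤ w.T ∧ c = column w (ℓ + N') s}) = m * (ℓ + N') + n

/-- Labels `(i, s)` of the columns collected up to time `tb` of iteration `jb`: all windows of depth
`ℓ + N` of the iterations `i < jb`, and those of iteration `jb` that end before time `tb`. -/
def IsColumn (M : ℕ → Traj n m p) (jb tb : ℕ) (c : ℕ × ℕ) : Prop :=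
  (c.1 < jb ∧ ((c.2 + P.N : ℕ) : ℕ∞) ≤ (M c.1).T) ∨ (c.1 = jb ∧ c.2 + P.N ≤ tb)

/-- The collected data matrix of depth `ℓ + N` has rank `m (ℓ + N) + n`. -/
def DataRank (M : ℕ → Traj n m p) (jb tb : ℕ) : Prop :=
  Module.finrank ℝ (Submodule.span ℝ
    {v | ∃ c, P.IsColumn M jb tb c ∧ v = column (M c.1) (ℓ + P.N) c.2}) = m * (ℓ + P.N) + n

/-! ### The finite-horizon problem solved at each time step -/

/-- Decision variables: the combination `g` of the data columns, and the predicted inputs and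
outputs. -/
structure Decision (P : RepTask n m p ℓ) where
  g : ℕ × ℕ →₀ ℝ
  u : Fin P.N → Fin m → ℝ
  y : Fin P.N → Fin p → ℝ

/-- The past inputs followed by the predicted ones, and likewise for the outputs. -/
def Decision.full {P : RepTask n m p ℓ} (d : P.Decision) (ξ : ExtState ℓ m p) :
    (Fin (ℓ + P.N) → Fin m → ℝ) × (Fin (ℓ + P.N) → Fin p → ℝ) :=
  (Fin.append ξ.past_u d.u, Fin.append ξ.past_y d.y)

/-- The predicted extended state after `N` steps: the last `ℓ` predicted inputs and outputs. -/
def Decision.terminal {P : RepTask n m p ℓ} (d : P.Decision) : ExtState ℓ m p :=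
  mkExt
    (fun i => d.u ⟨P.N - ℓ + i, by have := P.hN; have := i.isLt; omega⟩)
    (fun i => d.y ⟨P.N - ℓ + i, by have := P.hN; have := i.isLt; omega⟩)

/-- Feasibility at extended state `ξ` of iteration `j`, with prediction model given by the data
columns of `M` up to `(jb, tb)` and safe set given by `W`. -/
def Feasible (M W : ℕ → Traj n m p) (jb tb j : ℕ) (ξ : ExtState ℓ m p) (d : P.Decision) : Prop :=
  (∀ c ∈ d.g.support, P.IsColumn M jb tb c) ∧
  (d.g.sum fun c a => a • column (M c.1) (ℓ + P.N) c.2) = d.full ξ ∧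
  d.terminal ∈ P.ioCS W j ∧
  ∀ k, d.u k ∈ P.U ∧ d.y k ∈ P.Y

/-- The objective: predicted stage costs plus terminal cost. -/
def objective (W : ℕ → Traj n m p) (j : ℕ) (d : P.Decision) : ℝ≥0∞ :=
  (∑ k, ENNReal.ofReal (P.stageCost (d.u k) (d.y k))) + P.termCost W j (d.terminal)

/-- `d` is an optimal solution of the finite-horizon problem. -/
def IsOptimal (M W : ℕ → Traj n m p) (jb tb j : ℕ) (ξ : ExtState ℓ m p) (d : P.Decision) : Prop :=
  P.Feasible M W jb tb j ξ d ∧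
  ∀ d', P.Feasible M W jb tb j ξ d' → P.objective W j d ≤ P.objective W j d'

/-- A run of the scheme through the iterations `j ≤ last`. `M i` is the trajectory measured in
iteration `i`, and `W i` is the one that iteration `i` contributes to the safe set (in exploration
iterations these may differ). Up to iteration `jb`, in which the desired horizon is reached (at
time `tb`), nothing is required of the way in which inputs are chosen. Afterwards each iteration is
the receding-horizon closed loop. -/
structure IsRun (M W : ℕ → Traj n m p) (jb tb : ℕ) (last : ℕ∞) : Prop where
  measured : ∀ i : ℕ, (i : ℕ∞) ≤ last → P.plant.Generates ℓ (M i) ∧ (M i).ext ℓ 0 = P.ξS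
  stored : ∀ i : ℕ, (i : ℕ∞) ≤ last → P.plant.Generates ℓ (W i) ∧ (W i).ext ℓ 0 = P.ξS
  initial_stored : W 0 = M 0
  initial_safe : P.Safe (M 0)
  initial_rank : ∃ N₀, ℓ ≤ N₀ ∧ HankelRank (ℓ := ℓ) (M 0) N₀
  jb_le : (jb : ℕ∞) ≤ last
  tb_le : (tb : ℕ∞) ≤ (M jb).T
  reached : P.DataRank M jb tb
  later_stored : ∀ j : ℕ, jb < j → (j : ℕ∞) ≤ last → W j = M j
  later_end : ∀ j : ℕ, jb < j → (j : ℕ∞) ≤ last → P.EndsAtTarget (M j)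
  later_input : ∀ j : ℕ, jb < j → (j : ℕ∞) ≤ last → ∀ t : ℕ, (t : ℕ∞) < (M j).T →
    ∃ d, P.IsOptimal M W jb tb j ((M j).ext ℓ t) d ∧
      (M j).u (t + ℓ) = d.u ⟨0, lt_of_lt_of_le P.hℓ P.hN⟩

/-- Inputs at the times `0, 1, …`, continued by `uF` after the end of the trajectory. -/
def inputs (w : Traj n m p) (t : ℕ) : Fin m → ℝ := by
  classical
  exact if (t : ℕ∞) < w.T then w.u (t + ℓ) else P.uF

/-- States at the times `0, 1, …`, continued by `xF` after the end of the trajectory. -/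
def states (w : Traj n m p) (t : ℕ) : Fin n → ℝ := by
  classical
  exact if (t : ℕ∞) ≤ w.T then w.x (t + ℓ) else P.xF

end RepTask

/-! ### The linear independence constraint qualification -/

/-- LICQ at `z` for equality constraints `e i = 0` and inequality constraints `f k ≤ 0`: the
gradients of the equality constraints and of the active inequality constraints are linearly
independent. -/
def LICQ {E ι κ : Type} [NormedAddCommGroup E] [NormedSpace ℝ E]
    (e : ι → E → ℝ) (f : κ → E → ℝ) (z : E) : Prop :=
  LinearIndependent ℝ (Sum.elim (fun i => fderiv ℝ (e i) z)
    (fun k : {k : κ // f k z = 0} => fderiv ℝ (f k.1) z))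

namespace RepTask

variable {n m p ℓ : ℕ} (P : RepTask n m p ℓ)

/-- States `x_0, …, x_H` and inputs `u_0, …, u_{H-1}` of an `H`-step optimal control problem. -/
abbrev OcpVar (n m H : ℕ) : Type := (Fin (H + 1) → Fin n → ℝ) × (Fin H → Fin m → ℝ)

/-- Equality constraints of the `H`-step problem with prescribed end points `a`, `b`: initial state,
dynamics, final state. -/
def ocpEq (H : ℕ) (a b : Fin n → ℝ) :
    (Fin n ⊕ (Fin H × Fin n)) ⊕ Fin n → OcpVar n m H → ℝ :=
  Sum.elim
    (Sum.elim (fun i z => z.1 0 i - a i)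
      (fun c z => z.1 c.1.succ c.2 -
        (P.plant.A.mulVec (z.1 c.1.castSucc) + P.plant.B.mulVec (z.2 c.1)) c.2))
    (fun i z => z.1 (Fin.last H) i - b i)

/-- Labels of the output constraints of the `H`-step problem. At the first step the state is
prescribed, so an output constraint that does not involve the input there constrains no decision
variable and is not listed. -/
abbrev OcpOutIdx {κ : Type} (H : ℕ) (q : κ → (Fin p → ℝ) → ℝ) : Type :=
  {c : Fin H × κ // (c.1 : ℕ) = 0 → ∃ y v, q c.2 (y + P.plant.D.mulVec v) ≠ q c.2 y}

/-- Inequality constraints `g i (u_k) ≤ 0` and `q i (C x_k + D u_k) ≤ 0` of the `H`-step problem. -/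
def ocpIneq {ι κ : Type} (H : ℕ) (g : ι → (Fin m → ℝ) → ℝ) (q : κ → (Fin p → ℝ) → ℝ) :
    (Fin H × ι) ⊕ P.OcpOutIdx H q → OcpVar n m H → ℝ :=
  Sum.elim (fun c z => g c.2 (z.2 c.1))
    (fun c z => q c.1.2
      (P.plant.C.mulVec (z.1 c.1.1.castSucc) + P.plant.D.mulVec (z.2 c.1.1)))

/-- LICQ, at each window of `H` consecutive steps of the trajectory `(x, u)`, for the optimal
control problem that steers the first state of the window to the last one. -/
def WindowLICQ {ι κ : Type} (g : ι → (Fin m → ℝ) → ℝ) (q : κ → (Fin p → ℝ) → ℝ) (H : ℕ)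
    (x : ℕ → Fin n → ℝ) (u : ℕ → Fin m → ℝ) : Prop :=
  ∀ t : ℕ, LICQ (P.ocpEq H (x t) (x (t + H))) (P.ocpIneq H g q)
    ((fun k => x (t + k), fun k => u (t + k)) : OcpVar n m H)

/-- The LICQ condition along `(x, u)`. Fixing the terminal extended state of a horizon-`N` problem
fixes the last `ℓ` inputs and the state before them, so that `N - ℓ` steps are free; two consecutive
such problems share `N - ℓ - 1` free steps. LICQ is required for both kinds of windows. -/
def LICQAlong {ι κ : Type} (g : ι → (Fin m → ℝ) → ℝ) (q : κ → (Fin p → ℝ) → ℝ)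
    (x : ℕ → Fin n → ℝ) (u : ℕ → Fin m → ℝ) : Prop :=
  P.WindowLICQ g q (P.N - ℓ) x u ∧ P.WindowLICQ g q (P.N - ℓ - 1) x u

end RepTask

end

noncomputable section

/-! The data columns lie in the space of input-output sequences of length `ℓ + N`, whose dimension
is at most `m * (ℓ + N) + n`. The rank condition therefore makes them span it
(`IsRun.span_columns`), and the data-driven problem is a model-based one whose terminal ingredients
are the convex hull of stored extended states and the convexified cost-to-go.

Monotonicity is a sandwich. Below: given a prediction and any representation of its terminal state
by stored states, append the same convex combination of the inputs applied there. By linearity and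
convexity the shifted prediction is feasible, and the optimal value drops by at least the stage cost
(`IsRun.costAt_add_objective_le`); summing, the realized cost-to-go is at most the optimal value.
Above: the stored iteration `j` is itself a candidate in iteration `j + 1`, so the optimal value is
at most its cost-to-go. Comparison with the initial trajectory also shows that every later iteration
has finite cost, and detectability turns this into convergence, so these iterations are safe.

If the inputs repeat, the two bounds coincide at each time. Competitors that leave the trajectory
and rejoin it after `N - ℓ` steps share its finite tail cost, so each window of `N - ℓ` steps is
optimal for its end points (`IsRun.window_optimal`). LICQ yields multipliers for each window; LICQ
on the overlap of consecutive windows makes the multipliers of the dynamics agree there, so they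
glue to one costate sequence, and LICQ at the limit keeps that sequence eventually bounded
(`exists_costate`). Convexity of the stage cost and of the constraint sets then gives, for every
admissible competitor, an inequality of partial costs up to a boundary term, costate times state
difference (`sum_stage_le`). A competitor of finite cost converges to the same target, so the
boundary term vanishes in the limit.

Finite trajectories are treated throughout by continuing them with the equilibrium (`pad`), since
the extended realization speaks of infinite trajectories. -/

/-! ### Stability of Schur recursions with vanishing perturbation -/

/-- Gelfand's formula: for any `r` strictly between the spectral radius and `1`, the norms are
eventually dominated by `r ^ k`. -/
theorem summable_norm_pow_of_spectrum {A : Type*} [NormedRing A] [NormedAlgebra ℂ A]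
    [CompleteSpace A] [Nontrivial A] (a : A) (h : ∀ z ∈ spectrum ℂ a, ‖z‖ < 1) :
    Summable fun k : ℕ => ‖a ^ k‖ := by
  have hr : spectralRadius ℂ a < (1 : NNReal) :=
    spectrum.spectralRadius_lt_of_forall_lt a fun z hz => by
      have := h z hz
      exact_mod_cast this
  obtain ⟨r, hr0, hr1⟩ := ENNReal.lt_iff_exists_nnreal_btwn.1 hr
  have hlim := spectrum.pow_nnnorm_pow_one_div_tendsto_nhds_spectralRadius a
  have hev := hlim.eventually (gt_mem_nhds hr0)
  have hr1' : (r : ℝ) < 1 := by exact_mod_cast hr1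
  refine Summable.of_norm_bounded_eventually_nat
    (summable_geometric_of_lt_one r.coe_nonneg hr1') ?_
  filter_upwards [hev, eventually_gt_atTop 0] with k hk hk0
  have hk' : (0 : ℝ) < k := by exact_mod_cast hk0
  rw [norm_norm]
  have h1 : ((‖a ^ k‖₊ : ℝ≥0∞) ^ (1 / (k : ℝ))) ^ (k : ℝ) ≤ (r : ℝ≥0∞) ^ (k : ℝ) :=
    ENNReal.rpow_le_rpow hk.le hk'.le
  rw [← ENNReal.rpow_mul, one_div, inv_mul_cancel₀ hk'.ne', ENNReal.rpow_one,
    ENNReal.rpow_natCast] at h1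
  have h2 : ‖a ^ k‖₊ ≤ r ^ k := by exact_mod_cast h1
  exact_mod_cast h2

/-- Dominated convergence for series: each term tends to zero for fixed `i`, and a bound on `b`
times `c i` dominates. -/
theorem tendsto_sum_range_mul_reverse {c b : ℕ → ℝ} (hc : Summable c) (hc0 : ∀ i, 0 ≤ c i)
    (hb : Tendsto b atTop (𝓝 0)) :
    Tendsto (fun k => ∑ i ∈ Finset.range k, c i * b (k - 1 - i)) atTop (𝓝 0) := by
  obtain ⟨K, hK⟩ := (Metric.isBounded_range_of_tendsto b hb).exists_norm_le
  have hK' : ∀ i, ‖b i‖ ≤ K := fun i => hK _ ⟨i, rfl⟩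
  have key := tendsto_tsum_of_dominated_convergence (𝓕 := atTop) (β := ℕ) (G := ℝ)
    (f := fun (k : ℕ) (i : ℕ) => if i < k then c i * b (k - 1 - i) else 0) (g := fun _ => 0)
    (bound := fun i => c i * K) (hc.mul_right K) ?_ ?_
  · rw [tsum_zero] at key
    refine key.congr fun k => ?_
    rw [tsum_eq_sum (s := Finset.range k)]
    · exact Finset.sum_congr rfl fun i hi => if_pos (Finset.mem_range.1 hi)
    · intro i hi
      exact if_neg fun h => hi (Finset.mem_range.2 h)
  · intro i
    have h1 : Tendsto (fun k : ℕ => c i * b (k - 1 - i)) atTop (𝓝 (c i * 0)) := by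
      refine (hb.comp ?_).const_mul _
      exact (tendsto_sub_atTop_nat i).comp (tendsto_sub_atTop_nat 1)
    rw [mul_zero] at h1
    refine h1.congr' ?_
    filter_upwards [eventually_gt_atTop i] with k hk
    rw [if_pos hk]
  · refine Eventually.of_forall fun k i => ?_
    have hK0 : 0 ≤ K := (norm_nonneg _).trans (hK' 0)
    split_ifs
    · rw [norm_mul, Real.norm_of_nonneg (hc0 i)]
      exact mul_le_mul_of_nonneg_left (hK' _) (hc0 i)
    · rw [norm_zero]; exact mul_nonneg (hc0 i) hK0

/-- Variation of constants writes `e k` as a decaying term plus a convolution of the summable powers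
of `M` with the null sequence `f`. The passage to complex matrices makes the spectral radius formula
available. -/
theorem IsSchur.tendsto_zero {ι : Type} [Fintype ι] [DecidableEq ι] {M : Matrix ι ι ℝ}
    (hM : IsSchur M) {e f : ℕ → ι → ℝ} (hf : Tendsto f atTop (𝓝 0))
    (he : ∀ k, e (k + 1) = M.mulVec (e k) + f k) : Tendsto e atTop (𝓝 0) := by
  cases isEmpty_or_nonempty ι with
  | inl h => exact tendsto_const_nhds.congr fun k => Subsingleton.elim _ _
  | inr h =>
  let _ : NormedRing (Matrix ι ι ℂ) := Matrix.linftyOpNormedRing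
  let _ : NormedAlgebra ℂ (Matrix ι ι ℂ) := Matrix.linftyOpNormedAlgebra
  have _ : CompleteSpace (Matrix ι ι ℂ) := FiniteDimensional.complete ℂ _
  set Mc : Matrix ι ι ℂ := M.map (algebraMap ℝ ℂ) with hMc
  have hsum := summable_norm_pow_of_spectrum Mc hM
  let cv : (ι → ℝ) → ι → ℂ := fun v i => (v i : ℂ)
  have hcv_norm : ∀ v, ‖cv v‖ = ‖v‖ := fun v => by
    simp only [Pi.norm_def, cv]
    congr 1
    refine Finset.sup_congr rfl fun i _ => ?_
    exact Complex.nnnorm_real _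
  have hec : ∀ k, cv (e (k + 1)) = Mc.mulVec (cv (e k)) + cv (f k) := fun k => by
    funext i
    simp [cv, he, hMc, Matrix.mulVec, dotProduct]
  have hform : ∀ k, cv (e k) = (Mc ^ k).mulVec (cv (e 0)) +
      ∑ i ∈ Finset.range k, (Mc ^ i).mulVec (cv (f (k - 1 - i))) := by
    intro k
    induction k with
    | zero => simp
    | succ k ih =>
      rw [hec, ih, Matrix.mulVec_add, Matrix.mulVec_mulVec, ← pow_succ', Finset.sum_range_succ',
        Matrix.mulVec_sum, add_assoc]
      simp only [pow_zero, Matrix.one_mulVec, Nat.add_sub_cancel, Nat.sub_zero, Matrix.mulVec_mulVec,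
        ← pow_succ']
      congr 2
      refine Finset.sum_congr rfl fun i hi => ?_
      congr 3
      omega
  have hbound : ∀ k, ‖e k‖ ≤ ‖Mc ^ k‖ * ‖e 0‖ +
      ∑ i ∈ Finset.range k, ‖Mc ^ i‖ * ‖f (k - 1 - i)‖ := by
    intro k
    rw [← hcv_norm (e k), hform k]
    refine (norm_add_le _ _).trans (add_le_add ?_ ((norm_sum_le _ _).trans
      (Finset.sum_le_sum fun i _ => ?_)))
    · rw [← hcv_norm (e 0)]
      exact Matrix.linfty_opNorm_mulVec _ _
    · rw [← hcv_norm (f _)]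
      exact Matrix.linfty_opNorm_mulVec _ _
  refine squeeze_zero_norm hbound ?_
  have h1 := hsum.tendsto_atTop_zero.mul_const ‖e 0‖
  have h2 := tendsto_sum_range_mul_reverse hsum (fun i => norm_nonneg _)
    (tendsto_zero_iff_norm_tendsto_zero.1 hf)
  simpa using h1.add h2

/-! ### Multipliers under LICQ: existence, signs, uniqueness, boundedness -/

/-- If the joint map to `τ → ℝ` were not surjective, a nonzero functional vanishing on its range
would be a linear relation among the `φ i`. -/
theorem exists_dual_family {E τ : Type*} [NormedAddCommGroup E] [NormedSpace ℝ E] [Fintype τ]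
    [DecidableEq τ] {φ : τ → E →L[ℝ] ℝ} (h : LinearIndependent ℝ φ) :
    ∃ v : τ → E, ∀ i j, φ i (v j) = if i = j then 1 else 0 := by
  let G : E →ₗ[ℝ] (τ → ℝ) := LinearMap.pi fun i => (φ i : E →ₗ[ℝ] ℝ)
  have hG : LinearMap.range G = ⊤ := by
    by_contra hne
    obtain ⟨Λ, hΛ0, hΛ⟩ := Submodule.exists_le_ker_of_lt_top _ (lt_top_iff_ne_top.2 hne)
    have hrep : ∀ a : τ → ℝ, Λ a = ∑ i, Λ (Pi.single i 1) * a i := fun a => by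
      conv_lhs => rw [pi_eq_sum_univ' a]
      simp [mul_comm]
    have hz : ∑ i, Λ (Pi.single i 1) • φ i = 0 := by
      ext x
      have h1 : Λ (G x) = 0 := hΛ ⟨x, rfl⟩
      rw [hrep] at h1
      simpa [G] using h1
    have h0 := Fintype.linearIndependent_iff.1 h _ hz
    refine hΛ0 (LinearMap.ext fun a => ?_)
    simp [hrep a, h0]
  have hs := fun j : τ => LinearMap.range_eq_top.1 hG (Pi.single j 1)
  choose v hv using hs
  refine ⟨v, fun i j => ?_⟩
  have := congrFun (hv j) i
  simpa [G, Pi.single_apply] using this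

theorem sum_eq_sum_active {κ : Type} [Fintype κ] {p : κ → Prop} [DecidablePred p] {b d : κ → ℝ}
    (hb : ∀ k, ¬ p k → b k = 0) : ∑ k, b k * d k = ∑ k : {k // p k}, b k * d k := by
  rw [← Finset.sum_subset (Finset.subset_univ (Finset.univ.filter p)),
      ← Finset.sum_subtype_eq_sum_filter]
  · have : (Finset.univ.subtype p) = Finset.univ := by ext; simp
    rw [this]
  · intro k _ hk
    rw [hb k (by simpa using hk), zero_mul]

/-- Used to vary one active constraint while the others stay exactly fixed. On the
finite-dimensional slice through `z` spanned by a dual family, the constraint map has derivative the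
identity, so the inverse function theorem lifts the straight line in constraint space. -/
theorem exists_curve {E τ : Type*} [NormedAddCommGroup E] [NormedSpace ℝ E] [CompleteSpace E]
    [Fintype τ] {G : τ → E → ℝ} {G' : τ → E →L[ℝ] ℝ} {z : E}
    (hG' : ∀ i, HasStrictFDerivAt (G i) (G' i) z) (hli : LinearIndependent ℝ G') (w : τ → ℝ) :
    ∃ (γ : ℝ → E) (d : E), γ 0 = z ∧ HasDerivAt γ d 0 ∧ (∀ i, G' i d = w i) ∧
      ∀ᶠ s in 𝓝 (0 : ℝ), ∀ i, G i (γ s) = G i z + s * w i := by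
  classical
  obtain ⟨v, hv⟩ := exists_dual_family hli
  let R : (τ → ℝ) →L[ℝ] E := ∑ i, (ContinuousLinearMap.proj i).smulRight (v i)
  have hR : ∀ a i, G' i (R a) = a i := fun a i => by
    simp [R, hv]
  have hφ : HasStrictFDerivAt (fun a i => G i (z + R a))
      ((ContinuousLinearEquiv.refl ℝ (τ → ℝ) : (τ → ℝ) ≃L[ℝ] (τ → ℝ)) : (τ → ℝ) →L[ℝ] (τ → ℝ)) 0 := by
    rw [hasStrictFDerivAt_pi']
    intro i
    have h0 : HasStrictFDerivAt (fun a => z + R a) R 0 :=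
      R.hasStrictFDerivAt.const_add z
    have h1 := hG' i
    rw [show z = z + R 0 by simp] at h1
    have h2 := h1.comp (0 : τ → ℝ) h0
    refine h2.congr_fderiv ?_
    ext a
    simp [hR]
  set ψ := hφ.localInverse _ _ _ with hψ
  have hφ0 : (fun i => G i (z + R 0)) = fun i => G i z := by
    funext i; simp
  set y₀ : τ → ℝ := fun i => G i z with hy₀
  have hψ0 : ψ y₀ = 0 := by
    have := hφ.localInverse_apply_image
    simp only [hφ0] at this
    exact this
  have hψr : ∀ᶠ a in 𝓝 y₀, ∀ i, G i (z + R (ψ a)) = a i := by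
    have := hφ.eventually_right_inverse
    simp only [hφ0] at this
    filter_upwards [this] with a ha i using congrFun ha i
  have hψd : HasStrictFDerivAt ψ (ContinuousLinearMap.id ℝ (τ → ℝ)) y₀ := by
    have := hφ.to_localInverse
    simp only [hφ0] at this
    exact this
  have hsw : HasDerivAt (fun s : ℝ => y₀ + s • w) w 0 := by
    simpa using ((hasDerivAt_id (0 : ℝ)).smul_const w).const_add y₀
  refine ⟨fun s => z + R (ψ (y₀ + s • w)), R w, by simp [hψ0], ?_, hR w, ?_⟩
  · refine HasDerivAt.const_add z ?_
    refine R.hasFDerivAt.comp_hasDerivAt (0 : ℝ) ?_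
    have h1 : HasFDerivAt ψ (ContinuousLinearMap.id ℝ (τ → ℝ)) (y₀ + (0 : ℝ) • w) := by
      rw [zero_smul, add_zero]; exact hψd.hasFDerivAt
    exact h1.comp_hasDerivAt (0 : ℝ) hsw
  · have := hsw.continuousAt.tendsto
    simp only [zero_smul, add_zero] at this
    filter_upwards [this.eventually hψr] with s hs i
    simpa [hy₀] using hs i

/-- The Karush-Kuhn-Tucker conditions at a minimizer that satisfies LICQ. -/
theorem LICQ.exists_multipliers {E ι κ : Type} [NormedAddCommGroup E] [NormedSpace ℝ E]
    [CompleteSpace E] [Fintype ι] [Fintype κ] {e : ι → E → ℝ} {f : κ → E → ℝ} {J : E → ℝ} {z : E}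
    (he : ∀ i, ContDiff ℝ 1 (e i)) (hf : ∀ k, ContDiff ℝ 1 (f k)) (hJ : ContDiff ℝ 1 J)
    (hez : ∀ i, e i z = 0) (hfz : ∀ k, f k z ≤ 0) (hlicq : LICQ e f z)
    (hmin : ∀ z', (∀ i, e i z' = 0) → (∀ k, f k z' ≤ 0) → J z ≤ J z') :
    ∃ (a : ι → ℝ) (b : κ → ℝ), (∀ k, 0 ≤ b k) ∧ (∀ k, f k z ≠ 0 → b k = 0) ∧
      ∀ v, fderiv ℝ J z v + ∑ i, a i * fderiv ℝ (e i) z v + ∑ k, b k * fderiv ℝ (f k) z v = 0 := by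
  classical
  let τ := ι ⊕ {k : κ // f k z = 0}
  let G : τ → E → ℝ := Sum.elim e (fun k => f k.1)
  let G' : τ → E →L[ℝ] ℝ := Sum.elim (fun i => fderiv ℝ (e i) z)
    (fun k : {k : κ // f k z = 0} => fderiv ℝ (f k.1) z)
  have hG' : ∀ i, HasStrictFDerivAt (G i) (G' i) z := by
    rintro (i | k)
    · exact (he i).contDiffAt.hasStrictFDerivAt one_ne_zero
    · exact (hf k.1).contDiffAt.hasStrictFDerivAt one_ne_zero
  have hGz : ∀ i, G i z = 0 := by
    rintro (i | k)
    · exact hez i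
    · exact k.2
  have hJ' : HasStrictFDerivAt J (fderiv ℝ J z) z :=
    hJ.contDiffAt.hasStrictFDerivAt one_ne_zero
  have hli : LinearIndependent ℝ G' := hlicq
  have hinact : ∀ᶠ z' in 𝓝 z, ∀ k, f k z ≠ 0 → f k z' < 0 := by
    rw [eventually_all]
    intro k
    by_cases hk : f k z = 0
    · exact Eventually.of_forall fun _ h => absurd hk h
    · filter_upwards [(hf k).continuous.continuousAt.eventually_lt
        (continuousAt_const (y := (0 : ℝ))) (lt_of_le_of_ne (hfz k) hk)] with z' hz' _ using hz'
  have hmin' : ∀ᶠ z' in 𝓝 z, (∀ i, e i z' = 0) → (∀ k, f k z = 0 → f k z' ≤ 0) → J z ≤ J z' := by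
    filter_upwards [hinact] with z' h1 h2 h3
    refine hmin z' h2 fun k => ?_
    by_cases hk : f k z = 0
    · exact h3 k hk
    · exact (h1 k hk).le
  have hextr : IsLocalExtrOn J {x | ∀ i, G i x = G i z} z := by
    refine Or.inl (eventually_nhdsWithin_iff.2 ?_)
    filter_upwards [hmin'] with z' h1 h2
    refine h1 (fun i => ?_) (fun k hk => ?_)
    · exact (h2 (Sum.inl i)).trans (hez i)
    · exact ((h2 (Sum.inr ⟨k, hk⟩)).trans hk).le
  obtain ⟨Λ, Λ₀, hne, hsum⟩ := hextr.exists_multipliers_of_hasStrictFDerivAt hG' hJ'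
  -- LICQ excludes the abnormal case.
  have hΛ₀ : Λ₀ ≠ 0 := by
    rintro rfl
    rw [zero_smul, add_zero] at hsum
    exact hne (Prod.ext (funext (Fintype.linearIndependent_iff.1 hli _ hsum)) rfl)
  let c : τ → ℝ := fun i => Λ i / Λ₀
  have hc : ∀ v, fderiv ℝ J z v + ∑ i, c i * G' i v = 0 := fun v => by
    have h1 := DFunLike.congr_fun hsum v
    simp only [_root_.add_apply, _root_.sum_apply,
      _root_.smul_apply, smul_eq_mul, _root_.zero_apply] at h1
    have h2 : Λ₀ * (fderiv ℝ J z v + ∑ i, c i * G' i v) = 0 := by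
      refine Eq.trans ?_ h1
      rw [mul_add, Finset.mul_sum, add_comm]
      congr 1
      refine Finset.sum_congr rfl fun i _ => ?_
      simp only [c]
      field_simp
    exact (mul_eq_zero.1 h2).resolve_left hΛ₀
  have hsign : ∀ k : {k : κ // f k z = 0}, 0 ≤ c (Sum.inr k) := by
    intro k
    -- The curve lowers the `k`-th active constraint at unit rate and keeps all other active ones at
    -- zero. It stays feasible for small positive `s`, so `J` has nonnegative derivative along it,
    -- and stationarity identifies that derivative with `c (Sum.inr k)`.
    let w : τ → ℝ := -Pi.single (Sum.inr k) 1
    obtain ⟨γ, d, hγ0, hγd, hd, hev1⟩ := exists_curve hG' hli w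
    simp only [hGz, zero_add] at hev1
    have hJγ : HasDerivAt (J ∘ γ) (fderiv ℝ J z d) 0 := by
      have h1 : HasFDerivAt J (fderiv ℝ J z) (γ 0) := by rw [hγ0]; exact hJ'.hasFDerivAt
      exact h1.comp_hasDerivAt (0 : ℝ) hγd
    have hev2 : ∀ᶠ s in 𝓝[>] (0 : ℝ), J z ≤ J (γ s) := by
      have h1 := hγd.continuousAt.tendsto
      rw [hγ0] at h1
      filter_upwards [(h1.eventually hmin').filter_mono nhdsWithin_le_nhds,
        hev1.filter_mono nhdsWithin_le_nhds, self_mem_nhdsWithin] with s h2 h3 h4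
      refine h2 (fun i => ?_) (fun k' hk' => ?_)
      · have := h3 (Sum.inl i)
        simpa [G, w] using this
      · have h5 := h3 (Sum.inr ⟨k', hk'⟩)
        change f k' (γ s) = _ at h5
        rw [h5]
        refine mul_nonpos_of_nonneg_of_nonpos (le_of_lt h4) ?_
        simp only [w, Pi.neg_apply, Pi.single_apply]
        split_ifs <;> norm_num
    have hge : 0 ≤ fderiv ℝ J z d := by
      refine ge_of_tendsto hJγ.tendsto_slope_zero_right ?_
      filter_upwards [hev2, self_mem_nhdsWithin] with s h1 h2
      have h3 : (0 : ℝ) < s := h2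
      simp only [zero_add, Function.comp, hγ0, smul_eq_mul]
      exact mul_nonneg (inv_nonneg.2 h3.le) (sub_nonneg.2 h1)
    have h1 := hc d
    have h2 : ∑ i, c i * G' i d = -c (Sum.inr k) := by
      simp_rw [hd, w, Pi.neg_apply, mul_neg, Finset.sum_neg_distrib]
      rw [Finset.sum_eq_single (Sum.inr k)]
      · rw [Pi.single_eq_same, mul_one]
      · intro i _ hi
        rw [Pi.single_eq_of_ne hi, mul_zero]
      · exact fun h => absurd (Finset.mem_univ _) h
    linarith
  refine ⟨fun i => c (Sum.inl i), fun k => if h : f k z = 0 then c (Sum.inr ⟨k, h⟩) else 0,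
    fun k => ?_, fun k hk => dif_neg hk, fun v => ?_⟩
  · dsimp only
    split_ifs with h
    · exact hsign _
    · exact le_rfl
  · have h1 := hc v
    rw [Fintype.sum_sum_type, ← add_assoc] at h1
    refine Eq.trans ?_ h1
    rw [sum_eq_sum_active (p := fun k => f k z = 0) fun k hk => dif_neg hk]
    congr 1
    refine Finset.sum_congr rfl fun k _ => ?_
    rw [dif_pos k.2]
    rfl

theorem LICQ.eq_zero {E ι κ : Type} [NormedAddCommGroup E] [NormedSpace ℝ E]
    [Fintype ι] [Fintype κ] {e : ι → E → ℝ} {f : κ → E → ℝ} {z : E} (h : LICQ e f z)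
    {a : ι → ℝ} {b : κ → ℝ} (hb : ∀ k, f k z ≠ 0 → b k = 0)
    (hv : ∀ v, ∑ i, a i * fderiv ℝ (e i) z v + ∑ k, b k * fderiv ℝ (f k) z v = 0) :
    ∀ i, a i = 0 := by
  classical
  have h1 := Fintype.linearIndependent_iff.1 h (Sum.elim a fun k => b k.1) (by
    ext v
    refine Eq.trans ?_ (hv v)
    rw [sum_eq_sum_active (p := fun k => f k z = 0) hb]
    simp [Fintype.sum_sum_type])
  exact fun i => h1 (Sum.inl i)

/-- Multipliers stay bounded near a point that satisfies LICQ. -/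
theorem LICQ.eventually_bounded {E ι κ : Type} [NormedAddCommGroup E] [NormedSpace ℝ E]
    [Fintype ι] [Fintype κ] {e : ι → E → ℝ} {f : κ → E → ℝ} {J : E → ℝ} {z : E} (h : LICQ e f z)
    (hf : ∀ k, ContDiff ℝ 1 (f k)) (hJ : ContDiff ℝ 1 J) {zs : ℕ → E}
    (hzs : Tendsto zs atTop (𝓝 z)) {es : ℕ → ι → E → ℝ}
    (hes : ∀ t i, fderiv ℝ (es t i) (zs t) = fderiv ℝ (e i) z)
    {a : ℕ → ι → ℝ} {b : ℕ → κ → ℝ} (hb : ∀ t k, f k (zs t) ≠ 0 → b t k = 0)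
    (hv : ∀ t v, fderiv ℝ J (zs t) v + ∑ i, a t i * fderiv ℝ (es t i) (zs t) v +
      ∑ k, b t k * fderiv ℝ (f k) (zs t) v = 0) :
    ∃ K, ∀ᶠ t in atTop, ∀ i, |a t i| ≤ K := by
  classical
  let τ := ι ⊕ {k : κ // f k z = 0}
  let D : τ → E →L[ℝ] ℝ := Sum.elim (fun i => fderiv ℝ (e i) z)
    (fun k : {k : κ // f k z = 0} => fderiv ℝ (f k.1) z)
  let Ds : ℕ → τ → E →L[ℝ] ℝ := fun t => Sum.elim (fun i => fderiv ℝ (e i) z)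
    (fun k : {k : κ // f k z = 0} => fderiv ℝ (f k.1) (zs t))
  have hDs : ∀ i, Tendsto (fun t => Ds t i) atTop (𝓝 (D i)) := by
    rintro (i | k)
    · exact tendsto_const_nhds
    · exact (((hf k.1).continuous_fderiv one_ne_zero).tendsto z).comp hzs
  have hJs : Tendsto (fun t => fderiv ℝ J (zs t)) atTop (𝓝 (fderiv ℝ J z)) :=
    ((hJ.continuous_fderiv one_ne_zero).tendsto z).comp hzs
  -- Constraints inactive at the limit are eventually inactive, so only gradients that are
  -- independent at `z` remain.
  have hact : ∀ᶠ t in atTop, ∀ k, f k z ≠ 0 → b t k = 0 := by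
    rw [eventually_all]
    intro k
    by_cases hk : f k z = 0
    · exact Eventually.of_forall fun _ h => absurd hk h
    · have h1 : Tendsto (fun t => f k (zs t)) atTop (𝓝 (f k z)) :=
        ((hf k).continuous.tendsto z).comp hzs
      filter_upwards [h1.eventually_ne hk] with t ht _ using hb t k ht
  let L : (τ → ℝ) →ₗ[ℝ] (E →L[ℝ] ℝ) := Fintype.linearCombination ℝ D
  have hker : LinearMap.ker L = ⊥ := by
    rw [LinearMap.ker_eq_bot']
    intro c hc
    exact funext (Fintype.linearIndependent_iff.1 h c hc)
  obtain ⟨K, hK0, hK⟩ := L.exists_antilipschitzWith hker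
  have hKb : ∀ c, ‖c‖ ≤ K * ‖L c‖ := fun c => by
    have := hK.le_mul_dist c 0
    simpa [dist_eq_norm] using this
  -- Injectivity of `L` gives `‖c‖ ≤ K * ‖L c‖`. Once the gradients are this close to their limits,
  -- the perturbation costs at most half of `‖c‖` and can be absorbed; this is the factor `2` in the
  -- final bound.
  have hsmall : ∀ᶠ t in atTop, K * ∑ i, ‖D i - Ds t i‖ ≤ 1 / 2 := by
    have h1 : Tendsto (fun t => (K : ℝ) * ∑ i, ‖D i - Ds t i‖) atTop (𝓝 (K * ∑ i : τ, (0 : ℝ))) := by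
      refine Tendsto.const_mul _ (tendsto_finsetSum _ fun i _ => ?_)
      have := (tendsto_const_nhds (x := D i)).sub (hDs i)
      rw [sub_self] at this
      exact tendsto_zero_iff_norm_tendsto_zero.1 this
    simp only [Finset.sum_const_zero, mul_zero] at h1
    exact h1.eventually_le_const (by norm_num)
  have hJb : ∀ᶠ t in atTop, ‖fderiv ℝ J (zs t)‖ ≤ ‖fderiv ℝ J z‖ + 1 :=
    hJs.norm.eventually_le_const (by linarith)
  refine ⟨2 * (K * (‖fderiv ℝ J z‖ + 1)), ?_⟩
  filter_upwards [hact, hsmall, hJb] with t h1 h2 h3 i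
  let c : τ → ℝ := Sum.elim (a t) fun k => b t k.1
  have h4 : ∑ i, c i • Ds t i = -fderiv ℝ J (zs t) := by
    ext v
    have h5 := hv t v
    rw [sum_eq_sum_active (h1)] at h5
    simp only [hes] at h5
    simp only [_root_.sum_apply, _root_.smul_apply, smul_eq_mul, _root_.neg_apply]
    refine (Fintype.sum_sum_type _).trans ?_
    simp only [c, Ds, Sum.elim_inl, Sum.elim_inr]
    linarith
  have h5 : L c = -fderiv ℝ J (zs t) + ∑ i, c i • (D i - Ds t i) := by
    rw [← h4]
    simp [L, Fintype.linearCombination_apply, smul_sub]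
  have h6 : ‖∑ i, c i • (D i - Ds t i)‖ ≤ ‖c‖ * ∑ i, ‖D i - Ds t i‖ := by
    rw [Finset.mul_sum]
    refine (norm_sum_le _ _).trans (Finset.sum_le_sum fun i _ => ?_)
    rw [norm_smul]
    exact mul_le_mul_of_nonneg_right (norm_le_pi_norm c i) (norm_nonneg _)
  have h7 : ‖L c‖ ≤ ‖fderiv ℝ J (zs t)‖ + ‖c‖ * ∑ i, ‖D i - Ds t i‖ := by
    rw [h5]
    refine (norm_add_le _ _).trans (add_le_add ?_ h6)
    rw [norm_neg]
  have h8 : ‖c‖ ≤ K * (‖fderiv ℝ J z‖ + 1) + ‖c‖ * (1 / 2) := by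
    calc ‖c‖ ≤ K * ‖L c‖ := hKb c
      _ ≤ K * (‖fderiv ℝ J (zs t)‖ + ‖c‖ * ∑ i, ‖D i - Ds t i‖) := by gcongr
      _ = K * ‖fderiv ℝ J (zs t)‖ + ‖c‖ * (K * ∑ i, ‖D i - Ds t i‖) := by ring
      _ ≤ _ := by gcongr
  have h9 : ‖a t i‖ ≤ ‖c‖ := norm_le_pi_norm c (Sum.inl i)
  rw [Real.norm_eq_abs] at h9
  linarith

/-! ### Convergence from quadratic forms and injective matrices -/

theorem tendsto_zero_of_dotProduct_self {ι : Type*} [Fintype ι] {v : ℕ → ι → ℝ}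
    (h : Tendsto (fun k => v k ⬝ᵥ v k) atTop (𝓝 0)) : Tendsto v atTop (𝓝 0) := by
  refine tendsto_pi_nhds.2 fun i => ?_
  have h1 : Tendsto (fun k => v k i * v k i) atTop (𝓝 0) :=
    squeeze_zero (fun k => mul_self_nonneg _)
      (fun k => Finset.single_le_sum (f := fun i => v k i * v k i)
        (fun i _ => mul_self_nonneg _) (Finset.mem_univ i)) h
  have h2 : Tendsto (fun k => |v k i|) atTop (𝓝 0) := by
    have := h1.sqrt
    simpa only [Real.sqrt_mul_self_eq_abs, Real.sqrt_zero] using this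
  exact (tendsto_zero_iff_abs_tendsto_zero _).2 h2

theorem tendsto_zero_of_mulVec_injective {ι κ : Type*} [Fintype ι] [Fintype κ]
    {B : Matrix κ ι ℝ} (hB : Function.Injective B.mulVec) {v : ℕ → ι → ℝ}
    (h : Tendsto (fun k => B.mulVec (v k)) atTop (𝓝 0)) : Tendsto v atTop (𝓝 0) := by
  obtain ⟨K, -, hK⟩ := B.mulVecLin.exists_antilipschitzWith (LinearMap.ker_eq_bot.2 hB)
  have h1 : ∀ k, ‖v k‖ ≤ K * ‖B.mulVec (v k)‖ := fun k => by
    have := hK.le_mul_dist (v k) 0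
    simpa [dist_eq_norm] using this
  refine squeeze_zero_norm h1 ?_
  simpa using (tendsto_zero_iff_norm_tendsto_zero.1 h).const_mul (K : ℝ)

open scoped MatrixOrder Matrix.Norms.L2Operator in
-- Factor `R` as `Bᵀ B` with `B` injective; the form is then the squared Euclidean length of
-- `B.mulVec v`.
theorem Matrix.PosDef.tendsto_zero {ι : Type*} [Fintype ι] {R : Matrix ι ι ℝ} (hR : R.PosDef)
    {v : ℕ → ι → ℝ} (h : Tendsto (fun k => v k ⬝ᵥ R.mulVec (v k)) atTop (𝓝 0)) :
    Tendsto v atTop (𝓝 0) := by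
  classical
  obtain ⟨B, hB⟩ := CStarAlgebra.nonneg_iff_eq_star_mul_self.1 hR.posSemidef.nonneg
  have hq : ∀ x : ι → ℝ, x ⬝ᵥ R.mulVec x = B.mulVec x ⬝ᵥ B.mulVec x := fun x => by
    rw [hB, Matrix.star_eq_conjTranspose, ← Matrix.mulVec_mulVec, Matrix.dotProduct_mulVec,
      Matrix.conjTranspose_eq_transpose_of_trivial, Matrix.vecMul_transpose]
  refine tendsto_zero_of_mulVec_injective (B := B) ?_ (tendsto_zero_of_dotProduct_self ?_)
  · refine (injective_iff_map_eq_zero B.mulVecLin).2 fun x hx => ?_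
    by_contra hne
    have h1 := hR.dotProduct_mulVec_pos hne
    rw [star_trivial, hq, show B.mulVec x = 0 from hx] at h1
    simp at h1
  · simpa only [hq] using h

/-! ### State sequences and observability of the plant -/

namespace Plant

variable {n m p : ℕ} (S : Plant n m p)

theorem generates_top_iff {ℓ : ℕ} {w : Traj n m p} (hT : w.T = ⊤) :
    S.Generates ℓ w ↔ ∀ k, w.x (k + 1) = S.A.mulVec (w.x k) + S.B.mulVec (w.u k) ∧
      w.y k = S.C.mulVec (w.x k) + S.D.mulVec (w.u k) := by
  simp [Generates, hT]

/-- The states reached from `x₀` with the inputs `u 0, u 1, …`. -/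
def stateSeq (x₀ : Fin n → ℝ) (u : ℕ → Fin m → ℝ) : ℕ → Fin n → ℝ
  | 0 => x₀
  | k + 1 => S.A.mulVec (stateSeq x₀ u k) + S.B.mulVec (u k)

/-- The infinite trajectory with first state `x₀` and inputs `u`. -/
def sim (x₀ : Fin n → ℝ) (u : ℕ → Fin m → ℝ) : Traj n m p where
  x := S.stateSeq x₀ u
  u := u
  y k := S.C.mulVec (S.stateSeq x₀ u k) + S.D.mulVec (u k)
  T := ⊤

theorem sim_generates (ℓ : ℕ) (x₀ : Fin n → ℝ) (u : ℕ → Fin m → ℝ) :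
    S.Generates ℓ (S.sim x₀ u) :=
  (S.generates_top_iff rfl).2 fun _ => ⟨rfl, rfl⟩

theorem stateSeq_add (x₀ x₁ : Fin n → ℝ) (u v : ℕ → Fin m → ℝ) (k : ℕ) :
    S.stateSeq (x₀ + x₁) (u + v) k = S.stateSeq x₀ u k + S.stateSeq x₁ v k := by
  induction k with
  | zero => rfl
  | succ k ih =>
    simp only [stateSeq, ih, Pi.add_apply, Matrix.mulVec_add]
    abel

theorem stateSeq_smul (c : ℝ) (x₀ : Fin n → ℝ) (u : ℕ → Fin m → ℝ) (k : ℕ) :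
    S.stateSeq (c • x₀) (c • u) k = c • S.stateSeq x₀ u k := by
  induction k with
  | zero => rfl
  | succ k ih => simp only [stateSeq, ih, Pi.smul_apply, Matrix.mulVec_smul, smul_add]

theorem stateSeq_eq {x : ℕ → Fin n → ℝ} {u v : ℕ → Fin m → ℝ} {L : ℕ}
    (hx : ∀ k < L, x (k + 1) = S.A.mulVec (x k) + S.B.mulVec (u k)) (huv : ∀ k < L, v k = u k) :
    ∀ k ≤ L, S.stateSeq (x 0) v k = x k := by
  intro k hk
  induction k with
  | zero => rfl
  | succ k ih => rw [stateSeq, ih (by omega), huv k hk, hx k hk]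

theorem obsMatrix_mulVec (ℓ : ℕ) (v : Fin n → ℝ) (a : Fin ℓ × Fin p) :
    (S.obsMatrix ℓ).mulVec v a = S.C.mulVec ((S.A ^ (a.1 : ℕ)).mulVec v) a.2 := by
  rw [Matrix.mulVec_mulVec]
  rfl

theorem obsMatrix_injective {ℓ : ℕ} (h : (S.obsMatrix ℓ).rank = n) :
    Function.Injective (S.obsMatrix ℓ).mulVec := by
  have h1 := (S.obsMatrix ℓ).mulVecLin.finrank_range_add_finrank_ker
  rw [Matrix.rank] at h
  rw [h, Module.finrank_fin_fun] at h1
  have h2 : LinearMap.ker (S.obsMatrix ℓ).mulVecLin = ⊥ :=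
    Submodule.finrank_eq_zero.1 (by omega)
  exact LinearMap.ker_eq_bot.1 h2

/-- This is the form in which observability enters: the difference of two state sequences with equal
inputs and outputs over `ℓ` steps is such an `e`. -/
theorem eq_zero_of_unobserved {ℓ : ℕ} (h : (S.obsMatrix ℓ).rank = n) {e : ℕ → Fin n → ℝ}
    (he : ∀ i < ℓ, e (i + 1) = S.A.mulVec (e i)) (hC : ∀ i < ℓ, S.C.mulVec (e i) = 0) :
    e 0 = 0 := by
  have hpow : ∀ i ≤ ℓ, e i = (S.A ^ i).mulVec (e 0) := by
    intro i hi
    induction i with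
    | zero => simp
    | succ i ih => rw [he i hi, ih (by omega), Matrix.mulVec_mulVec, pow_succ']
  refine S.obsMatrix_injective h (funext fun a => ?_)
  rw [obsMatrix_mulVec, ← hpow _ a.1.isLt.le, hC _ a.1.isLt]
  simp

/-- Convergence of inputs and outputs implies convergence of the states. -/
theorem tendsto_state_zero {ℓ : ℕ} (h : (S.obsMatrix ℓ).rank = n) {e : ℕ → Fin n → ℝ}
    {v : ℕ → Fin m → ℝ} {η : ℕ → Fin p → ℝ}
    (he : ∀ k, e (k + 1) = S.A.mulVec (e k) + S.B.mulVec (v k))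
    (hη : ∀ k, η k = S.C.mulVec (e k) + S.D.mulVec (v k))
    (hv : Tendsto v atTop (𝓝 0)) (hη0 : Tendsto η atTop (𝓝 0)) : Tendsto e atTop (𝓝 0) := by
  have hcont : ∀ {a b : ℕ} (M : Matrix (Fin a) (Fin b) ℝ) {f : ℕ → Fin b → ℝ},
      Tendsto f atTop (𝓝 0) → Tendsto (fun k => M.mulVec (f k)) atTop (𝓝 0) := by
    intro a b M f hf
    have h1 := (M.mulVecLin.continuous_of_finiteDimensional.tendsto 0).comp hf
    rw [map_zero] at h1
    exact h1
  -- Over a fixed number of steps the vanishing inputs have vanishing effect, so each block `C A ^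
  -- i` of the observability matrix applied to `e k` tends to zero.
  have hdiff : ∀ i, Tendsto (fun k => (S.A ^ i).mulVec (e k) - e (k + i)) atTop (𝓝 0) := by
    intro i
    induction i with
    | zero => simp
    | succ i ih =>
      have h1 := (hcont S.A ih).sub (hcont S.B (hv.comp (tendsto_add_atTop_nat i)))
      rw [sub_zero] at h1
      refine h1.congr fun k => ?_
      rw [Matrix.mulVec_sub, Matrix.mulVec_mulVec, ← pow_succ', ← add_assoc, he (k + i)]
      simp only [Function.comp]
      abel
  refine tendsto_zero_of_mulVec_injective (S.obsMatrix_injective h) (tendsto_pi_nhds.2 fun a => ?_)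
  have h1 := ((hcont S.C (hdiff a.1)).add ((hη0.comp (tendsto_add_atTop_nat a.1)).sub
    (hcont S.D (hv.comp (tendsto_add_atTop_nat a.1)))))
  rw [sub_zero, add_zero] at h1
  refine (tendsto_pi_nhds.1 h1 a.2).congr fun k => ?_
  rw [obsMatrix_mulVec]
  refine congrFun ?_ a.2
  simp only [Function.comp, hη, Matrix.mulVec_sub]
  abel

end Plant

/-! ### Continuation of trajectories by the target equilibrium -/

namespace RepTask

variable {n m p ℓ : ℕ} (P : RepTask n m p ℓ)

/-- The trajectory continued by the target equilibrium after its end. -/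
def pad (w : Traj n m p) : Traj n m p := by
  classical
  exact {
    x := fun k => if (k : ℕ∞) ≤ ℓ + w.T then w.x k else P.xF
    u := fun k => if (k : ℕ∞) < ℓ + w.T then w.u k else P.uF
    y := fun k => if (k : ℕ∞) < ℓ + w.T then w.y k else P.yF
    T := ⊤ }

variable {P}

theorem cast_add_lt_iff {T : ℕ∞} {t : ℕ} : ((t + ℓ : ℕ) : ℕ∞) < ℓ + T ↔ (t : ℕ∞) < T := by
  induction T using ENat.recTopCoe with
  | top => simp
  | coe T => norm_cast; omega

theorem cast_add_le_iff {T : ℕ∞} {t : ℕ} : ((t + ℓ : ℕ) : ℕ∞) ≤ ℓ + T ↔ (t : ℕ∞) ≤ T := by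
  induction T using ENat.recTopCoe with
  | top => simp
  | coe T => norm_cast; omega

theorem pad_u (w : Traj n m p) (t : ℕ) : (P.pad w).u (t + ℓ) = P.inputs w t := by
  simp only [pad, inputs, cast_add_lt_iff]

theorem pad_x (w : Traj n m p) (t : ℕ) : (P.pad w).x (t + ℓ) = P.states w t := by
  simp only [pad, states, cast_add_le_iff]

theorem pad_u_of_lt {w : Traj n m p} {t : ℕ} (h : (t : ℕ∞) < w.T) :
    (P.pad w).u (t + ℓ) = w.u (t + ℓ) := by
  simp only [pad, cast_add_lt_iff, if_pos h]

theorem pad_y_of_lt {w : Traj n m p} {t : ℕ} (h : (t : ℕ∞) < w.T) :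
    (P.pad w).y (t + ℓ) = w.y (t + ℓ) := by
  simp only [pad, cast_add_lt_iff, if_pos h]

theorem pad_u_of_not_lt {w : Traj n m p} {t : ℕ} (h : ¬ (t : ℕ∞) < w.T) :
    (P.pad w).u (t + ℓ) = P.uF := by
  simp only [pad, cast_add_lt_iff, if_neg h]

theorem pad_y_of_not_lt {w : Traj n m p} {t : ℕ} (h : ¬ (t : ℕ∞) < w.T) :
    (P.pad w).y (t + ℓ) = P.yF := by
  simp only [pad, cast_add_lt_iff, if_neg h]

theorem pad_ext_of_le {w : Traj n m p} {t : ℕ} (h : (t : ℕ∞) ≤ w.T) :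
    (P.pad w).ext ℓ t = w.ext ℓ t := by
  have h1 : ∀ i : Fin ℓ, ((t + i : ℕ) : ℕ∞) < ℓ + w.T := fun i => by
    have hi := i.isLt
    refine lt_of_lt_of_le (b := ((ℓ + t : ℕ) : ℕ∞)) (by norm_cast; omega) ?_
    push_cast
    gcongr
  funext a
  rcases a with ⟨i, a⟩ | ⟨i, a⟩
  · exact congrFun (if_pos (h1 i)) a
  · exact congrFun (if_pos (h1 i)) a

theorem ext_eq_ξF_iff {w : Traj n m p} {t : ℕ} :
    w.ext ℓ t = P.ξF ↔ (∀ i < ℓ, w.u (t + i) = P.uF) ∧ ∀ i < ℓ, w.y (t + i) = P.yF := by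
  constructor
  · intro h
    exact ⟨fun i hi => funext fun a => congrFun h (Sum.inl (⟨i, hi⟩, a)),
      fun i hi => funext fun a => congrFun h (Sum.inr (⟨i, hi⟩, a))⟩
  · rintro ⟨h1, h2⟩
    funext a
    rcases a with ⟨i, a⟩ | ⟨i, a⟩
    · exact congrFun (h1 i i.isLt) a
    · exact congrFun (h2 i i.isLt) a

theorem pad_ext_of_ge {w : Traj n m p} (hw : P.EndsAtTarget w) {t : ℕ} (h : w.T ≤ t) :
    (P.pad w).ext ℓ t = P.ξF := by
  obtain ⟨τ, hτ⟩ := ENat.ne_top_iff_exists.1 (ne_top_of_le_ne_top (ENat.natCast_ne_top t) h)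
  rw [← hτ] at h
  have hle : τ ≤ t := by exact_mod_cast h
  obtain ⟨h1, h2⟩ := ext_eq_ξF_iff.1 (hw τ hτ.symm)
  refine ext_eq_ξF_iff.2 ⟨fun i hi => ?_, fun i hi => ?_⟩
  · simp only [pad, ← hτ]
    split_ifs with h3
    · have h4 : t + i < ℓ + τ := by exact_mod_cast h3
      rw [show t + i = τ + (t - τ + i) by omega]
      exact h1 _ (by omega)
    · rfl
  · simp only [pad, ← hτ]
    split_ifs with h3
    · have h4 : t + i < ℓ + τ := by exact_mod_cast h3
      rw [show t + i = τ + (t - τ + i) by omega]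
      exact h2 _ (by omega)
    · rfl

/-- The last `ℓ` samples are the equilibrium ones, so over them the deviation from `xF` is an
unobserved free motion. It is zero at time `τ - ℓ` (sample `τ`) and hence also at time `τ`. -/
theorem state_eq_xF (hP : P.Standing) {w : Traj n m p} (hgen : P.plant.Generates ℓ w) {τ : ℕ}
    (hT : w.T = τ) (hw : P.EndsAtTarget w) : w.x (τ + ℓ) = P.xF := by
  obtain ⟨h1, h2⟩ := ext_eq_ξF_iff.1 (hw τ hT)
  have hdyn : ∀ i < ℓ, w.x (τ + (i + 1)) - P.xF = P.plant.A.mulVec (w.x (τ + i) - P.xF) ∧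
      P.plant.C.mulVec (w.x (τ + i) - P.xF) = 0 := by
    intro i hi
    have h3 := hgen.2 (τ + i) (by rw [hT]; norm_cast; omega)
    rw [h1 i hi, h2 i hi] at h3
    constructor
    · rw [← add_assoc, h3.1, Matrix.mulVec_sub]
      conv_lhs => rw [hP.target_state]
      abel
    · have h4 := h3.2
      rw [Matrix.mulVec_sub]
      conv_lhs at h4 => rw [hP.target_output]
      rw [sub_eq_zero]
      exact (add_right_cancel h4).symm
  have h0 := P.plant.eq_zero_of_unobserved hP.observable (e := fun i => w.x (τ + i) - P.xF)
    (fun i hi => (hdyn i hi).1) (fun i hi => (hdyn i hi).2)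
  have hall : ∀ i ≤ ℓ, w.x (τ + i) - P.xF = 0 := by
    intro i hi
    induction i with
    | zero => exact h0
    | succ i ih => rw [(hdyn i hi).1, ih (by omega), Matrix.mulVec_zero]
  exact sub_eq_zero.1 (hall ℓ le_rfl)

/-- Only the junction is delicate: at sample `ℓ + T` the state still comes from `w` while input and
output are already the padded ones. -/
theorem pad_generates (hP : P.Standing) {w : Traj n m p} (hgen : P.plant.Generates ℓ w)
    (hw : P.EndsAtTarget w) : P.plant.Generates ℓ (P.pad w) := by
  refine (P.plant.generates_top_iff rfl).2 fun k => ?_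
  by_cases hk : (k : ℕ∞) < ℓ + w.T
  · have h1 : ((k + 1 : ℕ) : ℕ∞) ≤ ℓ + w.T := by
      push_cast
      exact Order.add_one_le_of_lt hk
    simp only [pad, if_pos hk, if_pos h1, if_pos hk.le]
    exact hgen.2 k hk
  · have hx : (P.pad w).x k = P.xF := by
      simp only [pad]
      split_ifs with h1
      · have h2 : (k : ℕ∞) = ℓ + w.T := le_antisymm h1 (not_lt.1 hk)
        have h3 : w.T ≠ ⊤ := fun h => by simp [h] at h2
        obtain ⟨τ, hτ⟩ := ENat.ne_top_iff_exists.1 h3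
        rw [← hτ] at h2
        have h4 : k = τ + ℓ := by
          have : k = ℓ + τ := by exact_mod_cast h2
          omega
        rw [h4]
        exact state_eq_xF hP hgen hτ.symm hw
      · rfl
    have h1 : ¬ ((k + 1 : ℕ) : ℕ∞) ≤ ℓ + w.T := by
      intro h
      exact hk (lt_of_lt_of_le (by norm_cast; omega) h)
    rw [hx]
    simp only [pad, if_neg hk, if_neg h1]
    exact ⟨hP.target_state, hP.target_output⟩

theorem stageCost_target : P.stageCost P.uF P.yF = 0 := by
  simp [stageCost]

theorem stageCost_nonneg (hP : P.Standing) (u : Fin m → ℝ) (y : Fin p → ℝ) :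
    0 ≤ P.stageCost u y := by
  have h1 := hP.R_pos.posSemidef.dotProduct_mulVec_nonneg (u - P.uF)
  have h2 := hP.Q_nonneg.dotProduct_mulVec_nonneg (y - P.yF)
  simp only [star_trivial] at h1 h2
  exact add_nonneg h1 h2

theorem costToGo_of_top {w : Traj n m p} (hT : w.T = ⊤) (t : ℕ) :
    P.costToGo w t = ∑' k : ℕ, ENNReal.ofReal
      (P.stageCost (w.u (t + k + ℓ)) (w.y (t + k + ℓ))) := by
  simp [costToGo, hT]

theorem costToGo_pad (w : Traj n m p) (t : ℕ) : P.costToGo (P.pad w) t = P.costToGo w t := by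
  rw [costToGo_of_top rfl, costToGo]
  refine tsum_congr fun k => ?_
  split_ifs with h
  · rw [pad_u_of_lt h, pad_y_of_lt h]
  · rw [pad_u_of_not_lt h, pad_y_of_not_lt h, stageCost_target, ENNReal.ofReal_zero]

theorem costToGo_succ {w : Traj n m p} (hT : w.T = ⊤) (t : ℕ) :
    P.costToGo w t = ENNReal.ofReal (P.stageCost (w.u (t + ℓ)) (w.y (t + ℓ))) +
      P.costToGo w (t + 1) := by
  rw [costToGo_of_top hT, costToGo_of_top hT, tsum_eq_zero_add' ENNReal.summable]
  simp only [add_zero, add_comm, add_left_comm]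

theorem costToGo_ne_top {w : Traj n m p} (hw : P.Safe w) (t : ℕ) : P.costToGo w t ≠ ⊤ := by
  have h0 : P.costToGo w 0 ≠ ⊤ := by
    by_cases hT : w.T = ⊤
    · exact (hw.2.2 hT).2
    · obtain ⟨τ, hτ⟩ := ENat.ne_top_iff_exists.1 hT
      rw [costToGo, tsum_eq_sum (s := Finset.range τ)]
      · refine ENNReal.sum_ne_top.2 fun k _ => ?_
        split_ifs <;> simp
      · intro k hk
        refine if_neg fun h => hk (Finset.mem_range.2 ?_)
        rw [← hτ, zero_add] at h
        exact_mod_cast h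
  rw [← costToGo_pad] at h0 ⊢
  induction t with
  | zero => exact h0
  | succ t ih =>
    rw [costToGo_succ rfl] at ih
    exact (ENNReal.add_ne_top.1 ih).2

/-- After the end, the constraints hold because `(uF, yF)` is itself the sample at time `T - 1` of a
safe trajectory, which exists as `0 < T` and `0 < ℓ`. -/
theorem Safe.pad_mem {w : Traj n m p} (hw : P.Safe w) (hT : 0 < w.T) (t : ℕ) :
    (P.pad w).u (t + ℓ) ∈ P.U ∧ (P.pad w).y (t + ℓ) ∈ P.Y := by
  by_cases h : (t : ℕ∞) < w.T
  · rw [pad_u_of_lt h, pad_y_of_lt h]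
    exact hw.1 t h
  · rw [pad_u_of_not_lt h, pad_y_of_not_lt h]
    obtain ⟨τ, hτ⟩ := ENat.ne_top_iff_exists.1
      (ne_top_of_le_ne_top (ENat.natCast_ne_top t) (not_lt.1 h))
    have hτ0 : 0 < τ := by rw [← hτ] at hT; exact_mod_cast hT
    obtain ⟨h1, h2⟩ := ext_eq_ξF_iff.1 (hw.2.1 τ hτ.symm)
    have hℓ := P.hℓ
    have h3 := hw.1 (τ - 1) (by rw [← hτ]; norm_cast; omega)
    rw [show τ - 1 + ℓ = τ + (ℓ - 1) by omega, h1 _ (by omega), h2 _ (by omega)] at h3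
    exact h3

end RepTask

/-! ### The extended realization, and convergence of trajectories of finite cost -/

theorem tendsto_mulVec_zero {ι κ : Type*} [Fintype ι] [Fintype κ] (M : Matrix κ ι ℝ)
    {f : ℕ → ι → ℝ} (hf : Tendsto f atTop (𝓝 0)) :
    Tendsto (fun k => M.mulVec (f k)) atTop (𝓝 0) := by
  have h1 := (M.mulVecLin.continuous_of_finiteDimensional.tendsto 0).comp hf
  rw [map_zero] at h1
  exact h1

namespace RepTask

variable {n m p ℓ : ℕ} {P : RepTask n m p ℓ}

theorem ext_succ_eq (hP : P.Standing) {w : Traj n m p} (hw : P.plant.Generates ℓ w)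
    (hT : w.T = ⊤) (t : ℕ) :
    w.ext ℓ (t + 1) = P.At.mulVec (w.ext ℓ t) + P.Bt.mulVec (w.u (t + ℓ)) :=
  (hP.realization w hT hw t).1

theorem output_eq (hP : P.Standing) {w : Traj n m p} (hw : P.plant.Generates ℓ w)
    (hT : w.T = ⊤) (t : ℕ) :
    w.y (t + ℓ) = P.Ct.mulVec (w.ext ℓ t) + P.Dt.mulVec (w.u (t + ℓ)) :=
  (hP.realization w hT hw t).2

theorem ext_congr (hP : P.Standing) {w w' : Traj n m p} (hw : P.plant.Generates ℓ w)
    (hT : w.T = ⊤) (hw' : P.plant.Generates ℓ w') (hT' : w'.T = ⊤) {a b K : ℕ}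
    (h0 : w.ext ℓ a = w'.ext ℓ b) (hu : ∀ k < K, w.u (a + k + ℓ) = w'.u (b + k + ℓ)) :
    ∀ k ≤ K, w.ext ℓ (a + k) = w'.ext ℓ (b + k) := by
  intro k hk
  induction k with
  | zero => exact h0
  | succ k ih =>
    rw [← add_assoc, ← add_assoc, ext_succ_eq hP hw hT, ext_succ_eq hP hw' hT', ih (by omega),
      hu k hk]

theorem output_congr (hP : P.Standing) {w w' : Traj n m p} (hw : P.plant.Generates ℓ w)
    (hT : w.T = ⊤) (hw' : P.plant.Generates ℓ w') (hT' : w'.T = ⊤) {a b K : ℕ}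
    (h0 : w.ext ℓ a = w'.ext ℓ b) (hu : ∀ k < K, w.u (a + k + ℓ) = w'.u (b + k + ℓ)) :
    ∀ k < K, w.y (a + k + ℓ) = w'.y (b + k + ℓ) := by
  intro k hk
  rw [output_eq hP hw hT, output_eq hP hw' hT', hu k hk,
    ext_congr hP hw hT hw' hT' h0 hu k hk.le]

theorem rollout_eq (hP : P.Standing) {w : Traj n m p} (hw : P.plant.Generates ℓ w)
    (hT : w.T = ⊤) (h0 : w.ext ℓ 0 = P.ξS) {u : ℕ → Fin m → ℝ} (hu : ∀ k, u k = w.u (k + ℓ))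
    (k : ℕ) : P.rollout u k = w.ext ℓ k := by
  induction k with
  | zero => exact h0.symm
  | succ k ih => rw [rollout, ih, hu, ext_succ_eq hP hw hT]

theorem output_eq_y (hP : P.Standing) {w : Traj n m p} (hw : P.plant.Generates ℓ w)
    (hT : w.T = ⊤) (h0 : w.ext ℓ 0 = P.ξS) {u : ℕ → Fin m → ℝ} (hu : ∀ k, u k = w.u (k + ℓ))
    (k : ℕ) : P.output u k = w.y (k + ℓ) := by
  rw [output, rollout_eq hP hw hT h0 hu, hu, output_eq hP hw hT]

theorem infCost_eq (hP : P.Standing) {w : Traj n m p} (hw : P.plant.Generates ℓ w)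
    (hT : w.T = ⊤) (h0 : w.ext ℓ 0 = P.ξS) {u : ℕ → Fin m → ℝ} (hu : ∀ k, u k = w.u (k + ℓ)) :
    P.infCost u = P.costToGo w 0 := by
  rw [infCost, costToGo_of_top hT]
  refine tsum_congr fun k => ?_
  rw [output_eq_y hP hw hT h0 hu, hu, zero_add]

/-- The realization is applied to the constant equilibrium trajectory. -/
theorem ξF_equilibrium (hP : P.Standing) :
    P.ξF = P.At.mulVec P.ξF + P.Bt.mulVec P.uF ∧ P.yF = P.Ct.mulVec P.ξF + P.Dt.mulVec P.uF := by
  let w : Traj n m p := ⟨fun _ => P.xF, fun _ => P.uF, fun _ => P.yF, ⊤⟩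
  exact hP.realization w rfl ((P.plant.generates_top_iff rfl).2 fun _ =>
    ⟨hP.target_state, hP.target_output⟩) 0

theorem tendsto_stageCost_zero (hP : P.Standing) {w : Traj n m p} (hT : w.T = ⊤)
    (hc : P.costToGo w 0 ≠ ⊤) :
    Tendsto (fun k => P.stageCost (w.u (k + ℓ)) (w.y (k + ℓ))) atTop (𝓝 0) := by
  rw [costToGo_of_top hT] at hc
  have h1 := (ENNReal.continuousAt_toReal ENNReal.zero_ne_top).tendsto.comp
    (ENNReal.tendsto_atTop_zero_of_tsum_ne_top hc)
  rw [ENNReal.toReal_zero] at h1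
  refine h1.congr fun k => ?_
  rw [Function.comp, ENNReal.toReal_ofReal (stageCost_nonneg hP _ _), zero_add]

theorem tendsto_input_sub (hP : P.Standing) {w : Traj n m p} (hT : w.T = ⊤)
    (hc : P.costToGo w 0 ≠ ⊤) : Tendsto (fun k => w.u (k + ℓ) - P.uF) atTop (𝓝 0) := by
  refine hP.R_pos.tendsto_zero (squeeze_zero (fun k => ?_) (fun k => ?_)
    (tendsto_stageCost_zero hP hT hc))
  · simpa using hP.R_pos.posSemidef.dotProduct_mulVec_nonneg (w.u (k + ℓ) - P.uF)
  · have := hP.Q_nonneg.dotProduct_mulVec_nonneg (w.y (k + ℓ) - P.yF)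
    rw [star_trivial] at this
    exact le_add_of_nonneg_right this

/-- A trajectory of finite cost converges to the target. -/
theorem tendsto_ext (hP : P.Standing) {w : Traj n m p} (hw : P.plant.Generates ℓ w)
    (hT : w.T = ⊤) (hc : P.costToGo w 0 ≠ ⊤) : Tendsto (w.ext ℓ) atTop (𝓝 P.ξF) := by
  obtain ⟨Qh, hQh, hQ, L, hL⟩ := hP.detectable
  have hv := tendsto_input_sub hP hT hc
  have hη : Tendsto (fun k => Qh.mulVec (w.y (k + ℓ) - P.yF)) atTop (𝓝 0) := by
    refine tendsto_zero_of_dotProduct_self (squeeze_zero (fun k => ?_) (fun k => ?_)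
      (tendsto_stageCost_zero hP hT hc))
    · exact Finset.sum_nonneg fun i _ => mul_self_nonneg _
    · have h1 := hP.R_pos.posSemidef.dotProduct_mulVec_nonneg (w.u (k + ℓ) - P.uF)
      rw [star_trivial] at h1
      have h2 : Qh.transpose = Qh := by
        rw [← Matrix.conjTranspose_eq_transpose_of_trivial]; exact hQh.isHermitian
      have h3 : ∀ x, Qh.mulVec x ⬝ᵥ Qh.mulVec x = x ⬝ᵥ P.Q.mulVec x := fun x => by
        rw [← hQ, ← Matrix.mulVec_mulVec, Matrix.dotProduct_mulVec x]
        conv_rhs => rw [← h2, Matrix.vecMul_transpose, h2]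
      rw [h3]
      exact le_add_of_nonneg_left h1
  obtain ⟨hF1, hF2⟩ := ξF_equilibrium hP
  have he : Tendsto (fun k => w.ext ℓ k - P.ξF) atTop (𝓝 0) := by
    -- Observer form: adding and subtracting `L * (Qh * Ct)` applied to the error makes the error
    -- matrix Schur. The remainder involves only the input deviation and the `Qh`-weighted output
    -- deviation, both forced to zero by finite cost.
    refine hL.tendsto_zero (f := fun k => P.Bt.mulVec (w.u (k + ℓ) - P.uF) -
      L.mulVec (Qh.mulVec (w.y (k + ℓ) - P.yF) -
        Qh.mulVec (P.Dt.mulVec (w.u (k + ℓ) - P.uF)))) ?_ fun k => ?_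
    · simpa using (tendsto_mulVec_zero P.Bt hv).sub (tendsto_mulVec_zero L
        (by simpa using hη.sub (tendsto_mulVec_zero Qh (tendsto_mulVec_zero P.Dt hv))))
    · have h1 : w.y (k + ℓ) - P.yF =
          P.Ct.mulVec (w.ext ℓ k - P.ξF) + P.Dt.mulVec (w.u (k + ℓ) - P.uF) := by
        rw [output_eq hP hw hT, Matrix.mulVec_sub, Matrix.mulVec_sub]
        conv_lhs => rw [hF2]
        abel
      have h2 : w.ext ℓ (k + 1) - P.ξF =
          P.At.mulVec (w.ext ℓ k - P.ξF) + P.Bt.mulVec (w.u (k + ℓ) - P.uF) := by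
        rw [ext_succ_eq hP hw hT, Matrix.mulVec_sub, Matrix.mulVec_sub]
        conv_lhs => rw [hF1]
        abel
      rw [h2, h1, Matrix.add_mulVec, Matrix.mulVec_add Qh, add_sub_cancel_right,
        ← Matrix.mulVec_mulVec, ← Matrix.mulVec_mulVec]
      abel
  simpa using he.add_const P.ξF

theorem tendsto_u (P : RepTask n m p ℓ) {w : Traj n m p}
    (h : Tendsto (w.ext ℓ) atTop (𝓝 P.ξF)) : Tendsto w.u atTop (𝓝 P.uF) := by
  refine tendsto_pi_nhds.2 fun a => ?_
  have := tendsto_pi_nhds.1 h (Sum.inl (⟨0, P.hℓ⟩, a))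
  exact this

theorem tendsto_y (P : RepTask n m p ℓ) {w : Traj n m p}
    (h : Tendsto (w.ext ℓ) atTop (𝓝 P.ξF)) : Tendsto w.y atTop (𝓝 P.yF) := by
  refine tendsto_pi_nhds.2 fun a => ?_
  have := tendsto_pi_nhds.1 h (Sum.inr (⟨0, P.hℓ⟩, a))
  exact this

theorem tendsto_x (hP : P.Standing) {w : Traj n m p} (hw : P.plant.Generates ℓ w)
    (hT : w.T = ⊤) (h : Tendsto (w.ext ℓ) atTop (𝓝 P.ξF)) : Tendsto w.x atTop (𝓝 P.xF) := by
  have hu := (tendsto_u P h).sub_const P.uF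
  have hy := (tendsto_y P h).sub_const P.yF
  rw [sub_self] at hu hy
  have hg := (P.plant.generates_top_iff hT).1 hw
  have he := P.plant.tendsto_state_zero hP.observable (e := fun k => w.x k - P.xF)
    (fun k => ?_) (fun k => ?_) hu hy
  · simpa using he.add_const P.xF
  · rw [(hg k).1, Matrix.mulVec_sub, Matrix.mulVec_sub]
    conv_lhs => rw [hP.target_state]
    abel
  · rw [(hg k).2, Matrix.mulVec_sub, Matrix.mulVec_sub]
    conv_lhs => rw [hP.target_output]
    abel

/-- The state is determined by the extended state. -/
theorem state_congr (hP : P.Standing) {w w' : Traj n m p} (hw : P.plant.Generates ℓ w)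
    (hT : w.T = ⊤) (hw' : P.plant.Generates ℓ w') (hT' : w'.T = ⊤) {a b : ℕ}
    (h0 : w.ext ℓ a = w'.ext ℓ b) : w.x (a + ℓ) = w'.x (b + ℓ) := by
  have hg := (P.plant.generates_top_iff hT).1 hw
  have hg' := (P.plant.generates_top_iff hT').1 hw'
  have hu : ∀ i < ℓ, w.u (a + i) = w'.u (b + i) := fun i hi =>
    funext fun c => congrFun h0 (Sum.inl (⟨i, hi⟩, c))
  have hy : ∀ i < ℓ, w.y (a + i) = w'.y (b + i) := fun i hi =>
    funext fun c => congrFun h0 (Sum.inr (⟨i, hi⟩, c))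
  have hs : ∀ i < ℓ, w.x (a + (i + 1)) - w'.x (b + (i + 1)) =
      P.plant.A.mulVec (w.x (a + i) - w'.x (b + i)) := fun i hi => by
    rw [← add_assoc, ← add_assoc, (hg _).1, (hg' _).1, hu i hi, Matrix.mulVec_sub]
    abel
  have h1 := P.plant.eq_zero_of_unobserved hP.observable
    (e := fun i => w.x (a + i) - w'.x (b + i)) hs fun i hi => by
      have h2 := hy i hi
      rw [(hg _).2, (hg' _).2, hu i hi] at h2
      rw [Matrix.mulVec_sub, sub_eq_zero]
      exact add_right_cancel h2
  have h2 : ∀ i ≤ ℓ, w.x (a + i) - w'.x (b + i) = 0 := by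
    intro i hi
    induction i with
    | zero => exact h1
    | succ i ih => rw [hs i hi, ih (by omega), Matrix.mulVec_zero]
  exact sub_eq_zero.1 (h2 ℓ le_rfl)

end RepTask

/-! ### Data columns as a representation of all input-output sequences -/

namespace Plant

variable {n m p : ℕ} (S : Plant n m p)

/-- A finite input sequence, continued by the sequence `v`. -/
def extendSeq {L : ℕ} (u : Fin L → Fin m → ℝ) (v : ℕ → Fin m → ℝ) (k : ℕ) : Fin m → ℝ :=
  if h : k < L then u ⟨k, h⟩ else v k

/-- The input-output sequences of length `L`, parametrized by the first state and the inputs. -/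
def behaviour (L : ℕ) : (Fin n → ℝ) × (Fin L → Fin m → ℝ) →ₗ[ℝ]
    (Fin L → Fin m → ℝ) × (Fin L → Fin p → ℝ) where
  toFun a := (a.2, fun k => S.C.mulVec (S.stateSeq a.1 (extendSeq a.2 0) k) + S.D.mulVec (a.2 k))
  map_add' a b := by
    have h : extendSeq (a.2 + b.2) 0 = extendSeq a.2 0 + extendSeq b.2 0 := by
      funext k
      simp only [extendSeq, Pi.add_apply]
      split_ifs <;> simp
    refine Prod.ext rfl (funext fun k => ?_)
    simp only [Prod.fst_add, Prod.snd_add, h, stateSeq_add, Matrix.mulVec_add, Pi.add_apply]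
    abel
  map_smul' c a := by
    have h : extendSeq (c • a.2) 0 = c • extendSeq a.2 0 := by
      funext k
      simp only [extendSeq, Pi.smul_apply]
      split_ifs <;> simp
    refine Prod.ext rfl (funext fun k => ?_)
    simp [h, stateSeq_smul, Matrix.mulVec_smul]

theorem finrank_range_behaviour_le (L : ℕ) :
    Module.finrank ℝ (LinearMap.range (S.behaviour L)) ≤ m * L + n := by
  refine (LinearMap.finrank_range_le _).trans (le_of_eq ?_)
  simp [Module.finrank_prod, Module.finrank_pi_fintype]
  ring

theorem column_mem_range {w : Traj n m p} {L s : ℕ}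
    (hw : ∀ k < L, w.x (s + k + 1) = S.A.mulVec (w.x (s + k)) + S.B.mulVec (w.u (s + k)) ∧
      w.y (s + k) = S.C.mulVec (w.x (s + k)) + S.D.mulVec (w.u (s + k))) :
    RepTask.column w L s ∈ LinearMap.range (S.behaviour L) := by
  refine ⟨(w.x s, fun k => w.u (s + k)), Prod.ext rfl (funext fun k => ?_)⟩
  have h := S.stateSeq_eq (x := fun i => w.x (s + i)) (u := fun i => w.u (s + i)) (L := L)
    (v := extendSeq (fun k : Fin L => w.u (s + k)) 0) (fun i hi => (hw i hi).1)
    (fun i hi => by simp [extendSeq, hi]) k k.isLt.le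
  change S.C.mulVec (S.stateSeq (w.x s) _ k) + _ = w.y (s + k)
  rw [(hw k k.isLt).2]
  congr 2

end Plant

namespace RepTask

variable {n m p ℓ : ℕ} {P : RepTask n m p ℓ} {M W : ℕ → Traj n m p} {jb tb : ℕ} {last : ℕ∞}

theorem IsRun.isColumn_mem_range (hrun : P.IsRun M W jb tb last) {c : ℕ × ℕ}
    (hc : P.IsColumn M jb tb c) :
    column (M c.1) (ℓ + P.N) c.2 ∈ LinearMap.range (P.plant.behaviour (ℓ + P.N)) := by
  have h1 : c.1 ≤ jb ∧ ((c.2 + P.N : ℕ) : ℕ∞) ≤ (M c.1).T := by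
    rcases hc with ⟨h, h'⟩ | ⟨h, h'⟩
    · exact ⟨h.le, h'⟩
    · refine ⟨h.le, ?_⟩
      rw [h]
      refine le_trans ?_ hrun.tb_le
      exact_mod_cast h'
  have hgen := (hrun.measured c.1 (le_trans (by exact_mod_cast h1.1) hrun.jb_le)).1
  refine P.plant.column_mem_range fun k hk => hgen.2 (c.2 + k) ?_
  refine lt_of_lt_of_le (b := (ℓ : ℕ∞) + ((c.2 + P.N : ℕ) : ℕ∞)) ?_ (add_le_add_right h1.2 _)
  norm_cast
  omega

/-- The data columns span all input-output sequences of length `ℓ + N`. -/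
theorem IsRun.span_columns (hrun : P.IsRun M W jb tb last) :
    Submodule.span ℝ ((fun c : ℕ × ℕ => column (M c.1) (ℓ + P.N) c.2) '' {c | P.IsColumn M jb tb c}) =
      LinearMap.range (P.plant.behaviour (ℓ + P.N)) := by
  have hset : {v | ∃ c, P.IsColumn M jb tb c ∧ v = column (M c.1) (ℓ + P.N) c.2} =
      (fun c : ℕ × ℕ => column (M c.1) (ℓ + P.N) c.2) '' {c | P.IsColumn M jb tb c} := by
    ext v
    exact ⟨fun ⟨c, h, h'⟩ => ⟨c, h, h'.symm⟩, fun ⟨c, h, h'⟩ => ⟨c, h, h'.symm⟩⟩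
  have hr := hrun.reached
  rw [DataRank, hset] at hr
  -- The columns are input-output sequences, and their rank already equals the largest dimension
  -- that the space of such sequences can have.
  refine Submodule.eq_of_le_of_finrank_le (Submodule.span_le.2 ?_) ?_
  · rintro _ ⟨c, hc, rfl⟩
    exact hrun.isColumn_mem_range hc
  · rw [hr]
    exact P.plant.finrank_range_behaviour_le _

theorem IsRun.exists_combination_iff (hrun : P.IsRun M W jb tb last)
    (v : (Fin (ℓ + P.N) → Fin m → ℝ) × (Fin (ℓ + P.N) → Fin p → ℝ)) :
    (∃ g : ℕ × ℕ →₀ ℝ, (∀ c ∈ g.support, P.IsColumn M jb tb c) ∧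
      (g.sum fun c a => a • column (M c.1) (ℓ + P.N) c.2) = v) ↔
    v ∈ LinearMap.range (P.plant.behaviour (ℓ + P.N)) := by
  rw [← hrun.span_columns, Finsupp.mem_span_image_iff_linearCombination]
  refine exists_congr fun g => ?_
  rw [Finsupp.mem_supported, Finsupp.linearCombination_apply]
  rfl

/-- A feasible point of the finite-horizon problem is a trajectory; its inputs after the horizon can
be prescribed. -/
theorem IsRun.exists_traj (hrun : P.IsRun M W jb tb last) {j : ℕ} {ξ : ExtState ℓ m p}
    {d : P.Decision} (hd : P.Feasible M W jb tb j ξ d) (v : ℕ → Fin m → ℝ) :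
    ∃ w : Traj n m p, P.plant.Generates ℓ w ∧ w.T = ⊤ ∧ w.ext ℓ 0 = ξ ∧
      (∀ k : Fin P.N, w.u (k + ℓ) = d.u k ∧ w.y (k + ℓ) = d.y k) ∧
      ∀ k, P.N ≤ k → w.u (k + ℓ) = v k := by
  obtain ⟨⟨x₀, uu⟩, ha⟩ := (hrun.exists_combination_iff _).1 ⟨d.g, hd.1, hd.2.1⟩
  have h1 : uu = Fin.append ξ.past_u d.u := congrArg Prod.fst ha
  have h2 := congrArg Prod.snd ha
  change _ = Fin.append ξ.past_y d.y at h2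
  -- The shift by `ℓ` converts the sample index into time, as `v` is indexed by time.
  let us : ℕ → Fin m → ℝ := Plant.extendSeq uu fun k => v (k - ℓ)
  have hu : ∀ k : Fin (ℓ + P.N), (P.plant.sim x₀ us).u k = Fin.append ξ.past_u d.u k := fun k => by
    rw [← h1]
    exact dif_pos k.isLt
  have hy : ∀ k : Fin (ℓ + P.N), (P.plant.sim x₀ us).y k = Fin.append ξ.past_y d.y k := fun k => by
    rw [← h2]
    change P.plant.C.mulVec (P.plant.stateSeq x₀ us k) + P.plant.D.mulVec (us k) =
      P.plant.C.mulVec (P.plant.stateSeq x₀ (Plant.extendSeq uu 0) k) + P.plant.D.mulVec (uu k)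
    have h3 : us k = uu k := dif_pos k.isLt
    have h4 := P.plant.stateSeq_eq (x := P.plant.stateSeq x₀ us) (u := us) (L := ℓ + P.N)
      (v := Plant.extendSeq uu 0) (fun i _ => rfl)
      (fun i hi => by simp [us, Plant.extendSeq, hi]) k k.isLt.le
    rw [h3]
    congr 2
    exact h4.symm
  refine ⟨P.plant.sim x₀ us, P.plant.sim_generates ℓ x₀ us, rfl, ?_, fun k => ⟨?_, ?_⟩,
    fun k hk => ?_⟩
  · funext a
    rcases a with ⟨i, a⟩ | ⟨i, a⟩
    · have := congrFun (hu (Fin.castAdd P.N i)) a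
      rw [Fin.append_left] at this
      simpa [Traj.ext, mkExt, ExtState.past_u] using this
    · have := congrFun (hy (Fin.castAdd P.N i)) a
      rw [Fin.append_left] at this
      simpa [Traj.ext, mkExt, ExtState.past_y] using this
  · have := hu (Fin.natAdd ℓ k)
    rw [Fin.append_right] at this
    rw [← this, add_comm]
    rfl
  · have := hy (Fin.natAdd ℓ k)
    rw [Fin.append_right] at this
    rw [← this, add_comm]
    rfl
  · change us (k + ℓ) = _
    simp only [us, Plant.extendSeq]
    rw [dif_neg (by omega), Nat.add_sub_cancel]

theorem terminal_eq {d : P.Decision} {w : Traj n m p} {t : ℕ}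
    (h : ∀ k : Fin P.N, w.u (t + k + ℓ) = d.u k ∧ w.y (t + k + ℓ) = d.y k) :
    d.terminal = w.ext ℓ (t + P.N) := by
  have hN := P.hN
  funext a
  rcases a with ⟨i, a⟩ | ⟨i, a⟩
  · have h1 : w.u (t + (P.N - ℓ + i) + ℓ) = _ :=
      (h ⟨P.N - ℓ + i, by have := i.isLt; omega⟩).1
    rw [show t + (P.N - ℓ + i) + ℓ = t + P.N + i by omega] at h1
    exact (congrFun h1 a).symm
  · have h1 : w.y (t + (P.N - ℓ + i) + ℓ) = _ :=
      (h ⟨P.N - ℓ + i, by have := i.isLt; omega⟩).2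
    rw [show t + (P.N - ℓ + i) + ℓ = t + P.N + i by omega] at h1
    exact (congrFun h1 a).symm

/-- The stage cost of a trajectory at time `t`. -/
def costAt (P : RepTask n m p ℓ) (w : Traj n m p) (t : ℕ) : ℝ≥0∞ :=
  ENNReal.ofReal (P.stageCost (w.u (t + ℓ)) (w.y (t + ℓ)))

theorem objective_eq {j : ℕ} {d : P.Decision} {w : Traj n m p} {t : ℕ}
    (h : ∀ k : Fin P.N, w.u (t + k + ℓ) = d.u k ∧ w.y (t + k + ℓ) = d.y k) :
    P.objective W j d =
      (∑ k ∈ Finset.range P.N, P.costAt w (t + k)) + P.termCost W j (w.ext ℓ (t + P.N)) := by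
  rw [objective, terminal_eq h, ← Fin.sum_univ_eq_sum_range (fun k => P.costAt w (t + k))]
  congr 1
  refine Finset.sum_congr rfl fun k _ => ?_
  rw [costAt, (h k).1, (h k).2]

/-- Each admissible trajectory that is in the safe set after `N` steps is feasible for the
finite-horizon problem. -/
theorem IsRun.exists_feasible (hrun : P.IsRun M W jb tb last) {j : ℕ} {w : Traj n m p}
    (hw : P.plant.Generates ℓ w) (hT : w.T = ⊤) {t : ℕ}
    (hmem : ∀ k < P.N, w.u (t + k + ℓ) ∈ P.U ∧ w.y (t + k + ℓ) ∈ P.Y)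
    (hterm : w.ext ℓ (t + P.N) ∈ P.ioCS W j) :
    ∃ d : P.Decision, P.Feasible M W jb tb j (w.ext ℓ t) d ∧ P.objective W j d =
      (∑ k ∈ Finset.range P.N, P.costAt w (t + k)) + P.termCost W j (w.ext ℓ (t + P.N)) := by
  have hg := (P.plant.generates_top_iff hT).1 hw
  obtain ⟨g, hg1, hg2⟩ := (hrun.exists_combination_iff _).2
    (P.plant.column_mem_range (w := w) (L := ℓ + P.N) (s := t) fun k _ => hg _)
  let d : P.Decision := ⟨g, fun k => w.u (t + k + ℓ), fun k => w.y (t + k + ℓ)⟩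
  have hd : ∀ k : Fin P.N, w.u (t + k + ℓ) = d.u k ∧ w.y (t + k + ℓ) = d.y k :=
    fun k => ⟨rfl, rfl⟩
  refine ⟨d, ⟨hg1, hg2.trans ?_, ?_, fun k => hmem k k.isLt⟩, objective_eq hd⟩
  · refine Prod.ext (funext fun k => ?_) (funext fun k => ?_)
    · refine Fin.addCases (fun i => ?_) (fun i => ?_) k
      · simp only [Decision.full, Fin.append_left]
        rfl
      · simp only [Decision.full, Fin.append_right, column, d]
        congr 1
        simp
        ring
    · refine Fin.addCases (fun i => ?_) (fun i => ?_) k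
      · simp only [Decision.full, Fin.append_left]
        rfl
      · simp only [Decision.full, Fin.append_right, column, d]
        congr 1
        simp
        ring
  · rw [terminal_eq hd]
    exact hterm

end RepTask

/-! ### Terminal cost, decrease along the closed loop, and monotonicity -/

namespace RepTask

variable {n m p ℓ : ℕ} {P : RepTask n m p ℓ} {M W : ℕ → Traj n m p} {jb tb : ℕ} {last : ℕ∞}

/-- The quadratic part of the stage cost. -/
def quad (P : RepTask n m p ℓ) (v : Fin m → ℝ) (η : Fin p → ℝ) : ℝ :=
  v ⬝ᵥ P.R.mulVec v + η ⬝ᵥ P.Q.mulVec η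

theorem quad_nonneg (hP : P.Standing) (v : Fin m → ℝ) (η : Fin p → ℝ) : 0 ≤ P.quad v η := by
  have := stageCost_nonneg hP (v + P.uF) (η + P.yF)
  simpa only [stageCost, add_sub_cancel_right, quad] using this

/-- On a line the cost is a quadratic polynomial whose leading coefficient `quad` is nonnegative
under the standing assumptions. Both Jensen's inequality and the gradient inequality for the stage
cost are read off from this; the value of `b` is not needed. -/
theorem stageCost_line (u v : Fin m → ℝ) (y η : Fin p → ℝ) :
    ∃ b : ℝ, ∀ s : ℝ, P.stageCost (u + s • v) (y + s • η) =
      P.stageCost u y + s * b + s ^ 2 * P.quad v η := by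
  refine ⟨(u - P.uF) ⬝ᵥ P.R.mulVec v + v ⬝ᵥ P.R.mulVec (u - P.uF) +
    ((y - P.yF) ⬝ᵥ P.Q.mulVec η + η ⬝ᵥ P.Q.mulVec (y - P.yF)), fun s => ?_⟩
  simp only [stageCost, quad, add_sub_right_comm, Matrix.mulVec_add, Matrix.mulVec_smul,
    dotProduct_add, add_dotProduct, dotProduct_smul, smul_dotProduct, smul_eq_mul]
  ring

theorem convexOn_stageCost (hP : P.Standing) :
    ConvexOn ℝ Set.univ fun z : (Fin m → ℝ) × (Fin p → ℝ) => P.stageCost z.1 z.2 := by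
  refine ⟨convex_univ, fun x _ y _ a b ha hb hab => ?_⟩
  obtain ⟨c, hc⟩ := stageCost_line (P := P) y.1 (x.1 - y.1) y.2 (x.2 - y.2)
  have hq := quad_nonneg hP (x.1 - y.1) (x.2 - y.2)
  have h1 := hc 1
  have h2 := hc a
  rw [one_smul, one_smul, add_sub_cancel, add_sub_cancel] at h1
  have hb' : b = 1 - a := by linarith
  have e1 : y.1 + a • (x.1 - y.1) = (a • x + b • y).1 := by
    rw [Prod.fst_add, Prod.smul_fst, Prod.smul_fst, hb', smul_sub, sub_smul, one_smul]
    abel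
  have e2 : y.2 + a • (x.2 - y.2) = (a • x + b • y).2 := by
    rw [Prod.snd_add, Prod.smul_snd, Prod.smul_snd, hb', smul_sub, sub_smul, one_smul]
    abel
  rw [e1, e2] at h2
  dsimp only
  rw [h2, h1, smul_eq_mul, smul_eq_mul, hb']
  have h3 : 0 ≤ (a * (1 - a)) * P.quad (x.1 - y.1) (x.2 - y.2) :=
    mul_nonneg (mul_nonneg ha (by linarith)) hq
  nlinarith

/-- Different labels may point to the same stored state, so the weights are summed over the fibres
of `f`; the combined state and cost do not change. -/
theorem exists_weights {α : Type*} (s : Finset α) {wt : α → ℝ} {f : α → ℕ × ℕ} {j : ℕ}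
    (hwt : ∀ a ∈ s, 0 ≤ wt a) (hsum : ∑ a ∈ s, wt a = 1)
    (hf : ∀ a ∈ s, (f a).1 < j ∧ P.Safe (W (f a).1) ∧ ((f a).2 : ℕ∞) ≤ (W (f a).1).T) :
    ∃ γ, P.IsWeights W j γ (∑ a ∈ s, wt a • (W (f a).1).ext ℓ (f a).2) ∧
      (γ.sum fun c a => ENNReal.ofReal a * P.costToGo (W c.1) c.2) =
        ∑ a ∈ s, ENNReal.ofReal (wt a) * P.costToGo (W (f a).1) (f a).2 := by
  classical
  let γ : ℕ × ℕ →₀ ℝ := Finsupp.onFinset (s.image f) (fun c => ∑ a ∈ s with f a = c, wt a)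
    fun c hc => by
      obtain ⟨a, ha, -⟩ := Finset.exists_ne_zero_of_sum_ne_zero hc
      rw [Finset.mem_filter] at ha
      exact Finset.mem_image.2 ⟨a, ha⟩
  have hγ : ∀ c, γ c = ∑ a ∈ s with f a = c, wt a := fun c => rfl
  have hmaps : ∀ a ∈ s, f a ∈ s.image f := fun a ha => Finset.mem_image_of_mem f ha
  refine ⟨γ, ⟨fun c => ?_, fun c hc => ?_, ?_, ?_⟩, ?_⟩
  · rw [hγ]
    exact Finset.sum_nonneg fun a ha => hwt a (Finset.mem_filter.1 ha).1
  · obtain ⟨a, ha, rfl⟩ := Finset.mem_image.1 (Finsupp.support_onFinset_subset hc)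
    exact hf a ha
  · rw [Finsupp.onFinset_sum _ fun _ => rfl, ← hsum]
    exact Finset.sum_fiberwise_of_maps_to hmaps _
  · rw [Finsupp.onFinset_sum _ fun c => zero_smul ℝ ((W c.1).ext ℓ c.2), ← Finset.sum_fiberwise_of_maps_to hmaps]
    refine Finset.sum_congr rfl fun c _ => ?_
    rw [Finset.sum_smul]
    refine Finset.sum_congr rfl fun a ha => ?_
    rw [(Finset.mem_filter.1 ha).2]
  · rw [Finsupp.onFinset_sum _ fun _ => by simp, ← Finset.sum_fiberwise_of_maps_to hmaps]
    refine Finset.sum_congr rfl fun c _ => ?_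
    rw [ENNReal.ofReal_sum_of_nonneg fun a ha => hwt a (Finset.mem_filter.1 ha).1,
      Finset.sum_mul]
    refine Finset.sum_congr rfl fun a ha => ?_
    rw [(Finset.mem_filter.1 ha).2]

theorem costToGo_of_ge {w : Traj n m p} {t : ℕ} (h : w.T ≤ t) : P.costToGo w t = 0 := by
  rw [costToGo, ENNReal.tsum_eq_zero]
  intro k
  exact if_neg (not_lt.2 (h.trans (by norm_cast; omega)))

/-- Padding adds nothing to the safe set: beyond the end, the extended state and the zero cost-to-go
are those of time `T`. Successors of stored states can therefore be taken along padded trajectories.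
-/
theorem exists_time_eq_pad {w : Traj n m p} (hw : P.EndsAtTarget w) (t : ℕ) :
    ∃ t' : ℕ, (t' : ℕ∞) ≤ w.T ∧ w.ext ℓ t' = (P.pad w).ext ℓ t ∧
      P.costToGo w t' = P.costToGo (P.pad w) t := by
  by_cases h : (t : ℕ∞) ≤ w.T
  · exact ⟨t, h, (pad_ext_of_le h).symm, (costToGo_pad w t).symm⟩
  · have h' := (not_le.1 h).le
    obtain ⟨τ, hτ⟩ := ENat.ne_top_iff_exists.1 (ne_top_of_le_ne_top (ENat.natCast_ne_top t) h')
    refine ⟨τ, hτ.le, ?_, ?_⟩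
    · rw [pad_ext_of_ge hw h', hw τ hτ.symm]
    · rw [costToGo_pad, costToGo_of_ge h', costToGo_of_ge hτ.ge]

theorem termCost_le_of_pad {α : Type*} (s : Finset α) {wt : α → ℝ} {i t : α → ℕ} {j : ℕ}
    (hwt : ∀ a ∈ s, 0 ≤ wt a) (hsum : ∑ a ∈ s, wt a = 1)
    (hi : ∀ a ∈ s, i a < j ∧ P.Safe (W (i a))) {ξ : ExtState ℓ m p}
    (hξ : ∑ a ∈ s, wt a • (P.pad (W (i a))).ext ℓ (t a) = ξ) :
    ξ ∈ P.ioCS W j ∧ P.termCost W j ξ ≤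
      ∑ a ∈ s, ENNReal.ofReal (wt a) * P.costToGo (P.pad (W (i a))) (t a) := by
  have h1 : ∀ a, ∃ t', a ∈ s → ((t' : ℕ) : ℕ∞) ≤ (W (i a)).T ∧
      (W (i a)).ext ℓ t' = (P.pad (W (i a))).ext ℓ (t a) ∧
      P.costToGo (W (i a)) t' = P.costToGo (P.pad (W (i a))) (t a) := fun a => by
    by_cases ha : a ∈ s
    · obtain ⟨t', h⟩ := exists_time_eq_pad (hi a ha).2.2.1 (t a)
      exact ⟨t', fun _ => h⟩
    · exact ⟨0, fun h => absurd h ha⟩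
  choose t' ht' using h1
  obtain ⟨γ, hγ, hcost⟩ := exists_weights (P := P) (W := W) s (f := fun a => (i a, t' a)) hwt hsum
    (fun a ha => ⟨(hi a ha).1, (hi a ha).2, (ht' a ha).1⟩)
  have hγ' : P.IsWeights W j γ ξ := by
    rw [← hξ]
    convert hγ using 1
    exact Finset.sum_congr rfl fun a ha => by rw [(ht' a ha).2.1]
  refine ⟨⟨γ, hγ'⟩, (iInf₂_le γ hγ').trans (le_of_eq (hcost.trans ?_))⟩
  exact Finset.sum_congr rfl fun a ha => by rw [(ht' a ha).2.2]

theorem termCost_pad_le {i j : ℕ} (hij : i < j) (hi : P.Safe (W i)) (t : ℕ) :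
    (P.pad (W i)).ext ℓ t ∈ P.ioCS W j ∧
      P.termCost W j ((P.pad (W i)).ext ℓ t) ≤ P.costToGo (P.pad (W i)) t := by
  have := termCost_le_of_pad (P := P) (W := W) (j := j) ({()} : Finset Unit) (wt := fun _ => 1)
    (i := fun _ => i) (t := fun _ => t) (fun _ _ => zero_le_one) (by simp)
    (fun _ _ => ⟨hij, hi⟩) (ξ := (P.pad (W i)).ext ℓ t) (by simp)
  simpa using this

theorem costToGo_split {w : Traj n m p} (hT : w.T = ⊤) (t N : ℕ) :
    P.costToGo w t = (∑ k ∈ Finset.range N, P.costAt w (t + k)) + P.costToGo w (t + N) := by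
  induction N with
  | zero => simp
  | succ N ih => rw [ih, costToGo_succ hT, Finset.sum_range_succ]; exact (add_assoc _ _ _).symm

/-- Admissible trajectories that meet a safe trajectory after `N` steps bound the optimal value. -/
theorem IsRun.objective_le (hrun : P.IsRun M W jb tb last) {i j : ℕ} (hij : i < j)
    (hi : P.Safe (W i)) {ξ : ExtState ℓ m p} {d : P.Decision}
    (hd : P.IsOptimal M W jb tb j ξ d) {w : Traj n m p}
    (hw : P.plant.Generates ℓ w) (hT : w.T = ⊤) {t s : ℕ} (h0 : w.ext ℓ t = ξ)
    (hmem : ∀ k < P.N, w.u (t + k + ℓ) ∈ P.U ∧ w.y (t + k + ℓ) ∈ P.Y)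
    (hterm : w.ext ℓ (t + P.N) = (P.pad (W i)).ext ℓ s) :
    P.objective W j d ≤
      (∑ k ∈ Finset.range P.N, P.costAt w (t + k)) + P.costToGo (P.pad (W i)) s := by
  obtain ⟨hs1, hs2⟩ := termCost_pad_le (P := P) hij hi s
  rw [← hterm] at hs1 hs2
  obtain ⟨d', hd', hobj⟩ := hrun.exists_feasible hw hT hmem hs1
  rw [h0] at hd'
  exact (hd.2 d' hd').trans (hobj.le.trans (add_le_add le_rfl hs2))

/-- The upper half of the sandwich: the next `N` samples of a stored safe trajectory are a
candidate, with terminal cost at most the remaining cost-to-go. -/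
theorem IsRun.objective_le_costToGo (hP : P.Standing) (hrun : P.IsRun M W jb tb last) {i j : ℕ}
    (hij : i < j) (hi : P.Safe (W i)) (hgen : P.plant.Generates ℓ (W i)) {t : ℕ} {d : P.Decision}
    (hd : P.IsOptimal M W jb tb j ((P.pad (W i)).ext ℓ t) d) :
    P.objective W j d ≤ P.costToGo (W i) t := by
  rw [← costToGo_pad, costToGo_split rfl t P.N]
  exact hrun.objective_le hij hi hd (pad_generates hP hgen hi.2.1) rfl rfl
    (fun k _ => hi.pad_mem hgen.1 _) rfl

section ClosedLoop

variable (hP : P.Standing) (hrun : P.IsRun M W jb tb last) {j : ℕ} (hj : jb < j)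
  (hjl : (j : ℕ∞) ≤ last)

include hP hrun hj hjl

theorem IsRun.pad_generates : P.plant.Generates ℓ (P.pad (M j)) :=
  RepTask.pad_generates hP (hrun.measured j hjl).1 (hrun.later_end j hj hjl)

/-- Prediction and closed loop start at the same extended state with the same input, so they agree
for one step. The rest of the prediction, followed by freely chosen inputs `v`, then starts at the
next closed-loop state. -/
theorem IsRun.exists_predicted {t : ℕ} (ht : (t : ℕ∞) < (M j).T) {d : P.Decision}
    (hd : P.Feasible M W jb tb j ((M j).ext ℓ t) d)
    (hu : (M j).u (t + ℓ) = d.u ⟨0, lt_of_lt_of_le P.hℓ P.hN⟩) (v : ℕ → Fin m → ℝ) :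
    ∃ w : Traj n m p, P.plant.Generates ℓ w ∧ w.T = ⊤ ∧
      (∀ k : Fin P.N, w.u (k + ℓ) = d.u k ∧ w.y (k + ℓ) = d.y k) ∧
      (∀ k, P.N ≤ k → w.u (k + ℓ) = v k) ∧ P.costAt w 0 = P.costAt (M j) t ∧
      w.u (0 + ℓ) = (M j).u (t + ℓ) ∧ w.y (0 + ℓ) = (M j).y (t + ℓ) ∧
      w.ext ℓ 1 = (M j).ext ℓ (t + 1) := by
  obtain ⟨w, hw, hT, h0, hd', hv⟩ := hrun.exists_traj hd v
  have hN0 : 0 < P.N := lt_of_lt_of_le P.hℓ P.hN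
  have hu0 : w.u (0 + ℓ) = (M j).u (t + ℓ) := by rw [hu]; exact (hd' ⟨0, hN0⟩).1
  have h0' : w.ext ℓ 0 = (P.pad (M j)).ext ℓ t := by rw [h0, pad_ext_of_le ht.le]
  have hu0' : ∀ k < 1, w.u (0 + k + ℓ) = (P.pad (M j)).u (t + k + ℓ) := by
    intro k hk
    obtain rfl : k = 0 := by omega
    rw [add_zero, add_zero, pad_u_of_lt ht, hu0]
  have hgp := hrun.pad_generates hP hj hjl
  have hy := output_congr hP hw hT hgp rfl h0' hu0' 0 one_pos
  have he := ext_congr hP hw hT hgp rfl h0' hu0' 1 le_rfl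
  rw [add_zero, add_zero, pad_y_of_lt ht] at hy
  refine ⟨w, hw, hT, hd', hv, by rw [costAt, costAt, hu0, hy], hu0, hy, ?_⟩
  rw [zero_add] at he
  rw [he, pad_ext_of_le]
  rw [Nat.cast_add, Nat.cast_one]
  exact Order.add_one_le_of_lt ht

theorem IsRun.mem_constraints {t : ℕ} (ht : (t : ℕ∞) < (M j).T) :
    (M j).u (t + ℓ) ∈ P.U ∧ (M j).y (t + ℓ) ∈ P.Y := by
  obtain ⟨d, hd, hu⟩ := hrun.later_input j hj hjl t ht
  obtain ⟨w, -, -, hd', -, -, hu0, hy0, -⟩ :=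
    hrun.exists_predicted hP hj hjl ht hd.1 hu 0
  have hN0 : 0 < P.N := lt_of_lt_of_le P.hℓ P.hN
  have h1 := hd.1.2.2.2 ⟨0, hN0⟩
  rw [← (hd' ⟨0, hN0⟩).1, ← (hd' ⟨0, hN0⟩).2] at h1
  rw [← hu0, ← hy0]
  exact h1

theorem IsRun.costAt_le_objective {t : ℕ} (ht : (t : ℕ∞) < (M j).T) {d : P.Decision}
    (hd : P.Feasible M W jb tb j ((M j).ext ℓ t) d)
    (hu : (M j).u (t + ℓ) = d.u ⟨0, lt_of_lt_of_le P.hℓ P.hN⟩) :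
    P.costAt (M j) t ≤ P.objective W j d := by
  obtain ⟨w, -, -, hd', -, hc, -⟩ := hrun.exists_predicted hP hj hjl ht hd hu 0
  have hN0 : 0 < P.N := lt_of_lt_of_le P.hℓ P.hN
  rw [objective_eq (w := w) (t := 0) (by simpa using hd'), ← hc]
  have h1 := Finset.single_le_sum (f := fun k => P.costAt w (0 + k)) (fun _ _ => zero_le)
    (Finset.mem_range.2 hN0)
  rw [add_zero] at h1
  exact h1.trans le_self_add

/-- The optimal value decreases along the closed loop by at least the stage cost. -/
theorem IsRun.costAt_add_objective_le {t : ℕ} (ht : (t : ℕ∞) < (M j).T) {d d₁ : P.Decision}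
    (hd : P.Feasible M W jb tb j ((M j).ext ℓ t) d)
    (hu : (M j).u (t + ℓ) = d.u ⟨0, lt_of_lt_of_le P.hℓ P.hN⟩)
    (hd₁ : P.IsOptimal M W jb tb j ((M j).ext ℓ (t + 1)) d₁) :
    P.costAt (M j) t + P.objective W j d₁ ≤ P.objective W j d := by
  conv_rhs => rw [objective]
  -- Moving the stage costs to the left leaves a lower bound for an infimum, so each representation
  -- `γ` of the terminal state can be treated separately; no minimizing `γ` is needed.
  rw [← tsub_le_iff_left]
  refine le_iInf₂ fun γ hγ => ?_
  rw [tsub_le_iff_left]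
  have hsafe : ∀ c ∈ γ.support, c.1 < j ∧ P.Safe (W c.1) := fun c hc =>
    ⟨(hγ.2.1 c hc).1, (hγ.2.1 c hc).2.1⟩
  have hWgen : ∀ c ∈ γ.support, P.plant.Generates ℓ (W c.1) := fun c hc =>
    (hrun.stored c.1 (le_trans (by exact_mod_cast (hsafe c hc).1.le) hjl)).1
  have hpgen : ∀ c ∈ γ.support, P.plant.Generates ℓ (P.pad (W c.1)) := fun c hc =>
    RepTask.pad_generates hP (hWgen c hc) (hsafe c hc).2.2.1
  have hpmem : ∀ c ∈ γ.support, (P.pad (W c.1)).u (c.2 + ℓ) ∈ P.U ∧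
      (P.pad (W c.1)).y (c.2 + ℓ) ∈ P.Y := fun c hc =>
    (hsafe c hc).2.pad_mem (hWgen c hc).1 _
  have hnn : ∀ c ∈ γ.support, 0 ≤ γ c := fun c _ => hγ.1 c
  have hsum : ∑ c ∈ γ.support, γ c = 1 := hγ.2.2.1
  -- The appended input mixes the stored inputs with the weights of the terminal state. By linearity
  -- the new output and terminal state are the same mixtures of the stored successors.
  let uN := ∑ c ∈ γ.support, γ c • (P.pad (W c.1)).u (c.2 + ℓ)
  obtain ⟨w, hw, hT, hd', hv, hc0, -, -, hext⟩ :=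
    hrun.exists_predicted hP hj hjl ht hd hu fun _ => uN
  have hd0 : ∀ k : Fin P.N, w.u (0 + k + ℓ) = d.u k ∧ w.y (0 + k + ℓ) = d.y k := by
    simpa using hd'
  have huN : w.u (P.N + ℓ) = uN := hv P.N le_rfl
  have heN : w.ext ℓ P.N = ∑ c ∈ γ.support, γ c • (P.pad (W c.1)).ext ℓ c.2 := by
    have h1 := terminal_eq hd0
    rw [zero_add] at h1
    rw [← h1, ← hγ.2.2.2]
    refine Finset.sum_congr rfl fun c hc => ?_
    rw [pad_ext_of_le (hγ.2.1 c hc).2.2]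
  have hyN : w.y (P.N + ℓ) = ∑ c ∈ γ.support, γ c • (P.pad (W c.1)).y (c.2 + ℓ) := by
    rw [output_eq hP hw hT, huN, heN, Matrix.mulVec_sum, Matrix.mulVec_sum,
      ← Finset.sum_add_distrib]
    refine Finset.sum_congr rfl fun c hc => ?_
    rw [output_eq hP (hpgen c hc) rfl, Matrix.mulVec_smul, Matrix.mulVec_smul, smul_add]
  have heN1 : ∑ c ∈ γ.support, γ c • (P.pad (W c.1)).ext ℓ (c.2 + 1) = w.ext ℓ (1 + P.N) := by
    rw [add_comm 1, ext_succ_eq hP hw hT, huN, heN, Matrix.mulVec_sum, Matrix.mulVec_sum,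
      ← Finset.sum_add_distrib]
    refine Finset.sum_congr rfl fun c hc => ?_
    rw [ext_succ_eq hP (hpgen c hc) rfl, Matrix.mulVec_smul, Matrix.mulVec_smul, smul_add]
  obtain ⟨hs1, hs2⟩ := termCost_le_of_pad (P := P) (W := W) γ.support hnn hsum hsafe heN1
  have hmem : ∀ k < P.N, w.u (1 + k + ℓ) ∈ P.U ∧ w.y (1 + k + ℓ) ∈ P.Y := by
    intro k hk
    by_cases hk' : k + 1 < P.N
    · have h1 := hd' ⟨k + 1, hk'⟩
      have h2 := hd.2.2.2 ⟨k + 1, hk'⟩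
      rw [← h1.1, ← h1.2] at h2
      rw [add_comm 1 k]
      exact h2
    · rw [show 1 + k = P.N by omega, huN, hyN]
      exact ⟨hP.U_convex.sum_mem hnn hsum fun c hc => (hpmem c hc).1,
        hP.Y_convex.sum_mem hnn hsum fun c hc => (hpmem c hc).2⟩
  obtain ⟨d', hfeas, hobj⟩ := hrun.exists_feasible hw hT hmem hs1
  rw [hext] at hfeas
  -- Jensen's inequality for the appended stage cost; with the successors' costs-to-go it recombines
  -- to the terminal cost of `γ`.
  have hcN : P.costAt w P.N ≤ ∑ c ∈ γ.support, ENNReal.ofReal (γ c) *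
      P.costAt (P.pad (W c.1)) c.2 := by
    have h1 := (convexOn_stageCost hP).map_sum_le (t := γ.support) (w := γ)
      (p := fun c => ((P.pad (W c.1)).u (c.2 + ℓ), (P.pad (W c.1)).y (c.2 + ℓ))) hnn hsum
      (fun _ _ => Set.mem_univ _)
    have h2 : ∑ c ∈ γ.support, γ c • ((P.pad (W c.1)).u (c.2 + ℓ), (P.pad (W c.1)).y (c.2 + ℓ)) =
        (w.u (P.N + ℓ), w.y (P.N + ℓ)) := by
      rw [huN, hyN]
      refine Prod.ext ?_ ?_
      · simp only [Prod.fst_sum, Prod.smul_fst]; rfl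
      · simp only [Prod.snd_sum, Prod.smul_snd]
    rw [h2] at h1
    refine (ENNReal.ofReal_le_ofReal h1).trans (le_of_eq ?_)
    rw [ENNReal.ofReal_sum_of_nonneg fun c hc => smul_nonneg (hnn c hc) (stageCost_nonneg hP _ _)]
    refine Finset.sum_congr rfl fun c hc => ?_
    rw [smul_eq_mul, ENNReal.ofReal_mul (hnn c hc)]
    rfl
  have hstage : ∑ k, ENNReal.ofReal (P.stageCost (d.u k) (d.y k)) =
      ∑ k ∈ Finset.range P.N, P.costAt w k := by
    rw [← Fin.sum_univ_eq_sum_range]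
    refine Finset.sum_congr rfl fun k _ => ?_
    rw [costAt, (hd' k).1, (hd' k).2]
  calc P.costAt (M j) t + P.objective W j d₁
      ≤ P.costAt w 0 + ((∑ k ∈ Finset.range P.N, P.costAt w (1 + k)) +
        P.termCost W j (w.ext ℓ (1 + P.N))) := by
        rw [hc0, ← hobj]
        exact add_le_add le_rfl (hd₁.2 d' hfeas)
    _ = (∑ k ∈ Finset.range P.N, P.costAt w k) +
        (P.costAt w P.N + P.termCost W j (w.ext ℓ (1 + P.N))) := by
        rw [← add_assoc, ← add_assoc, ← Finset.sum_range_succ, Finset.sum_range_succ',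
          add_comm (P.costAt w 0)]
        simp only [add_comm 1]
    _ ≤ (∑ k ∈ Finset.range P.N, P.costAt w k) +
        ((∑ c ∈ γ.support, ENNReal.ofReal (γ c) * P.costAt (P.pad (W c.1)) c.2) +
          ∑ c ∈ γ.support, ENNReal.ofReal (γ c) * P.costToGo (P.pad (W c.1)) (c.2 + 1)) := by
        gcongr
    _ = _ := by
        rw [hstage, ← Finset.sum_add_distrib]
        congr 1
        refine Finset.sum_congr rfl fun c _ => ?_
        have h1 := costToGo_succ (P := P) (w := P.pad (W c.1)) rfl c.2
        rw [costToGo_pad] at h1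
        rw [← mul_add]
        exact congrArg (ENNReal.ofReal (γ c) * ·) h1.symm

/-- The lower half of the sandwich: the decrease inequality is summed along the closed loop, the
leftover optimal value being nonnegative. -/
theorem IsRun.costToGo_le_objective {t : ℕ} (ht : (t : ℕ∞) < (M j).T) {d : P.Decision}
    (hd : P.IsOptimal M W jb tb j ((M j).ext ℓ t) d)
    (hu : (M j).u (t + ℓ) = d.u ⟨0, lt_of_lt_of_le P.hℓ P.hN⟩) :
    P.costToGo (M j) t ≤ P.objective W j d := by
  classical
  -- Time and decision are generalized because the induction continues with the optimal solution of
  -- the next time. At the last time of a finite iteration there is none, and the first predicted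
  -- stage cost suffices.
  have key : ∀ K t : ℕ, (t : ℕ∞) < (M j).T → ∀ d : P.Decision,
      P.IsOptimal M W jb tb j ((M j).ext ℓ t) d →
      (M j).u (t + ℓ) = d.u ⟨0, lt_of_lt_of_le P.hℓ P.hN⟩ →
      ∑ k ∈ Finset.range K, (if ((t + k : ℕ) : ℕ∞) < (M j).T then
        P.costAt (M j) (t + k) else 0) ≤ P.objective W j d := by
    intro K
    induction K with
    | zero => intro t _ d _ _; simp
    | succ K ih =>
      intro t ht d hd hu
      rw [Finset.sum_range_succ', add_zero, if_pos ht, add_comm]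
      simp only [← add_assoc, add_right_comm t _ 1]
      by_cases ht1 : ((t + 1 : ℕ) : ℕ∞) < (M j).T
      · obtain ⟨d₁, hd₁, hu₁⟩ := hrun.later_input j hj hjl (t + 1) ht1
        exact (add_le_add le_rfl (ih (t + 1) ht1 d₁ hd₁ hu₁)).trans
          (hrun.costAt_add_objective_le hP hj hjl ht hd.1 hu hd₁)
      · rw [Finset.sum_eq_zero, add_zero]
        · exact hrun.costAt_le_objective hP hj hjl ht hd.1 hu
        · intro k _
          exact if_neg fun h => ht1 (lt_of_le_of_lt (by norm_cast; omega) h)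
  rw [costToGo]
  refine ENNReal.tsum_le_of_sum_range_le fun K => ?_
  refine le_trans (le_of_eq (Finset.sum_congr rfl fun k _ => ?_)) (key K t ht d hd hu)
  rfl

/-- The first predicted sample satisfies the constraints. Comparison with the initial trajectory,
always in the safe set, bounds the cost, and finite cost implies convergence by `tendsto_ext`. -/
theorem IsRun.safe : P.Safe (M j) := by
  refine ⟨fun t ht => hrun.mem_constraints hP hj hjl ht, hrun.later_end j hj hjl, fun hT => ?_⟩
  have hgen := (hrun.measured j hjl).1
  have hc : P.costToGo (M j) 0 ≠ ⊤ := by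
    have h0T : ((0 : ℕ) : ℕ∞) < (M j).T := hgen.1
    obtain ⟨d, hd, hu⟩ := hrun.later_input j hj hjl 0 h0T
    refine ne_top_of_le_ne_top ?_ (hrun.costToGo_le_objective hP hj hjl h0T hd hu)
    have hs : P.Safe (W 0) := hrun.initial_stored ▸ hrun.initial_safe
    obtain ⟨hg0, he0⟩ := hrun.stored 0 zero_le
    have h1 : (M j).ext ℓ 0 = (P.pad (W 0)).ext ℓ 0 := by
      rw [(hrun.measured j hjl).2, pad_ext_of_le (by simp), he0]
    rw [h1] at hd
    exact ne_top_of_le_ne_top (costToGo_ne_top hs 0)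
      (hrun.objective_le_costToGo hP (by omega) hs hg0 hd)
  exact ⟨tendsto_ext hP hgen hT hc, hc⟩

end ClosedLoop

/-- The optimal value of iteration `j + 1` at the common starting state lies between the two costs.
-/
theorem IsRun.costToGo_antitone (hP : P.Standing) (hrun : P.IsRun M W jb tb last) {j : ℕ}
    (hj : jb < j) (hjl : ((j + 1 : ℕ) : ℕ∞) ≤ last) :
    P.costToGo (M (j + 1)) 0 ≤ P.costToGo (M j) 0 := by
  have hjl' : (j : ℕ∞) ≤ last := le_trans (by norm_cast; omega) hjl
  have hs := hrun.safe hP hj hjl'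
  obtain ⟨hg, he⟩ := hrun.measured j hjl'
  have hW := hrun.later_stored j hj hjl'
  have h0T : ((0 : ℕ) : ℕ∞) < (M (j + 1)).T := (hrun.measured (j + 1) hjl).1.1
  obtain ⟨d, hd, hu⟩ := hrun.later_input (j + 1) (by omega) hjl 0 h0T
  refine (hrun.costToGo_le_objective hP (by omega) hjl h0T hd hu).trans ?_
  rw [← hW] at hs hg he ⊢
  have h1 : (M (j + 1)).ext ℓ 0 = (P.pad (W j)).ext ℓ 0 := by
    rw [(hrun.measured (j + 1) hjl).2, pad_ext_of_le (by simp), he]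
  rw [h1] at hd
  exact hrun.objective_le_costToGo hP (by omega) hs hg hd

end RepTask

/-! ### Optimality of the windows of a repeated iteration -/

namespace RepTask

variable {n m p ℓ : ℕ} {P : RepTask n m p ℓ} {M W : ℕ → Traj n m p} {jb tb : ℕ} {last : ℕ∞}

theorem costToGo_congr {w w' : Traj n m p} (hT : w.T = w'.T) {t : ℕ}
    (h : ∀ k : ℕ, ((t + k : ℕ) : ℕ∞) < w'.T →
      w.u (t + k + ℓ) = w'.u (t + k + ℓ) ∧ w.y (t + k + ℓ) = w'.y (t + k + ℓ)) :
    P.costToGo w t = P.costToGo w' t := by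
  rw [costToGo, costToGo, hT]
  refine tsum_congr fun k => ?_
  split_ifs with hk
  · rw [(h k hk).1, (h k hk).2]
  · rfl

/-- Replace `H` steps of a trajectory by another path with the same end points. -/
theorem exists_spliced (S : Plant n m p) {w : Traj n m p}
    (hg : ∀ k, w.x (k + 1) = S.A.mulVec (w.x k) + S.B.mulVec (w.u k) ∧
      w.y k = S.C.mulVec (w.x k) + S.D.mulVec (w.u k)) {t H : ℕ}
    {z : Fin (H + 1) → Fin n → ℝ} {v : Fin H → Fin m → ℝ} (hz0 : z 0 = w.x (t + ℓ))
    (hz : ∀ k : Fin H, z k.succ = S.A.mulVec (z k.castSucc) + S.B.mulVec (v k))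
    (hzH : z (Fin.last H) = w.x (t + H + ℓ)) :
    ∃ w' : Traj n m p, S.Generates ℓ w' ∧ w'.T = ⊤ ∧
      (∀ k < ℓ, w'.u k = w.u (t + k) ∧ w'.y k = w.y (t + k)) ∧
      (∀ k : Fin H, w'.u (k + ℓ) = v k ∧
        w'.y (k + ℓ) = S.C.mulVec (z k.castSucc) + S.D.mulVec (v k)) ∧
      ∀ k, w'.u (H + ℓ + k) = w.u (t + (H + ℓ + k)) ∧
        w'.y (H + ℓ + k) = w.y (t + (H + ℓ + k)) := by
  let us : ℕ → Fin m → ℝ := fun k =>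
    if k < ℓ then w.u (t + k) else if h : k - ℓ < H then v ⟨k - ℓ, h⟩ else w.u (t + k)
  have hu1 : ∀ k < ℓ, us k = w.u (t + k) := fun k hk => if_pos hk
  have hu2 : ∀ k : Fin H, us (k + ℓ) = v k := fun k => by
    simp only [us]
    rw [if_neg (by omega), dif_pos (by simp)]
    simp
  have hu3 : ∀ k, us (H + ℓ + k) = w.u (t + (H + ℓ + k)) := fun k => by
    simp only [us]
    rw [if_neg (by omega), dif_neg (by omega)]
  let X := S.stateSeq (w.x t) us
  have hX : ∀ k, X (k + 1) = S.A.mulVec (X k) + S.B.mulVec (us k) := fun k => rfl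
  have hx1 : ∀ k ≤ ℓ, X k = w.x (t + k) := fun k hk =>
    S.stateSeq_eq (x := fun k => w.x (t + k)) (u := fun k => w.u (t + k)) (L := ℓ)
      (fun k _ => (hg _).1) hu1 k hk
  have hx2 : ∀ k : Fin (H + 1), X (k + ℓ) = z k := by
    intro k
    induction k using Fin.induction with
    | zero => rw [hz0, ← hx1 ℓ le_rfl]; simp
    | succ k ih =>
      rw [Fin.val_castSucc] at ih
      rw [hz k, ← ih, ← hu2 k, ← hX]
      congr 1
      simp
      omega
  have hx3 : ∀ k, X (H + ℓ + k) = w.x (t + (H + ℓ + k)) := by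
    intro k
    induction k with
    | zero =>
      have := hx2 (Fin.last H)
      rw [hzH, Fin.val_last] at this
      rw [add_zero, this]
      congr 1
      omega
    | succ k ih => rw [← add_assoc, hX, ih, hu3, ← (hg _).1]; rfl
  refine ⟨S.sim (w.x t) us, S.sim_generates ℓ _ _, rfl, fun k hk => ⟨hu1 k hk, ?_⟩,
    fun k => ⟨hu2 k, ?_⟩, fun k => ⟨hu3 k, ?_⟩⟩
  · change S.C.mulVec (X k) + S.D.mulVec (us k) = _
    rw [hx1 k hk.le, hu1 k hk, (hg _).2]
  · change S.C.mulVec (X (k + ℓ)) + S.D.mulVec (us (k + ℓ)) = _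
    rw [hu2, ← hx2]
    rfl
  · change S.C.mulVec (X _) + S.D.mulVec (us _) = _
    rw [hx3, hu3, (hg _).2]

theorem stageCost_sum_le_of_costAt (hP : P.Standing) {w w' : Traj n m p} {H t : ℕ}
    (h : ∑ k ∈ Finset.range H, P.costAt w (t + k) ≤ ∑ k ∈ Finset.range H, P.costAt w' k) :
    ∑ k : Fin H, P.stageCost (w.u (t + k + ℓ)) (w.y (t + k + ℓ)) ≤
      ∑ k : Fin H, P.stageCost (w'.u (k + ℓ)) (w'.y (k + ℓ)) := by
  simp only [costAt] at h
  rw [← ENNReal.ofReal_sum_of_nonneg fun k _ => stageCost_nonneg hP _ _,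
    ← ENNReal.ofReal_sum_of_nonneg fun k _ => stageCost_nonneg hP _ _,
    ENNReal.ofReal_le_ofReal_iff (Finset.sum_nonneg fun k _ => stageCost_nonneg hP _ _)] at h
  rw [Fin.sum_univ_eq_sum_range
      (fun k => P.stageCost (w.u (t + k + ℓ)) (w.y (t + k + ℓ))),
    Fin.sum_univ_eq_sum_range (fun k => P.stageCost (w'.u (k + ℓ)) (w'.y (k + ℓ)))]
  exact h

theorem ext_congr_samples {w w' : Traj n m p} {a b : ℕ}
    (h : ∀ i < ℓ, w.u (a + i) = w'.u (b + i) ∧ w.y (a + i) = w'.y (b + i)) :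
    w.ext ℓ a = w'.ext ℓ b := by
  funext c
  rcases c with ⟨i, c⟩ | ⟨i, c⟩
  · exact congrFun (h i i.isLt).1 c
  · exact congrFun (h i i.isLt).2 c

/-- If an iteration is repeated, then each of its windows of `N - ℓ` steps is optimal among the paths
with the same end points. -/
theorem IsRun.window_optimal (hP : P.Standing) (hrun : P.IsRun M W jb tb last) {j : ℕ}
    (hj : jb < j) (hjl : ((j + 1 : ℕ) : ℕ∞) ≤ last) (hT : (M (j + 1)).T = (M j).T)
    (hu : ∀ t : ℕ, (t : ℕ∞) < (M j).T → (M (j + 1)).u (t + ℓ) = (M j).u (t + ℓ))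
    {H : ℕ} (hH : P.N = H + ℓ) (t : ℕ)
    {z : Fin (H + 1) → Fin n → ℝ} {v : Fin H → Fin m → ℝ}
    (hz0 : z 0 = (P.pad (M j)).x (t + ℓ))
    (hz : ∀ k : Fin H, z k.succ = P.plant.A.mulVec (z k.castSucc) + P.plant.B.mulVec (v k))
    (hzH : z (Fin.last H) = (P.pad (M j)).x (t + H + ℓ))
    (hmem : ∀ k, v k ∈ P.U ∧ P.plant.C.mulVec (z k.castSucc) + P.plant.D.mulVec (v k) ∈ P.Y) :
    ∑ k : Fin H, P.stageCost ((P.pad (M j)).u (t + k + ℓ)) ((P.pad (M j)).y (t + k + ℓ)) ≤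
      ∑ k : Fin H, P.stageCost (v k)
        (P.plant.C.mulVec (z k.castSucc) + P.plant.D.mulVec (v k)) := by
  have hjl' : (j : ℕ∞) ≤ last := le_trans (by norm_cast; omega) hjl
  by_cases ht : (t : ℕ∞) < (M j).T
  swap
  -- After the end, the padded trajectory rests at the target and its cost is zero.
  · refine (le_of_eq ?_).trans (Finset.sum_nonneg fun k _ => stageCost_nonneg hP _ _)
    refine Finset.sum_eq_zero fun k _ => ?_
    have h1 : ¬ ((t + k : ℕ) : ℕ∞) < (M j).T := fun h =>
      ht (lt_of_le_of_lt (by norm_cast; omega) h)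
    rw [pad_u_of_not_lt h1, pad_y_of_not_lt h1, stageCost_target]
  have hg := hrun.pad_generates hP hj hjl'
  have hg' := hrun.pad_generates hP (j := j + 1) (by omega) hjl
  have hsafe := hrun.safe hP hj hjl'
  have h0 : (P.pad (M (j + 1))).ext ℓ 0 = (P.pad (M j)).ext ℓ 0 := by
    rw [pad_ext_of_le (by simp), pad_ext_of_le (by simp), (hrun.measured _ hjl).2,
      (hrun.measured _ hjl').2]
  have hupad : ∀ k, (P.pad (M (j + 1))).u (k + ℓ) = (P.pad (M j)).u (k + ℓ) := fun k => by
    rw [pad_u, pad_u, inputs, inputs, hT]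
    split_ifs with hk
    · exact hu k hk
    · rfl
  have hext : ∀ k, (P.pad (M (j + 1))).ext ℓ k = (P.pad (M j)).ext ℓ k := fun k => by
    have := ext_congr hP hg' rfl hg rfl h0 (K := k) (fun i _ => by simpa using hupad i) k le_rfl
    simpa using this
  have hypad : ∀ k, (P.pad (M (j + 1))).y (k + ℓ) = (P.pad (M j)).y (k + ℓ) := fun k => by
    rw [output_eq hP hg' rfl, output_eq hP hg rfl, hext, hupad]
  have hctg : P.costToGo (M (j + 1)) t = P.costToGo (P.pad (M j)) t := by
    rw [← costToGo_pad]
    exact costToGo_congr (w := P.pad (M (j + 1))) (w' := P.pad (M j)) rfl fun k _ => ⟨hupad _, hypad _⟩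
  have ht' : (t : ℕ∞) < (M (j + 1)).T := by rw [hT]; exact ht
  obtain ⟨d, hd, hdu⟩ := hrun.later_input (j + 1) (by omega) hjl t ht'
  have hlow := hrun.costToGo_le_objective hP (by omega) hjl ht' hd hdu
  have hgg := (P.plant.generates_top_iff rfl).1 hg
  obtain ⟨w', hw', hT', ha, hb, hc⟩ := exists_spliced P.plant hgg hz0 hz hzH
  have hW := hrun.later_stored j hj hjl'
  have hsW : P.Safe (W j) := hW ▸ hsafe
  -- The spliced path has its time origin at `t`. It rejoins iteration `j` in state after `H` steps
  -- and copies it for `ℓ` more, which makes its extended state after `N = H + ℓ` steps a stored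
  -- one.
  have hup := hrun.objective_le (Nat.lt_succ_self j) hsW hd hw' hT' (t := 0) (s := t + P.N)
    (by
      rw [← pad_ext_of_le ht'.le, hext]
      exact ext_congr_samples fun i hi => by rw [zero_add]; exact ha i hi)
    (fun k hk => by
      rw [zero_add]
      by_cases hkH : k < H
      · rw [(hb ⟨k, hkH⟩).1, (hb ⟨k, hkH⟩).2]
        exact hmem _
      · obtain ⟨i, rfl⟩ := Nat.exists_eq_add_of_le (not_lt.1 hkH)
        rw [show H + i + ℓ = H + ℓ + i by omega, (hc i).1, (hc i).2,
          show t + (H + ℓ + i) = t + H + i + ℓ by omega]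
        exact hsafe.pad_mem (hrun.measured j hjl').1.1 _)
    (by
      rw [hW]
      refine ext_congr_samples fun i _ => ?_
      rw [hH, zero_add, add_assoc t]
      exact hc i)
  rw [hW] at hup
  have htail : ∀ k, P.costAt w' (0 + (H + k)) = P.costAt (P.pad (M j)) (t + (H + k)) := fun k => by
    rw [costAt, costAt, zero_add, show H + k + ℓ = H + ℓ + k by omega, (hc k).1, (hc k).2,
      show t + (H + ℓ + k) = t + (H + k) + ℓ by omega]
  have h1 := hlow.trans hup
  rw [hctg, costToGo_split rfl t P.N, hH, Finset.sum_range_add, Finset.sum_range_add] at h1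
  simp only [htail, add_assoc] at h1
  -- The common tail can be cancelled in `ℝ≥0∞` only because it is finite.
  have hfin : (∑ k ∈ Finset.range ℓ, P.costAt (P.pad (M j)) (t + (H + k))) +
      P.costToGo (P.pad (M j)) (t + (H + ℓ)) ≠ ⊤ := by
    refine ENNReal.add_ne_top.2 ⟨ENNReal.sum_ne_top.2 fun k _ => ENNReal.ofReal_ne_top, ?_⟩
    rw [costToGo_pad]
    exact costToGo_ne_top hsafe _
  have h2 := (ENNReal.add_le_add_iff_right hfin).1 h1
  simp only [zero_add] at h2
  refine (stageCost_sum_le_of_costAt hP h2).trans (le_of_eq ?_)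
  exact Finset.sum_congr rfl fun k _ => by rw [(hb k).1, (hb k).2]

end RepTask

/-! ### Stationarity of the Lagrangian of window problems -/

theorem exists_dotProduct_eq {n : ℕ} (α : (Fin n → ℝ) →ₗ[ℝ] ℝ) :
    ∃ a : Fin n → ℝ, ∀ ζ, α ζ = a ⬝ᵥ ζ := by
  refine ⟨fun j => α (Pi.single j 1), fun ζ => ?_⟩
  rw [LinearMap.pi_apply_eq_sum_univ α ζ, dotProduct]
  refine Finset.sum_congr rfl fun j _ => ?_
  rw [smul_eq_mul, mul_comm]
  congr 2
  funext i
  simp [Pi.single_apply, eq_comm]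

/-- The linear functional `ζ ↦ a ⬝ᵥ ζ`. -/
def dotLin {n : ℕ} (a : Fin n → ℝ) : (Fin n → ℝ) →ₗ[ℝ] ℝ where
  toFun ζ := a ⬝ᵥ ζ
  map_add' := dotProduct_add a
  map_smul' c ζ := by simp

@[simp]
theorem dotLin_apply {n : ℕ} (a ζ : Fin n → ℝ) : dotLin a ζ = a ⬝ᵥ ζ := rfl

namespace RepTask

variable {n m p ℓ : ℕ} (P : RepTask n m p ℓ)

/-- The input and the output as functions of the state and the input. -/
def io : (Fin n → ℝ) × (Fin m → ℝ) →ₗ[ℝ] (Fin m → ℝ) × (Fin p → ℝ) :=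
  (LinearMap.snd ℝ _ _).prod
    (P.plant.C.mulVecLin ∘ₗ LinearMap.fst ℝ _ _ + P.plant.D.mulVecLin ∘ₗ LinearMap.snd ℝ _ _)

theorem io_apply (x : Fin n → ℝ) (u : Fin m → ℝ) :
    P.io (x, u) = (u, P.plant.C.mulVec x + P.plant.D.mulVec u) := rfl

/-- Input and output at step `k` of an `H`-step problem. -/
def ioSlot {H : ℕ} (k : Fin H) : OcpVar n m H →L[ℝ] (Fin m → ℝ) × (Fin p → ℝ) :=
  (LinearMap.toContinuousLinearMap P.io).comp
    (((ContinuousLinearMap.proj k.castSucc).comp (ContinuousLinearMap.fst ℝ _ _)).prod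
      ((ContinuousLinearMap.proj k).comp (ContinuousLinearMap.snd ℝ _ _)))

theorem ioSlot_apply {H : ℕ} (k : Fin H) (z : OcpVar n m H) :
    P.ioSlot k z = P.io (z.1 k.castSucc, z.2 k) := rfl

/-- The stage cost as a function of the input-output pair. -/
def stage (w : (Fin m → ℝ) × (Fin p → ℝ)) : ℝ := P.stageCost w.1 w.2

theorem contDiff_stage : ContDiff ℝ 1 P.stage := by
  unfold stage stageCost
  simp only [dotProduct, Matrix.mulVec, Pi.sub_apply]
  fun_prop

/-- A weighted sum of constraint gradients at the input-output pair `w`. -/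
def cstr {r s : ℕ} (g : Fin r → (Fin m → ℝ) → ℝ) (q : Fin s → (Fin p → ℝ) → ℝ)
    (w : (Fin m → ℝ) × (Fin p → ℝ)) (μ : Fin r → ℝ) (ν : Fin s → ℝ) :
    (Fin m → ℝ) × (Fin p → ℝ) →ₗ[ℝ] ℝ :=
  ∑ i, μ i • ((fderiv ℝ (g i) w.1 : (Fin m → ℝ) →ₗ[ℝ] ℝ) ∘ₗ LinearMap.fst ℝ _ _) +
    ∑ i, ν i • ((fderiv ℝ (q i) w.2 : (Fin p → ℝ) →ₗ[ℝ] ℝ) ∘ₗ LinearMap.snd ℝ _ _)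

theorem cstr_apply {r s : ℕ} (g : Fin r → (Fin m → ℝ) → ℝ) (q : Fin s → (Fin p → ℝ) → ℝ)
    (w : (Fin m → ℝ) × (Fin p → ℝ)) (μ : Fin r → ℝ) (ν : Fin s → ℝ)
    (d : (Fin m → ℝ) × (Fin p → ℝ)) :
    cstr g q w μ ν d = ∑ i, μ i * fderiv ℝ (g i) w.1 d.1 + ∑ i, ν i * fderiv ℝ (q i) w.2 d.2 := by
  simp [cstr]

theorem cstr_sub {r s : ℕ} (g : Fin r → (Fin m → ℝ) → ℝ) (q : Fin s → (Fin p → ℝ) → ℝ)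
    (w : (Fin m → ℝ) × (Fin p → ℝ)) (μ μ' : Fin r → ℝ) (ν ν' : Fin s → ℝ) :
    cstr g q w (μ - μ') (ν - ν') = cstr g q w μ ν - cstr g q w μ' ν' := by
  refine LinearMap.ext fun d => ?_
  simp only [cstr_apply, LinearMap.sub_apply, Pi.sub_apply, sub_mul, Finset.sum_sub_distrib]
  ring

/-- Stationarity of the Lagrangian of an `H`-step problem with fixed end points; `θ k` is the
derivative of the terms that depend on the input-output pair at step `k`, and `lam k` is the multiplier
of the dynamics from step `k` to step `k + 1`. -/
def Stationary {H : ℕ} (θ : Fin H → (Fin m → ℝ) × (Fin p → ℝ) →ₗ[ℝ] ℝ) (lam : Fin H → Fin n → ℝ)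
    (α β : (Fin n → ℝ) →ₗ[ℝ] ℝ) : Prop :=
  ∀ (ζ : Fin (H + 1) → Fin n → ℝ) (v : Fin H → Fin m → ℝ),
    ∑ k, (θ k (P.io (ζ k.castSucc, v k)) + lam k ⬝ᵥ (ζ k.succ -
      (P.plant.A.mulVec (ζ k.castSucc) + P.plant.B.mulVec (v k)))) +
      α (ζ 0) + β (ζ (Fin.last H)) = 0

variable {P}

theorem Stationary.sub {H : ℕ} {θ θ' : Fin H → (Fin m → ℝ) × (Fin p → ℝ) →ₗ[ℝ] ℝ}
    {lam lam' : Fin H → Fin n → ℝ} {α β α' β' : (Fin n → ℝ) →ₗ[ℝ] ℝ}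
    (h : P.Stationary θ lam α β) (h' : P.Stationary θ' lam' α' β') :
    P.Stationary (θ - θ') (lam - lam') (α - α') (β - β') := by
  intro ζ v
  have h1 := h ζ v
  have h2 := h' ζ v
  simp only [Finset.sum_add_distrib] at h1 h2
  simp only [Pi.sub_apply, LinearMap.sub_apply, sub_dotProduct, Finset.sum_add_distrib,
    Finset.sum_sub_distrib]
  linarith

/-- Test with variations that vanish at the first step; the multiplier of the first transition
becomes the functional on the new initial state. -/
theorem Stationary.tail {H : ℕ} {θ : Fin (H + 1) → (Fin m → ℝ) × (Fin p → ℝ) →ₗ[ℝ] ℝ}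
    {lam : Fin (H + 1) → Fin n → ℝ} {α β : (Fin n → ℝ) →ₗ[ℝ] ℝ} (h : P.Stationary θ lam α β) :
    P.Stationary (fun k => θ k.succ) (fun k => lam k.succ) (dotLin (lam 0)) β := by
  intro ζ v
  have h1 := h (Fin.cons 0 ζ) (Fin.cons 0 v)
  rw [Fin.sum_univ_succ, ← Fin.succ_last] at h1
  simp only [Fin.cons_succ, Fin.cons_zero, Fin.castSucc_zero, ← Fin.succ_castSucc,
    Matrix.mulVec_zero, add_zero, sub_zero, map_zero, ← Prod.zero_eq_mk, zero_add] at h1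
  rw [dotLin_apply]
  linarith

/-- Test with a zero last input and a zero final state; what remains of the last step depends only
on the state before it and is absorbed in `β'`. -/
theorem Stationary.init {H : ℕ} {θ : Fin (H + 1) → (Fin m → ℝ) × (Fin p → ℝ) →ₗ[ℝ] ℝ}
    {lam : Fin (H + 1) → Fin n → ℝ} {α β : (Fin n → ℝ) →ₗ[ℝ] ℝ} (h : P.Stationary θ lam α β) :
    ∃ β', P.Stationary (fun k => θ k.castSucc) (fun k => lam k.castSucc) α β' := by
  refine ⟨θ (Fin.last H) ∘ₗ P.io ∘ₗ LinearMap.inl ℝ _ _ -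
    dotLin (lam (Fin.last H)) ∘ₗ P.plant.A.mulVecLin, fun ζ v => ?_⟩
  have h1 := h (Fin.snoc ζ 0) (Fin.snoc v 0)
  rw [Fin.sum_univ_castSucc] at h1
  have e0 : (Fin.snoc ζ 0 : Fin (H + 2) → Fin n → ℝ) 0 = ζ 0 := by
    rw [← Fin.castSucc_zero, Fin.snoc_castSucc]
  simp only [Fin.snoc_castSucc, Fin.succ_castSucc, Fin.succ_last, Fin.snoc_last, e0, map_zero,
    Matrix.mulVec_zero, add_zero, zero_sub, dotProduct_neg] at h1
  simp only [LinearMap.sub_apply, LinearMap.comp_apply, LinearMap.inl_apply, dotLin_apply,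
    Matrix.mulVecLin_apply]
  linarith

/-- Variations supported at the first step give the costate equation there. -/
theorem Stationary.head {H : ℕ} {θ : Fin (H + 1) → (Fin m → ℝ) × (Fin p → ℝ) →ₗ[ℝ] ℝ}
    {lam : Fin (H + 1) → Fin n → ℝ} {α β : (Fin n → ℝ) →ₗ[ℝ] ℝ} (h : P.Stationary θ lam α β)
    (ζ : Fin n → ℝ) (v : Fin m → ℝ) :
    θ 0 (P.io (ζ, v)) + α ζ =
      lam 0 ⬝ᵥ (P.plant.A.mulVec ζ + P.plant.B.mulVec v) := by
  have h1 := h (Fin.cons ζ 0) (Fin.cons v 0)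
  rw [Fin.sum_univ_succ, ← Fin.succ_last] at h1
  simp only [Fin.cons_succ, Fin.cons_zero, Fin.castSucc_zero, ← Fin.succ_castSucc, Pi.zero_apply,
    Matrix.mulVec_zero, add_zero, sub_zero, map_zero, ← Prod.zero_eq_mk, dotProduct_zero, zero_sub,
    Finset.sum_const_zero, dotProduct_neg] at h1
  linarith

section Gradients

variable {r s : ℕ} {g : Fin r → (Fin m → ℝ) → ℝ} {q : Fin s → (Fin p → ℝ) → ℝ}

theorem fderiv_comp_slot {H : ℕ} {F : (Fin m → ℝ) × (Fin p → ℝ) → ℝ} (hF : ContDiff ℝ 1 F)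
    (k : Fin H) (z d : OcpVar n m H) :
    fderiv ℝ (fun z => F (P.ioSlot k z)) z d = fderiv ℝ F (P.ioSlot k z) (P.ioSlot k d) := by
  have h1 : HasFDerivAt F (fderiv ℝ F (P.ioSlot k z)) (P.ioSlot k z) :=
    (hF.differentiable one_ne_zero _).hasFDerivAt
  rw [show fderiv ℝ (fun z => F (P.ioSlot k z)) z = _ from
    (h1.comp z (P.ioSlot k).hasFDerivAt).fderiv]
  rfl

theorem contDiff_ocpIneq (hg : ∀ i, ContDiff ℝ 1 (g i)) (hq : ∀ i, ContDiff ℝ 1 (q i)) (H : ℕ)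
    (c : (Fin H × Fin r) ⊕ P.OcpOutIdx H q) : ContDiff ℝ 1 (P.ocpIneq H g q c) := by
  rcases c with c | c
  · exact (hg c.2).comp (contDiff_fst.comp (P.ioSlot c.1).contDiff)
  · exact (hq c.1.2).comp (contDiff_snd.comp (P.ioSlot c.1.1).contDiff)

theorem fderiv_ocpIneq_inl (hg : ∀ i, ContDiff ℝ 1 (g i)) {H : ℕ} (c : Fin H × Fin r)
    (z d : OcpVar n m H) :
    fderiv ℝ (P.ocpIneq H g q (Sum.inl c)) z d = fderiv ℝ (g c.2) (z.2 c.1) (d.2 c.1) := by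
  have h1 : HasFDerivAt (g c.2) (fderiv ℝ (g c.2) (z.2 c.1)) (z.2 c.1) :=
    ((hg c.2).differentiable one_ne_zero _).hasFDerivAt
  have h2 := h1.comp z ((ContinuousLinearMap.fst ℝ _ _).comp (P.ioSlot c.1)).hasFDerivAt
  rw [show fderiv ℝ (P.ocpIneq H g q (Sum.inl c)) z = _ from h2.fderiv]
  rfl

theorem fderiv_ocpIneq_inr (hq : ∀ i, ContDiff ℝ 1 (q i)) {H : ℕ} (c : P.OcpOutIdx H q)
    (z d : OcpVar n m H) :
    fderiv ℝ (P.ocpIneq H g q (Sum.inr c)) z d =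
      fderiv ℝ (q c.1.2) (P.ioSlot c.1.1 z).2 (P.ioSlot c.1.1 d).2 := by
  have h1 : HasFDerivAt (q c.1.2) (fderiv ℝ (q c.1.2) (P.ioSlot c.1.1 z).2)
      (P.ioSlot c.1.1 z).2 := ((hq c.1.2).differentiable one_ne_zero _).hasFDerivAt
  have h2 := h1.comp z ((ContinuousLinearMap.snd ℝ _ _).comp (P.ioSlot c.1.1)).hasFDerivAt
  rw [show fderiv ℝ (P.ocpIneq H g q (Sum.inr c)) z = _ from h2.fderiv]
  rfl

variable (P) in
/-- The equality constraints with end points zero, as linear functionals. -/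
def ocpEqLin (H : ℕ) (c : (Fin n ⊕ (Fin H × Fin n)) ⊕ Fin n) : OcpVar n m H →L[ℝ] ℝ :=
  LinearMap.toContinuousLinearMap
    { toFun := P.ocpEq H 0 0 c
      map_add' := fun z z' => by
        rcases c with (i | c) | i <;> (simp [ocpEq, Matrix.mulVec_add]; try ring)
      map_smul' := fun t z => by
        rcases c with (i | c) | i <;> (simp [ocpEq, Matrix.mulVec_smul]; try ring) }

theorem ocpEq_eq (H : ℕ) (a b : Fin n → ℝ) (c : (Fin n ⊕ (Fin H × Fin n)) ⊕ Fin n) :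
    P.ocpEq H a b c = fun z => P.ocpEqLin H c z -
      Sum.elim (Sum.elim a fun _ => 0) b c := by
  funext z
  rcases c with (i | c) | i <;> simp [ocpEq, ocpEqLin]

theorem contDiff_ocpEq (H : ℕ) (a b : Fin n → ℝ) (c : (Fin n ⊕ (Fin H × Fin n)) ⊕ Fin n) :
    ContDiff ℝ 1 (P.ocpEq H a b c) := by
  rw [ocpEq_eq]
  exact (P.ocpEqLin H c).contDiff.sub contDiff_const

theorem fderiv_ocpEq (H : ℕ) (a b : Fin n → ℝ) (c : (Fin n ⊕ (Fin H × Fin n)) ⊕ Fin n)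
    (z : OcpVar n m H) : fderiv ℝ (P.ocpEq H a b c) z = P.ocpEqLin H c := by
  rw [ocpEq_eq]
  exact ((P.ocpEqLin H c).hasFDerivAt.sub_const _).fderiv

theorem sum_ocpEqLin {H : ℕ} (a : (Fin n ⊕ (Fin H × Fin n)) ⊕ Fin n → ℝ) (d : OcpVar n m H) :
    ∑ c, a c * P.ocpEqLin H c d = (∑ k : Fin H, (fun i => a (Sum.inl (Sum.inr (k, i)))) ⬝ᵥ
        (d.1 k.succ - (P.plant.A.mulVec (d.1 k.castSucc) + P.plant.B.mulVec (d.2 k)))) +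
      (fun i => a (Sum.inl (Sum.inl i))) ⬝ᵥ d.1 0 +
      (fun i => a (Sum.inr i)) ⬝ᵥ d.1 (Fin.last H) := by
  simp only [Fintype.sum_sum_type, Fintype.sum_prod_type, dotProduct]
  simp only [ocpEqLin, LinearMap.coe_toContinuousLinearMap', LinearMap.coe_mk, AddHom.coe_mk, ocpEq,
    Sum.elim_inl, Sum.elim_inr, Pi.zero_apply, sub_zero, Pi.sub_apply]
  ring

open scoped Classical in
-- Output constraints not listed at the first step receive multiplier zero, so the sum can be
-- grouped by time step.
theorem sum_ocpIneq (hg : ∀ i, ContDiff ℝ 1 (g i)) (hq : ∀ i, ContDiff ℝ 1 (q i)) {H : ℕ}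
    (b : (Fin H × Fin r) ⊕ P.OcpOutIdx H q → ℝ) (z d : OcpVar n m H) :
    ∑ c, b c * fderiv ℝ (P.ocpIneq H g q c) z d =
      ∑ k : Fin H, cstr g q (P.ioSlot k z) (fun i => b (Sum.inl (k, i)))
        (fun i => if h : _ then b (Sum.inr ⟨(k, i), h⟩) else 0) (P.ioSlot k d) := by
  rw [Fintype.sum_sum_type]
  simp only [fderiv_ocpIneq_inl hg, fderiv_ocpIneq_inr hq, cstr_apply, Finset.sum_add_distrib]
  rw [Fintype.sum_prod_type]
  congr 1
  refine Eq.trans ?_ (Fintype.sum_prod_type (fun c : Fin H × Fin s =>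
    (if h : (c.1 : ℕ) = 0 → ∃ y v, q c.2 (y + P.plant.D.mulVec v) ≠ q c.2 y then
      b (Sum.inr ⟨c, h⟩) else 0) * fderiv ℝ (q c.2) (P.ioSlot c.1 z).2 (P.ioSlot c.1 d).2))
  rw [sum_eq_sum_active (p := fun c : Fin H × Fin s =>
    (c.1 : ℕ) = 0 → ∃ y v, q c.2 (y + P.plant.D.mulVec v) ≠ q c.2 y) fun c hc => dif_neg hc]
  refine Finset.sum_congr rfl fun c _ => ?_
  rw [dif_pos c.2]

end Gradients

end RepTask

/-! ### Gluing the window multipliers to a costate -/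

theorem fderiv_apply_eq_zero_of_const {E : Type*} [NormedAddCommGroup E] [NormedSpace ℝ E]
    {F : E → ℝ} {x v : E} (hF : DifferentiableAt ℝ F x) (h : ∀ t : ℝ, F (x + t • v) = F x) :
    fderiv ℝ F x v = 0 := by
  have h1 : HasDerivAt (fun t : ℝ => F (x + t • v)) (fderiv ℝ F x v) 0 :=
    hF.hasFDerivAt.hasLineDerivAt v
  simp only [h] at h1
  exact h1.unique (hasDerivAt_const _ _)

namespace RepTask

variable {n m p ℓ : ℕ} {P : RepTask n m p ℓ}
  {r s : ℕ} {g : Fin r → (Fin m → ℝ) → ℝ} {q : Fin s → (Fin p → ℝ) → ℝ}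

/-- Constraint multipliers at an input-output pair: nonnegative, and zero for inactive constraints. -/
def IsDual (g : Fin r → (Fin m → ℝ) → ℝ) (q : Fin s → (Fin p → ℝ) → ℝ)
    (w : (Fin m → ℝ) × (Fin p → ℝ)) (μ : Fin r → ℝ) (ν : Fin s → ℝ) : Prop :=
  (∀ i, 0 ≤ μ i ∧ (g i w.1 ≠ 0 → μ i = 0)) ∧ ∀ i, 0 ≤ ν i ∧ (q i w.2 ≠ 0 → ν i = 0)

open scoped Classical in
/-- Under LICQ the multipliers of the dynamics are unique. -/
theorem multiplier_unique (hg : ∀ i, ContDiff ℝ 1 (g i)) (hq : ∀ i, ContDiff ℝ 1 (q i)) {H : ℕ}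
    {a b : Fin n → ℝ} {z : OcpVar n m (H + 1)}
    (hL : LICQ (P.ocpEq (H + 1) a b) (P.ocpIneq (H + 1) g q) z)
    {μ : Fin (H + 1) → Fin r → ℝ} {ν : Fin (H + 1) → Fin s → ℝ}
    (hμ : ∀ k i, g i (P.ioSlot k z).1 ≠ 0 → μ k i = 0)
    (hν : ∀ k i, q i (P.ioSlot k z).2 ≠ 0 → ν k i = 0)
    {lam : Fin (H + 1) → Fin n → ℝ} {α β : (Fin n → ℝ) →ₗ[ℝ] ℝ}
    (hst : P.Stationary (fun k => cstr g q (P.ioSlot k z) (μ k) (ν k)) lam α β) : lam = 0 := by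
  -- LICQ says nothing about output constraints dropped at the first step, yet `ν 0` may charge
  -- them. They are insensitive to the input, so their contribution `γ` depends on the initial state
  -- variation alone and is moved into the multiplier of the initial condition.
  let ν' : Fin (H + 1) → Fin s → ℝ := fun k i =>
    if (k : ℕ) = 0 → ∃ y v, q i (y + P.plant.D.mulVec v) ≠ q i y then ν k i else 0
  let γ : (Fin n → ℝ) →ₗ[ℝ] ℝ :=
    cstr g q (P.ioSlot 0 z) (0 : Fin r → ℝ) (ν 0 - ν' 0) ∘ₗ P.io ∘ₗ LinearMap.inl ℝ _ _
  have hsucc : ∀ k : Fin H, ν' k.succ = ν k.succ := fun k => by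
    funext i
    exact if_pos fun h => absurd h (by simp)
  have hzero : ∀ ζ v, cstr g q (P.ioSlot 0 z) (μ 0) (ν 0) (P.io (ζ, v)) =
      cstr g q (P.ioSlot 0 z) (μ 0) (ν' 0) (P.io (ζ, v)) + γ ζ := by
    intro ζ v
    have h1 := LinearMap.congr_fun (cstr_sub g q (P.ioSlot 0 z) (μ 0) (μ 0) (ν 0) (ν' 0))
      (P.io (ζ, v))
    rw [LinearMap.sub_apply, sub_self] at h1
    have h2 : P.io (ζ, v) = P.io (ζ, 0) + P.io (0, v) := by
      rw [← map_add]; simp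
    have h3 : cstr g q (P.ioSlot 0 z) (0 : Fin r → ℝ) (ν 0 - ν' 0) (P.io (0, v)) = 0 := by
      rw [cstr_apply, io_apply]
      simp only [Pi.zero_apply, zero_mul, Finset.sum_const_zero, zero_add, Matrix.mulVec_zero]
      refine Finset.sum_eq_zero fun i _ => ?_
      by_cases hi : ∃ y v, q i (y + P.plant.D.mulVec v) ≠ q i y
      · have : ν' 0 i = ν 0 i := if_pos fun _ => hi
        rw [Pi.sub_apply, this, sub_self, zero_mul]
      · push Not at hi
        rw [fderiv_apply_eq_zero_of_const ((hq i).differentiable one_ne_zero _), mul_zero]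
        intro t
        rw [← Matrix.mulVec_smul]
        exact hi _ _
    have h4 : γ ζ = cstr g q (P.ioSlot 0 z) (0 : Fin r → ℝ) (ν 0 - ν' 0) (P.io (ζ, 0)) := rfl
    have h5 : cstr g q (P.ioSlot 0 z) (0 : Fin r → ℝ) (ν 0 - ν' 0) (P.io (ζ, v)) = γ ζ := by
      rw [h2, map_add, h3, add_zero, h4]
    linarith
  obtain ⟨a', ha'⟩ := exists_dotProduct_eq (α + γ)
  obtain ⟨b', hb'⟩ := exists_dotProduct_eq β
  let A : (Fin n ⊕ (Fin (H + 1) × Fin n)) ⊕ Fin n → ℝ :=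
    Sum.elim (Sum.elim a' fun c => lam c.1 c.2) b'
  let B : (Fin (H + 1) × Fin r) ⊕ P.OcpOutIdx (H + 1) q → ℝ :=
    Sum.elim (fun c => μ c.1 c.2) fun c => ν c.1.1 c.1.2
  have h0 := LICQ.eq_zero hL (a := A) (b := B) ?_ ?_
  · funext k i
    exact h0 (Sum.inl (Sum.inr (k, i)))
  · rintro (c | c) hc
    · exact hμ c.1 c.2 hc
    · exact hν c.1.1 c.1.2 hc
  · intro d
    simp only [fderiv_ocpEq]
    rw [sum_ocpEqLin, sum_ocpIneq hg hq]
    have h1 := hst d.1 d.2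
    have h2 : ∀ k : Fin (H + 1), (fun i => if h : (k : ℕ) = 0 →
        ∃ y v, q i (y + P.plant.D.mulVec v) ≠ q i y then B (Sum.inr ⟨(k, i), h⟩) else 0) = ν' k := by
      intro k
      funext i
      simp only [ν', B, Sum.elim_inr, dite_eq_ite]
    simp only [h2]
    have h3 : ∑ k, cstr g q (P.ioSlot k z) (μ k) (ν k) (P.io (d.1 k.castSucc, d.2 k)) =
        ∑ k, cstr g q (P.ioSlot k z) (μ k) (ν' k) (P.ioSlot k d) + γ (d.1 0) := by
      simp only [ioSlot_apply _ _ d]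
      rw [Fin.sum_univ_succ, Fin.sum_univ_succ, Fin.castSucc_zero, hzero]
      simp only [hsucc]
      ring
    rw [Finset.sum_add_distrib, h3] at h1
    have h4 := ha' (d.1 0)
    have h5 := hb' (d.1 (Fin.last (H + 1)))
    rw [LinearMap.add_apply] at h4
    simp only [A, B, Sum.elim_inl, Sum.elim_inr]
    rw [← h4, ← h5]
    linarith

/-- Without steps, the initial and final conditions constrain the same state and have equal
gradients, so independence leaves no state coordinate. This settles the case `N = ℓ + 1`. -/
theorem eq_zero_of_licq_zero {a b : Fin n → ℝ} {z : OcpVar n m 0}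
    (hL : LICQ (P.ocpEq 0 a b) (P.ocpIneq 0 g q) z) : IsEmpty (Fin n) := by
  refine ⟨fun i => ?_⟩
  have h1 := hL.injective (a₁ := Sum.inl (Sum.inl (Sum.inl i))) (a₂ := Sum.inl (Sum.inr i)) (by
    simp only [Sum.elim_inl, fderiv_ocpEq]
    ext d <;> simp [ocpEqLin, ocpEq])
  simp at h1

variable (P) in
/-- The window of `H` steps from time `t`. -/
def window (H : ℕ) (x : ℕ → Fin n → ℝ) (u : ℕ → Fin m → ℝ) (t : ℕ) : OcpVar n m H :=
  (fun k => x (t + k), fun k => u (t + k))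

theorem ioSlot_window {H : ℕ} (x : ℕ → Fin n → ℝ) (u : ℕ → Fin m → ℝ) (t : ℕ) (k : Fin H) :
    P.ioSlot k (window H x u t) = P.io (x (t + k), u (t + k)) := rfl

variable (P) in
/-- The cost of an `H`-step path. -/
def ocpCost (H : ℕ) (z : OcpVar n m H) : ℝ := ∑ k, P.stage (P.ioSlot k z)

theorem contDiff_ocpCost (H : ℕ) : ContDiff ℝ 1 (P.ocpCost H) :=
  ContDiff.sum fun k _ => P.contDiff_stage.comp (P.ioSlot k).contDiff

theorem fderiv_ocpCost {H : ℕ} (z d : OcpVar n m H) :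
    fderiv ℝ (P.ocpCost H) z d = ∑ k, fderiv ℝ P.stage (P.ioSlot k z) (P.ioSlot k d) := by
  have h1 : fderiv ℝ (P.ocpCost H) z = ∑ k, fderiv ℝ (fun z => P.stage (P.ioSlot k z)) z :=
    fderiv_fun_sum fun k _ =>
      (P.contDiff_stage.comp (P.ioSlot k).contDiff).differentiable one_ne_zero _
  rw [h1, _root_.sum_apply]
  exact Finset.sum_congr rfl fun k _ => fderiv_comp_slot P.contDiff_stage k z d

variable (P) in
/-- Gradient of the Lagrangian of a single step. -/
def lagr (g : Fin r → (Fin m → ℝ) → ℝ) (q : Fin s → (Fin p → ℝ) → ℝ)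
    (w : (Fin m → ℝ) × (Fin p → ℝ)) (μ : Fin r → ℝ) (ν : Fin s → ℝ) :
    (Fin m → ℝ) × (Fin p → ℝ) →ₗ[ℝ] ℝ :=
  (fderiv ℝ P.stage w : (Fin m → ℝ) × (Fin p → ℝ) →ₗ[ℝ] ℝ) + cstr g q w μ ν

variable (P) in
/-- Each window of `H` steps is optimal among the admissible paths with the same end points. -/
def WindowOptimal (g : Fin r → (Fin m → ℝ) → ℝ) (q : Fin s → (Fin p → ℝ) → ℝ) (H : ℕ)
    (x : ℕ → Fin n → ℝ) (u : ℕ → Fin m → ℝ) : Prop :=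
  ∀ t, ∀ z : OcpVar n m H, (∀ c, P.ocpEq H (x t) (x (t + H)) c z = 0) →
    (∀ k, (∀ i, g i (P.ioSlot k z).1 ≤ 0) ∧ ∀ i, q i (P.ioSlot k z).2 ≤ 0) →
    P.ocpCost H (window H x u t) ≤ P.ocpCost H z

end RepTask

namespace RepTask

variable {n m p ℓ : ℕ} {P : RepTask n m p ℓ}
  {r s : ℕ} {g : Fin r → (Fin m → ℝ) → ℝ} {q : Fin s → (Fin p → ℝ) → ℝ}
  {x : ℕ → Fin n → ℝ} {u : ℕ → Fin m → ℝ}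

theorem ocpEq_window (hdyn : ∀ t, x (t + 1) = P.plant.A.mulVec (x t) + P.plant.B.mulVec (u t))
    (H t : ℕ) (c : (Fin n ⊕ (Fin H × Fin n)) ⊕ Fin n) :
    P.ocpEq H (x t) (x (t + H)) c (window H x u t) = 0 := by
  rcases c with (i | ⟨k, i⟩) | i
  · simp [ocpEq, window]
  · have := congrFun (hdyn (t + k)) i
    simp only [ocpEq, window, Sum.elim_inl, Sum.elim_inr, Fin.val_succ, Fin.val_castSucc]
    rw [← add_assoc, this, sub_self]
  · simp [ocpEq, window]

/-- A dropped first-step constraint holds anyway: the initial state is that of the reference path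
and the constraint ignores the input, so its value is the one on the reference path. -/
theorem constraints_of_ocp {H t : ℕ}
    (hcon : ∀ t, (∀ i, g i (P.io (x t, u t)).1 ≤ 0) ∧ ∀ i, q i (P.io (x t, u t)).2 ≤ 0)
    {z : OcpVar n m H} (he : ∀ c, P.ocpEq H (x t) (x (t + H)) c z = 0)
    (hf : ∀ c, P.ocpIneq H g q c z ≤ 0) (k : Fin H) :
    (∀ i, g i (P.ioSlot k z).1 ≤ 0) ∧ ∀ i, q i (P.ioSlot k z).2 ≤ 0 := by
  refine ⟨fun i => hf (Sum.inl (k, i)), fun i => ?_⟩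
  by_cases hc : (k : ℕ) = 0 → ∃ y v, q i (y + P.plant.D.mulVec v) ≠ q i y
  · exact hf (Sum.inr ⟨(k, i), hc⟩)
  · push Not at hc
    obtain ⟨hk, hc⟩ := hc
    have h0 : z.1 k.castSucc = x t := by
      have hk' : k.castSucc = 0 := Fin.ext hk
      rw [hk']
      funext i
      exact sub_eq_zero.1 (he (Sum.inl (Sum.inl i)))
    have h1 := (hcon t).2 i
    rw [io_apply, hc] at h1
    rw [ioSlot_apply, h0, io_apply, hc]
    exact h1

open scoped Classical in
theorem exists_window_multipliers (hg : ∀ i, ContDiff ℝ 1 (g i)) (hq : ∀ i, ContDiff ℝ 1 (q i))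
    (hdyn : ∀ t, x (t + 1) = P.plant.A.mulVec (x t) + P.plant.B.mulVec (u t))
    (hcon : ∀ t, (∀ i, g i (P.io (x t, u t)).1 ≤ 0) ∧ ∀ i, q i (P.io (x t, u t)).2 ≤ 0)
    {H : ℕ} (hopt : P.WindowOptimal g q H x u) (hL : P.WindowLICQ g q H x u) (t : ℕ) :
    ∃ (a : (Fin n ⊕ (Fin H × Fin n)) ⊕ Fin n → ℝ) (b : (Fin H × Fin r) ⊕ P.OcpOutIdx H q → ℝ),
      (∀ c, 0 ≤ b c) ∧ (∀ c, P.ocpIneq H g q c (window H x u t) ≠ 0 → b c = 0) ∧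
      ∀ d, fderiv ℝ (P.ocpCost H) (window H x u t) d +
        ∑ c, a c * fderiv ℝ (P.ocpEq H (x t) (x (t + H)) c) (window H x u t) d +
        ∑ c, b c * fderiv ℝ (P.ocpIneq H g q c) (window H x u t) d = 0 := by
  refine LICQ.exists_multipliers (fun c => contDiff_ocpEq H _ _ c) (contDiff_ocpIneq hg hq H)
    (contDiff_ocpCost H) (ocpEq_window hdyn H t) ?_ (hL t) fun z he hf =>
      hopt t z he (constraints_of_ocp hcon he hf)
  rintro (c | c)
  · exact (hcon (t + c.1)).1 c.2
  · exact (hcon (t + c.1.1)).2 c.1.2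

open scoped Classical in
theorem stationary_of_multipliers (hg : ∀ i, ContDiff ℝ 1 (g i)) (hq : ∀ i, ContDiff ℝ 1 (q i))
    {H t : ℕ} {a : (Fin n ⊕ (Fin H × Fin n)) ⊕ Fin n → ℝ}
    {b : (Fin H × Fin r) ⊕ P.OcpOutIdx H q → ℝ} (hb0 : ∀ c, 0 ≤ b c)
    (hb : ∀ c, P.ocpIneq H g q c (window H x u t) ≠ 0 → b c = 0)
    (h : ∀ d, fderiv ℝ (P.ocpCost H) (window H x u t) d +
        ∑ c, a c * fderiv ℝ (P.ocpEq H (x t) (x (t + H)) c) (window H x u t) d +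
        ∑ c, b c * fderiv ℝ (P.ocpIneq H g q c) (window H x u t) d = 0) :
    ∃ (μ : Fin H → Fin r → ℝ) (ν : Fin H → Fin s → ℝ) (α β : (Fin n → ℝ) →ₗ[ℝ] ℝ),
      (∀ k : Fin H, IsDual g q (P.io (x (t + k), u (t + k))) (μ k) (ν k)) ∧
      P.Stationary (fun k : Fin H => P.lagr g q (P.io (x (t + k), u (t + k))) (μ k) (ν k))
        (fun k i => a (Sum.inl (Sum.inr (k, i)))) α β := by
  refine ⟨fun k i => b (Sum.inl (k, i)), fun k i => if h : (k : ℕ) = 0 →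
    ∃ y v, q i (y + P.plant.D.mulVec v) ≠ q i y then b (Sum.inr ⟨(k, i), h⟩) else 0,
    dotLin fun i => a (Sum.inl (Sum.inl i)), dotLin fun i => a (Sum.inr i),
    fun k => ⟨fun i => ⟨hb0 _, fun hi => hb (Sum.inl (k, i)) hi⟩, fun i => ?_⟩, fun ζ v => ?_⟩
  · dsimp only
    split_ifs with hc
    · exact ⟨hb0 _, fun hi => hb (Sum.inr ⟨(k, i), hc⟩) hi⟩
    · exact ⟨le_rfl, fun _ => rfl⟩
  · have h1 := h (ζ, v)
    simp only [fderiv_ocpEq] at h1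
    rw [sum_ocpEqLin, sum_ocpIneq hg hq, fderiv_ocpCost] at h1
    simp only [ioSlot_window] at h1
    simp only [ioSlot_apply] at h1
    simp only [lagr, LinearMap.add_apply, dotLin_apply, Finset.sum_add_distrib,
      ContinuousLinearMap.coe_coe]
    linarith

/-- Along a sequence all of whose windows are optimal there is a bounded sequence of multipliers of
the dynamics such that the Lagrangian is stationary at each step. -/
theorem exists_costate (hg : ∀ i, ContDiff ℝ 1 (g i)) (hq : ∀ i, ContDiff ℝ 1 (q i))
    (hdyn : ∀ t, x (t + 1) = P.plant.A.mulVec (x t) + P.plant.B.mulVec (u t))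
    (hcon : ∀ t, (∀ i, g i (P.io (x t, u t)).1 ≤ 0) ∧ ∀ i, q i (P.io (x t, u t)).2 ≤ 0)
    (hx : Tendsto x atTop (𝓝 P.xF)) (hu : Tendsto u atTop (𝓝 P.uF)) {H : ℕ}
    (hopt : P.WindowOptimal g q (H + 1) x u) (hL : P.WindowLICQ g q (H + 1) x u)
    (hL' : P.WindowLICQ g q H x u)
    (hLF : P.WindowLICQ g q (H + 1) (fun _ => P.xF) (fun _ => P.uF)) :
    ∃ Λ : ℕ → Fin n → ℝ, (∃ K, ∀ᶠ t in atTop, ∀ i, |Λ t i| ≤ K) ∧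
      (∃ μ ν, IsDual g q (P.io (x 0, u 0)) μ ν ∧ ∀ v,
        P.lagr g q (P.io (x 0, u 0)) μ ν (P.io (0, v)) = Λ 0 ⬝ᵥ P.plant.B.mulVec v) ∧
      ∀ t, ∃ μ ν, IsDual g q (P.io (x (t + 1), u (t + 1))) μ ν ∧ ∀ ζ v,
        P.lagr g q (P.io (x (t + 1), u (t + 1))) μ ν (P.io (ζ, v)) + Λ t ⬝ᵥ ζ =
          Λ (t + 1) ⬝ᵥ (P.plant.A.mulVec ζ + P.plant.B.mulVec v) := by
  classical
  choose a b hb0 hb hab using exists_window_multipliers hg hq hdyn hcon hopt hL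
  choose μ ν α β hdual hst using fun t =>
    stationary_of_multipliers hg hq (hb0 t) (hb t) (hab t)
  -- The costate at `t` will be the multiplier of the first transition in the window starting at
  -- `t`.
  let lam : ℕ → Fin (H + 1) → Fin n → ℝ := fun t k i => a t (Sum.inl (Sum.inr (k, i)))
  refine ⟨fun t => lam t 0, ?_, ⟨μ 0 0, ν 0 0, ?_, fun v => ?_⟩, fun t => ?_⟩
  · have hzs : Tendsto (window (H + 1) x u) atTop
        (𝓝 ((fun _ => P.xF, fun _ => P.uF) : OcpVar n m (H + 1))) := by
      refine Tendsto.prodMk_nhds (tendsto_pi_nhds.2 fun k => ?_) (tendsto_pi_nhds.2 fun k => ?_)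
      · exact hx.comp (tendsto_add_atTop_nat (k : ℕ))
      · exact hu.comp (tendsto_add_atTop_nat (k : ℕ))
    obtain ⟨K, hK⟩ := LICQ.eventually_bounded (hLF 0) (contDiff_ocpIneq hg hq (H + 1))
      (contDiff_ocpCost (P := P) (H + 1)) hzs
      (es := fun t => P.ocpEq (H + 1) (x t) (x (t + (H + 1))))
      (fun t c => by rw [fderiv_ocpEq, fderiv_ocpEq]) hb hab
    exact ⟨K, hK.mono fun t ht i => ht _⟩
  · exact hdual 0 0
  · have h1 := (hst 0).head 0 v
    rw [map_zero, add_zero, Matrix.mulVec_zero] at h1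
    exact h1.trans (by rw [zero_add])
  · cases H with
    | zero =>
      have hn := eq_zero_of_licq_zero (hL' 0)
      refine ⟨μ (t + 1) 0, ν (t + 1) 0, hdual (t + 1) 0, fun ζ v => ?_⟩
      have h1 := (hst (t + 1)).head ζ v
      rw [Subsingleton.elim ζ 0] at h1 ⊢
      rw [map_zero, add_zero] at h1
      rw [dotProduct_zero, add_zero]
      exact h1
    | succ H =>
      have h1 := (hst t).tail
      obtain ⟨β', h2⟩ := (hst (t + 1)).init
      have hidx : ∀ k : Fin (H + 1), t + (k.succ : ℕ) = t + 1 + (k.castSucc : ℕ) := fun k => by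
        simp only [Fin.val_succ, Fin.val_castSucc]; omega
      -- On the overlap of the windows from `t` and `t + 1` both Lagrangians are stationary. In the
      -- difference the cost gradients cancel and only constraint gradients remain, so LICQ on the
      -- overlap forces the multipliers of the dynamics to agree.
      have h3 : P.Stationary (fun k => cstr g q (P.ioSlot k (window (H + 1) x u (t + 1)))
          (μ t k.succ - μ (t + 1) k.castSucc) (ν t k.succ - ν (t + 1) k.castSucc))
          ((fun k : Fin (H + 1) => lam t k.succ) - fun k => lam (t + 1) k.castSucc)
          (dotLin (lam t 0) - α (t + 1)) (β t - β') := by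
        have h4 := h1.sub h2
        convert h4 using 1
        funext k
        rw [ioSlot_window, cstr_sub, Pi.sub_apply, hidx, lagr, lagr, add_sub_add_left_eq_sub]
        rfl
      have h5 := multiplier_unique hg hq (hL' (t + 1)) (fun k i hi => ?_) (fun k i hi => ?_) h3
      · have h6 : lam t 1 = lam (t + 1) 0 := sub_eq_zero.1 (congrFun h5 0)
        -- The constraint multipliers at `t + 1` come from the second step of window `t`. In window
        -- `t + 1` this time is the first step, where the functional `α` on the initial state is
        -- unknown.
        refine ⟨μ t 1, ν t 1, hdual t 1, fun ζ v => ?_⟩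
        have h7 := h1.head ζ v
        change _ = lam (t + 1) 0 ⬝ᵥ _
        rw [← h6]
        exact h7
      · have h8 := ((hdual t k.succ).1 i).2
        rw [hidx] at h8
        have h9 := ((hdual (t + 1) k.castSucc).1 i).2
        rw [Pi.sub_apply, h8 hi, h9 hi, sub_zero]
      · have h8 := ((hdual t k.succ).2 i).2
        rw [hidx] at h8
        have h9 := ((hdual (t + 1) k.castSucc).2 i).2
        rw [Pi.sub_apply, h8 hi, h9 hi, sub_zero]

end RepTask

/-! ### Sufficiency by convexity, and passage to the infinite horizon -/

/-- Along the segment towards `y`, which stays in `U`, `F` starts at zero and remains nonpositive.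
Only the set has to be convex, not the function describing it. -/
theorem fderiv_sub_nonpos_of_active {E : Type*} [NormedAddCommGroup E] [NormedSpace ℝ E]
    {F : E → ℝ} {U : Set E} (hU : Convex ℝ U) {x y : E} (hF : DifferentiableAt ℝ F x)
    (hle : ∀ z ∈ U, F z ≤ 0) (hx : x ∈ U) (hy : y ∈ U) (h0 : F x = 0) :
    fderiv ℝ F x (y - x) ≤ 0 := by
  have h1 : HasDerivAt (fun t : ℝ => F (x + t • (y - x))) (fderiv ℝ F x (y - x)) 0 :=
    hF.hasFDerivAt.hasLineDerivAt (y - x)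
  refine le_of_tendsto h1.tendsto_slope_zero_right ?_
  filter_upwards [Ioo_mem_nhdsGT (zero_lt_one' ℝ)] with t ht
  simp only [zero_add, zero_smul, add_zero, h0, sub_zero, smul_eq_mul]
  exact mul_nonpos_of_nonneg_of_nonpos (inv_nonneg.2 ht.1.le)
    (hle _ (hU.add_smul_sub_mem hx hy ⟨ht.1.le, ht.2.le⟩))

theorem tendsto_dotProduct_zero {n : ℕ} {Λ δ : ℕ → Fin n → ℝ} {K : ℝ}
    (hK : ∀ᶠ t in atTop, ∀ i, |Λ t i| ≤ K) (hδ : Tendsto δ atTop (𝓝 0)) :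
    Tendsto (fun t => Λ t ⬝ᵥ δ t) atTop (𝓝 0) := by
  have h0 : Tendsto (fun t => ∑ i, K * |δ t i|) atTop (𝓝 0) := by
    have h1 : Tendsto (fun t => ∑ i, K * |δ t i|) atTop (𝓝 (∑ i : Fin n, K * |(0 : ℝ)|)) :=
      tendsto_finsetSum _ fun i _ => ((tendsto_pi_nhds.1 hδ i).abs).const_mul K
    simpa using h1
  refine squeeze_zero_norm' ?_ h0
  filter_upwards [hK] with t ht
  refine (norm_sum_le _ _).trans (Finset.sum_le_sum fun i _ => ?_)
  rw [norm_mul, Real.norm_eq_abs, Real.norm_eq_abs]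
  exact mul_le_mul_of_nonneg_right (ht i) (abs_nonneg _)

namespace RepTask

variable {n m p ℓ : ℕ} {P : RepTask n m p ℓ}
  {r s : ℕ} {g : Fin r → (Fin m → ℝ) → ℝ} {q : Fin s → (Fin p → ℝ) → ℝ}

theorem stage_gradient_le (hP : P.Standing) (w w' : (Fin m → ℝ) × (Fin p → ℝ)) :
    P.stage w + fderiv ℝ P.stage w (w' - w) ≤ P.stage w' := by
  obtain ⟨b, hb⟩ := stageCost_line (P := P) w.1 (w'.1 - w.1) w.2 (w'.2 - w.2)
  have h1 : HasDerivAt (fun t : ℝ => P.stage (w + t • (w' - w)))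
      (fderiv ℝ P.stage w (w' - w)) 0 :=
    (P.contDiff_stage.differentiable one_ne_zero w).hasFDerivAt.hasLineDerivAt (w' - w)
  have h2 : (fun t : ℝ => P.stage (w + t • (w' - w))) = fun t =>
      P.stageCost w.1 w.2 + t * b + t ^ 2 * P.quad (w'.1 - w.1) (w'.2 - w.2) := funext hb
  have h3 : HasDerivAt (fun t : ℝ =>
      P.stageCost w.1 w.2 + t * b + t ^ 2 * P.quad (w'.1 - w.1) (w'.2 - w.2)) b 0 := by
    have h4 := (((hasDerivAt_id (0 : ℝ)).mul_const b).const_add (P.stageCost w.1 w.2)).add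
      (((hasDerivAt_id (0 : ℝ)).pow 2).mul_const (P.quad (w'.1 - w.1) (w'.2 - w.2)))
    exact HasDerivAt.congr_deriv h4 (by simp)
  rw [h2] at h1
  rw [h1.unique h3]
  have h5 := hb 1
  have hq := quad_nonneg hP (w'.1 - w.1) (w'.2 - w.2)
  rw [one_smul, one_smul, add_sub_cancel, add_sub_cancel] at h5
  rw [stage, stage, h5]
  linarith

theorem cstr_nonpos (hP : P.Standing) (hg : ∀ i, ContDiff ℝ 1 (g i))
    (hq : ∀ i, ContDiff ℝ 1 (q i)) (hU : P.U = {u | ∀ i, g i u ≤ 0})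
    (hY : P.Y = {y | ∀ i, q i y ≤ 0}) {w w' : (Fin m → ℝ) × (Fin p → ℝ)} {μ : Fin r → ℝ}
    {ν : Fin s → ℝ} (hd : IsDual g q w μ ν) (hw : w.1 ∈ P.U ∧ w.2 ∈ P.Y)
    (hw' : w'.1 ∈ P.U ∧ w'.2 ∈ P.Y) : cstr g q w μ ν (w' - w) ≤ 0 := by
  rw [cstr_apply]
  refine add_nonpos (Finset.sum_nonpos fun i _ => ?_) (Finset.sum_nonpos fun i _ => ?_)
  · by_cases hi : g i w.1 = 0
    · refine mul_nonpos_of_nonneg_of_nonpos (hd.1 i).1 (fderiv_sub_nonpos_of_active hP.U_convex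
        ((hg i).differentiable one_ne_zero _) (fun z hz => ?_) hw.1 hw'.1 hi)
      rw [hU] at hz
      exact hz i
    · rw [(hd.1 i).2 hi, zero_mul]
  · by_cases hi : q i w.2 = 0
    · refine mul_nonpos_of_nonneg_of_nonpos (hd.2 i).1 (fderiv_sub_nonpos_of_active hP.Y_convex
        ((hq i).differentiable one_ne_zero _) (fun z hz => ?_) hw.2 hw'.2 hi)
      rw [hY] at hz
      exact hz i
    · rw [(hd.2 i).2 hi, zero_mul]

/-- The gradient inequality of the convex stage cost survives adding the constraint terms, since
these are nonpositive in admissible directions. -/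
theorem stage_lagr_le (hP : P.Standing) (hg : ∀ i, ContDiff ℝ 1 (g i))
    (hq : ∀ i, ContDiff ℝ 1 (q i)) (hU : P.U = {u | ∀ i, g i u ≤ 0})
    (hY : P.Y = {y | ∀ i, q i y ≤ 0}) {w w' : (Fin m → ℝ) × (Fin p → ℝ)} {μ : Fin r → ℝ}
    {ν : Fin s → ℝ} (hd : IsDual g q w μ ν) (hw : w.1 ∈ P.U ∧ w.2 ∈ P.Y)
    (hw' : w'.1 ∈ P.U ∧ w'.2 ∈ P.Y) :
    P.stage w + P.lagr g q w μ ν (w' - w) ≤ P.stage w' := by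
  have h1 := stage_gradient_le hP w w'
  have h2 := cstr_nonpos hP hg hq hU hY hd hw hw'
  have h3 : P.lagr g q w μ ν (w' - w) = fderiv ℝ P.stage w (w' - w) + cstr g q w μ ν (w' - w) := rfl
  linarith

/-- The costate bounds the cost of every admissible path from the same state. -/
theorem sum_stage_le (hP : P.Standing) (hg : ∀ i, ContDiff ℝ 1 (g i))
    (hq : ∀ i, ContDiff ℝ 1 (q i)) (hU : P.U = {u | ∀ i, g i u ≤ 0})
    (hY : P.Y = {y | ∀ i, q i y ≤ 0}) {x x' : ℕ → Fin n → ℝ} {u u' : ℕ → Fin m → ℝ}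
    (hdyn : ∀ t, x (t + 1) = P.plant.A.mulVec (x t) + P.plant.B.mulVec (u t))
    (hdyn' : ∀ t, x' (t + 1) = P.plant.A.mulVec (x' t) + P.plant.B.mulVec (u' t))
    (hcon : ∀ t, (P.io (x t, u t)).1 ∈ P.U ∧ (P.io (x t, u t)).2 ∈ P.Y)
    (hcon' : ∀ t, (P.io (x' t, u' t)).1 ∈ P.U ∧ (P.io (x' t, u' t)).2 ∈ P.Y)
    (h0 : x' 0 = x 0) {Λ : ℕ → Fin n → ℝ}
    (hΛ0 : ∃ μ ν, IsDual g q (P.io (x 0, u 0)) μ ν ∧ ∀ v,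
        P.lagr g q (P.io (x 0, u 0)) μ ν (P.io (0, v)) = Λ 0 ⬝ᵥ P.plant.B.mulVec v)
    (hΛ : ∀ t, ∃ μ ν, IsDual g q (P.io (x (t + 1), u (t + 1))) μ ν ∧ ∀ ζ v,
        P.lagr g q (P.io (x (t + 1), u (t + 1))) μ ν (P.io (ζ, v)) + Λ t ⬝ᵥ ζ =
          Λ (t + 1) ⬝ᵥ (P.plant.A.mulVec ζ + P.plant.B.mulVec v)) (K : ℕ) :
    ∑ k ∈ Finset.range (K + 1), P.stage (P.io (x k, u k)) +
        Λ K ⬝ᵥ (x' (K + 1) - x (K + 1)) ≤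
      ∑ k ∈ Finset.range (K + 1), P.stage (P.io (x' k, u' k)) := by
  have hδ : ∀ t, x' (t + 1) - x (t + 1) =
      P.plant.A.mulVec (x' t - x t) + P.plant.B.mulVec (u' t - u t) := fun t => by
    rw [hdyn, hdyn', Matrix.mulVec_sub, Matrix.mulVec_sub]
    abel
  have hio : ∀ t, P.io (x' t, u' t) - P.io (x t, u t) = P.io (x' t - x t, u' t - u t) := fun t => by
    rw [← map_sub, Prod.mk_sub_mk]
  induction K with
  | zero =>
    obtain ⟨μ, ν, hd, hst⟩ := hΛ0
    have h1 := stage_lagr_le hP hg hq hU hY hd (hcon 0) (hcon' 0)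
    rw [hio, h0, sub_self, hst] at h1
    rw [Finset.sum_range_one, Finset.sum_range_one, hδ, h0, sub_self, Matrix.mulVec_zero, zero_add]
    exact h1
  | succ K ih =>
    -- By the costate equation the Lagrangian derivative along the difference at time `K + 1` equals
    -- the increment of the boundary term, so the sum telescopes.
    obtain ⟨μ, ν, hd, hst⟩ := hΛ K
    have h1 := stage_lagr_le hP hg hq hU hY hd (hcon (K + 1)) (hcon' (K + 1))
    rw [hio] at h1
    have h2 := hst (x' (K + 1) - x (K + 1)) (u' (K + 1) - u (K + 1))
    rw [← hδ (K + 1)] at h2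
    rw [Finset.sum_range_succ, Finset.sum_range_succ _ (K + 1)]
    linarith

/-- Realizes a competitor of the infinite-horizon problem, given only by its inputs, as a plant
trajectory with the same past; the costate argument needs its states. -/
theorem exists_traj_of_inputs {w : Traj n m p} (hw : P.plant.Generates ℓ w) (hT : w.T = ⊤)
    (u' : ℕ → Fin m → ℝ) :
    ∃ w' : Traj n m p, P.plant.Generates ℓ w' ∧ w'.T = ⊤ ∧ w'.ext ℓ 0 = w.ext ℓ 0 ∧
      ∀ k, w'.u (k + ℓ) = u' k := by
  have hg := (P.plant.generates_top_iff hT).1 hw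
  let us : ℕ → Fin m → ℝ := fun k => if k < ℓ then w.u k else u' (k - ℓ)
  have hus : ∀ k < ℓ, us k = w.u k := fun k hk => if_pos hk
  refine ⟨P.plant.sim (w.x 0) us, P.plant.sim_generates ℓ _ _, rfl, ?_, fun k => ?_⟩
  · refine ext_congr_samples fun i hi => ?_
    rw [zero_add]
    refine ⟨hus i hi, ?_⟩
    have h1 := P.plant.stateSeq_eq (fun k _ => (hg k).1) hus i hi.le
    change P.plant.C.mulVec (P.plant.stateSeq _ us i) + P.plant.D.mulVec (us i) = _
    rw [h1, hus i hi, (hg i).2]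
  · change us (k + ℓ) = _
    simp [us]

/-- A fixed partial sum of `c` is below every longer one, hence below the full sum of `c'` minus `ε
K₂`; then `K₂` tends to infinity. Summability of `c` is not presupposed. -/
theorem tsum_ofReal_le_of_sum_le {c c' ε : ℕ → ℝ} (hc : ∀ k, 0 ≤ c k) (hc' : ∀ k, 0 ≤ c' k)
    (hfin : ∑' k, ENNReal.ofReal (c' k) ≠ ⊤) (hε : Tendsto ε atTop (𝓝 0))
    (h : ∀ K, ∑ k ∈ Finset.range (K + 1), c k + ε K ≤ ∑ k ∈ Finset.range (K + 1), c' k) :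
    ∑' k, ENNReal.ofReal (c k) ≤ ∑' k, ENNReal.ofReal (c' k) := by
  have hs : Summable c' := by
    have := ENNReal.summable_toReal hfin
    exact this.congr fun k => ENNReal.toReal_ofReal (hc' k)
  rw [← ENNReal.ofReal_tsum_of_nonneg hc' hs]
  refine ENNReal.tsum_le_of_sum_range_le fun K => ?_
  rw [← ENNReal.ofReal_sum_of_nonneg fun k _ => hc k]
  refine ENNReal.ofReal_le_ofReal ?_
  have hlim : Tendsto (fun K₂ => ∑' k, c' k - ε K₂) atTop (𝓝 (∑' k, c' k)) := by
    simpa using hε.const_sub (∑' k, c' k)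
  refine ge_of_tendsto hlim ?_
  filter_upwards [eventually_ge_atTop K] with K₂ hK₂
  have h1 := h K₂
  have h2 : ∑ k ∈ Finset.range K, c k ≤ ∑ k ∈ Finset.range (K₂ + 1), c k :=
    Finset.sum_le_sum_of_subset_of_nonneg (Finset.range_mono (by omega)) fun k _ _ => hc k
  have h3 := hs.sum_le_tsum (Finset.range (K₂ + 1)) fun k _ => hc' k
  linarith

variable {M W : ℕ → Traj n m p} {jb tb : ℕ} {last : ℕ∞}

theorem IsRun.solvesInf (hP : P.Standing) (hrun : P.IsRun M W jb tb last) {j : ℕ}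
    (hj : jb < j) (hjl : ((j + 1 : ℕ) : ℕ∞) ≤ last) (hT : (M (j + 1)).T = (M j).T)
    (hu : ∀ t : ℕ, (t : ℕ∞) < (M j).T → (M (j + 1)).u (t + ℓ) = (M j).u (t + ℓ))
    (hg : ∀ i, ContDiff ℝ 1 (g i)) (hq : ∀ i, ContDiff ℝ 1 (q i))
    (hU : P.U = {u | ∀ i, g i u ≤ 0}) (hY : P.Y = {y | ∀ i, q i y ≤ 0}) (hN : ℓ < P.N)
    (hL : P.LICQAlong g q (P.states (M j)) (P.inputs (M j)))
    (hLF : P.LICQAlong g q (fun _ => P.xF) (fun _ => P.uF)) :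
    P.SolvesInf (P.inputs (M j)) := by
  have hjl' : (j : ℕ∞) ≤ last := le_trans (by norm_cast; omega) hjl
  obtain ⟨H, hH⟩ : ∃ H, P.N = (H + 1) + ℓ := ⟨P.N - ℓ - 1, by omega⟩
  have hsafe := hrun.safe hP hj hjl'
  obtain ⟨hgen, hext0⟩ := hrun.measured j hjl'
  have hpg := hrun.pad_generates hP hj hjl'
  have hgg := (P.plant.generates_top_iff rfl).1 hpg
  have hp0 : (P.pad (M j)).ext ℓ 0 = P.ξS := by rw [pad_ext_of_le (by simp), hext0]
  have hin : ∀ k, P.inputs (M j) k = (P.pad (M j)).u (k + ℓ) := fun k => (pad_u _ _).symm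
  set x := P.states (M j) with hx
  set u := P.inputs (M j) with hudef
  have hxp : ∀ k, x k = (P.pad (M j)).x (k + ℓ) := fun k => (pad_x _ _).symm
  have hdyn : ∀ t, x (t + 1) = P.plant.A.mulVec (x t) + P.plant.B.mulVec (u t) := fun t => by
    rw [hxp, hxp, hin, add_right_comm, (hgg _).1]
  have hio : ∀ t, P.io (x t, u t) = ((P.pad (M j)).u (t + ℓ), (P.pad (M j)).y (t + ℓ)) := fun t => by
    rw [io_apply, hxp, hin, (hgg _).2]
  have hmem : ∀ t, (P.io (x t, u t)).1 ∈ P.U ∧ (P.io (x t, u t)).2 ∈ P.Y := fun t => by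
    rw [hio]
    exact hsafe.pad_mem hgen.1 t
  have hctop : P.costToGo (P.pad (M j)) 0 ≠ ⊤ := by
    rw [costToGo_pad]
    exact costToGo_ne_top hsafe 0
  have hconv := tendsto_ext hP hpg rfl hctop
  have hxlim : Tendsto x atTop (𝓝 P.xF) :=
    ((tendsto_x hP hpg rfl hconv).comp (tendsto_add_atTop_nat ℓ)).congr fun k => (hxp k).symm
  have hulim : Tendsto u atTop (𝓝 P.uF) :=
    ((tendsto_u P hconv).comp (tendsto_add_atTop_nat ℓ)).congr fun k => (hin k).symm
  have hopt : P.WindowOptimal g q (H + 1) x u := by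
    intro t z he hf
    have h1 := hrun.window_optimal hP hj hjl hT hu hH t (z := z.1) (v := z.2)
      (by rw [← hxp]; exact funext fun i => sub_eq_zero.1 (he (Sum.inl (Sum.inl i))))
      (fun k => funext fun i => sub_eq_zero.1 (he (Sum.inl (Sum.inr (k, i)))))
      (by rw [← hxp]; exact funext fun i => sub_eq_zero.1 (he (Sum.inr i)))
      (fun k => ⟨by rw [hU]; exact (hf k).1, by rw [hY]; exact (hf k).2⟩)
    refine le_trans (le_of_eq (Finset.sum_congr rfl fun k _ => ?_)) h1
    rw [ioSlot_window, hio]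
    rfl
  have hNH : P.N - ℓ = H + 1 := by omega
  have hNH' : P.N - ℓ - 1 = H := by omega
  rw [LICQAlong, hNH', hNH] at hL hLF
  obtain ⟨Λ, ⟨K, hK⟩, hΛ0, hΛ⟩ := exists_costate hg hq hdyn
    (fun t => by have h1 := hmem t; rw [hU, hY] at h1; exact h1) hxlim hulim hopt hL.1 hL.2 hLF.1
  refine ⟨fun k => ?_, fun u' hu' => ?_⟩
  · rw [output_eq_y hP hpg rfl hp0 hin, hin]
    exact hsafe.pad_mem hgen.1 k
  · by_cases hfin : P.infCost u' = ⊤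
    · rw [hfin]; exact le_top
    obtain ⟨w', hw', hT', he', hwu⟩ := exists_traj_of_inputs hpg rfl u'
    have hw0 : w'.ext ℓ 0 = P.ξS := he'.trans hp0
    have hin' : ∀ k, u' k = w'.u (k + ℓ) := fun k => (hwu k).symm
    have hgg' := (P.plant.generates_top_iff hT').1 hw'
    have hcost' := infCost_eq hP hw' hT' hw0 hin'
    -- Finite cost forces the competitor to the same limit `xF`, so its difference from the
    -- closed-loop state tends to zero and the bounded costate cannot keep the boundary term alive.
    have hconv' := tendsto_x hP hw' hT' (tendsto_ext hP hw' hT' (hcost' ▸ hfin))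
    let x' : ℕ → Fin n → ℝ := fun k => w'.x (k + ℓ)
    have hx0 : x' 0 = x 0 := by
      rw [hxp]
      exact state_congr hP hw' hT' hpg rfl he'
    have hio' : ∀ t, P.io (x' t, u' t) = (w'.u (t + ℓ), w'.y (t + ℓ)) := fun t => by
      rw [io_apply, hin', (hgg' _).2]
    have hmem' : ∀ t, (P.io (x' t, u' t)).1 ∈ P.U ∧ (P.io (x' t, u' t)).2 ∈ P.Y := fun t => by
      rw [hio', ← output_eq_y hP hw' hT' hw0 hin', ← hin']
      exact hu' t
    have hsum := sum_stage_le hP hg hq hU hY hdyn (x' := x') (u' := u')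
      (fun t => by
        rw [hin', show x' (t + 1) = w'.x (t + ℓ + 1) by simp only [x', add_right_comm]]
        exact (hgg' _).1)
      hmem hmem' hx0 hΛ0 hΛ
    have hδ : Tendsto (fun t => x' (t + 1) - x (t + 1)) atTop (𝓝 0) := by
      have h1 := (hconv'.comp (tendsto_add_atTop_nat (1 + ℓ))).sub
        (hxlim.comp (tendsto_add_atTop_nat 1))
      rw [sub_self] at h1
      refine h1.congr fun t => ?_
      simp only [x', Function.comp, add_assoc]
    have hstage : ∀ t, P.stage (P.io (x t, u t)) = P.stageCost (u t) (P.output u t) := fun t => by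
      rw [hio, output_eq_y hP hpg rfl hp0 hin, hin]
      rfl
    have hstage' : ∀ t, P.stage (P.io (x' t, u' t)) = P.stageCost (u' t) (P.output u' t) :=
      fun t => by
        rw [hio', output_eq_y hP hw' hT' hw0 hin', hin']
        rfl
    simp only [hstage, hstage'] at hsum
    exact tsum_ofReal_le_of_sum_le (fun k => stageCost_nonneg hP _ _)
      (fun k => stageCost_nonneg hP _ _) hfin (tendsto_dotProduct_zero hK hδ) hsum

end RepTask

end

theorem mainTheorem6 {n m p ℓ : ℕ} (P : RepTask n m p ℓ) (hP : P.Standing)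
    (M W : ℕ → Traj n m p) (jb tb : ℕ) (last : ℕ∞) (hrun : P.IsRun M W jb tb last) :
    (∀ j : ℕ, jb < j → ((j + 1 : ℕ) : ℕ∞) ≤ last →
      P.costToGo (M (j + 1)) 0 ≤ P.costToGo (M j) 0) ∧
    (∀ j : ℕ, jb < j → ((j + 1 : ℕ) : ℕ∞) ≤ last →
      (M (j + 1)).T = (M j).T →
      (∀ t : ℕ, (t : ℕ∞) < (M j).T → (M (j + 1)).u (t + ℓ) = (M j).u (t + ℓ)) →
      ∀ (r s : ℕ) (g : Fin r → (Fin m → ℝ) → ℝ) (q : Fin s → (Fin p → ℝ) → ℝ),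
        (∀ i, ContDiff ℝ 1 (g i)) → (∀ i, ContDiff ℝ 1 (q i)) →
        P.U = {u | ∀ i, g i u ≤ 0} → P.Y = {y | ∀ i, q i y ≤ 0} →
        ℓ < P.N →
        P.LICQAlong g q (P.states (M j)) (P.inputs (M j)) →
        P.LICQAlong g q (fun _ => P.xF) (fun _ => P.uF) →
        P.SolvesInf (P.inputs (M j))) := by
  refine ⟨fun j hj hjl => hrun.costToGo_antitone hP hj hjl, ?_⟩
  intro j hj hjl hT hu r s g q hg hq hU hY hN hL hLF
  exact hrun.solvesInf hP hj hjl hT hu hg hq hU hY hN hL hLF
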